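/- Let $m,n\ge 0$, $\Lambda\in\{1,0,-1\}$, $H=\mathrm O(m,n)$, and let $G=\mathrm O(m,n+1)$, $\mathrm{IO}(m,n)=\mathrm O(m,n)\ltimes\mathbb R^{m,n}$ or $\mathrm O(m+1,n)$ for $\Lambda=1,0,-1$ respectively. Here $\mathbb R^{m,n}$ carries the metric $\eta=\mathrm{diag}(-1,\dots,-1,1,\dots,1)$ ($m$ times $-1$, $n$ times $+1$), and $\mathfrak g=\mathfrak h\oplus\mathfrak z$ is the $\mathrm{Ad}(H)$-invariant splitting of the Lie algebra of $G$ with $\mathfrak h=\mathfrak o(m,n)$ and $\mathfrak z\cong\mathbb R^{m,n}$. Let $(\pi:\mathcal P\to M,A)$ be a smooth Cartan geometry modeled on $G/H$: $\pi$ is a smooth principal $H$-bundle over a smooth manifold $M$, and $A$ is a smooth $\mathfrak g$-valued $1$-form on $\mathcal P$ such that every $A_p:T_p\mathcal P\to\mathfrak g$ is a linear isomorphism, $(R_h)^*A=\mathrm{Ad}(h^{-1})\circ A$ for all $h\in H$, and $A(\tilde X)=X$ for the fundamental vector field $\tilde X$ of every $X\in\mathfrak h$. Write $A=\omega+e$ according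 to $\mathfrak g=\mathfrak h\oplus\mathfrak z$. Each $p\in\mathcal P$ over $x\in M$ defines a linear isomorphism $\phi(p):\mathbb R^{m,n}\cong\mathfrak z\to T_xM$, $\phi(p)(z)=\pi_*(A_p^{-1}(z))$. The map $\phi$ embeds $\mathcal P$ into the linear frame bundle $\mathrm{GL}(M)$; its image $P$ is the admissible frame bundle, with Cartan connection $\tilde A=(\phi^{-1})^*A$. The associated Riemann--Cartan geometry on $M$ consists of the metric $g(v,w)=\eta(\phi(p)^{-1}v,\phi(p)^{-1}w)$ (for any $p\in\mathcal P_x$, $v,w\in T_xM$), so that $P$ is the orthonormal frame bundle of $g$, and of the covariant derivative $\nabla$ induced by $\omega$, that is, $\phi(p)^{-1}(\nabla_vX)=v^h\big(q\mapsto\phi(q)^{-1}(X_{\pi(q)})\big)$ with $v^h\in T_p\mathcal P$ the $\omega$-horizontal lift of $v$; its torsion is $T(X,Y)=\nabla_XY-\nabla_YX-[X,Y]$. For a smooth vector field $\xi$ on $M$ let $\bar\xi=\xi^a\partial_a+f_i^b\,\partial_b\xi^a\,\frac{\partial}{\partial f_i^a}$ be its complete lift to $\mathrm{GL}(M)$,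 in induced coordinates $(x^a,f_i^a)$. The Cartan geometry is called invariant under $\xi$ if $\bar\xi$ is tangent to $P$ and $\mathcal L_{\bar\xi}\tilde A=0$ on $P$. Then for every smooth vector field $\xi$ on $M$: 1. the Cartan geometry is invariant under $\xi$ if and only if $\mathcal L_\xi g=0$ and $\mathcal L_\xi T=0$; 2. $\bar\xi$ is tangent to $P$ if and only if $\mathcal L_\xi g=0$. -/

import Mathlib

open Matrix
open scoped Manifold ContDiff

noncomputable section

namespace RiemannCartan

/-! ### The orthogonal Klein geometries -/

/-- The linear group preserving the bilinear form with matrix `J`. -/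
def formGroup {κ : Type} [Fintype κ] [DecidableEq κ] (J : Matrix κ κ ℝ) :
    Subgroup (GL κ ℝ) where
  carrier := {B | (B : Matrix κ κ ℝ)ᵀ * J * (B : Matrix κ κ ℝ) = J}
  one_mem' := by simp
  mul_mem' := by
    intro a b ha hb
    simp only [Set.mem_ofPred_eq, Units.val_mul, Matrix.transpose_mul] at *
    calc (b : Matrix κ κ ℝ)ᵀ * (a : Matrix κ κ ℝ)ᵀ * J * (a * b : Matrix κ κ ℝ)
        = (b : Matrix κ κ ℝ)ᵀ * ((a : Matrix κ κ ℝ)ᵀ * J * (a : Matrix κ κ ℝ)) * b := by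
          simp only [Matrix.mul_assoc]
      _ = J := by rw [ha, hb]
  inv_mem' := by
    intro a ha
    simp only [Set.mem_ofPred_eq] at *
    have h1 : (a : Matrix κ κ ℝ) * ((a⁻¹ : GL κ ℝ) : Matrix κ κ ℝ) = 1 := by
      rw [← Units.val_mul]; simp
    have h2 : ((a⁻¹ : GL κ ℝ) : Matrix κ κ ℝ)ᵀ * (a : Matrix κ κ ℝ)ᵀ = 1 := by
      rw [← Matrix.transpose_mul, h1, Matrix.transpose_one]
    calc ((a⁻¹ : GL κ ℝ) : Matrix κ κ ℝ)ᵀ * J * ((a⁻¹ : GL κ ℝ) : Matrix κ κ ℝ)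
        = ((a⁻¹ : GL κ ℝ) : Matrix κ κ ℝ)ᵀ * ((a : Matrix κ κ ℝ)ᵀ * J * (a : Matrix κ κ ℝ))
            * ((a⁻¹ : GL κ ℝ) : Matrix κ κ ℝ) := by rw [ha]
      _ = (((a⁻¹ : GL κ ℝ) : Matrix κ κ ℝ)ᵀ * (a : Matrix κ κ ℝ)ᵀ) * J
            * ((a : Matrix κ κ ℝ) * ((a⁻¹ : GL κ ℝ) : Matrix κ κ ℝ)) := by
          simp only [Matrix.mul_assoc]
      _ = J := by rw [h1, h2]; simp

/-- The index type of the standard basis of `ℝ^{m,n}`. -/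
abbrev Idx (m n : ℕ) : Type := Fin m ⊕ Fin n

/-- The metric `η` of `ℝ^{m,n}`: `m` times `-1` and `n` times `+1`. -/
def eta (m n : ℕ) : Matrix (Idx m n) (Idx m n) ℝ :=
  Matrix.diagonal (Sum.elim (fun _ => -1) (fun _ => 1))

/-- The group `H = O(m,n)`. -/
abbrev orthGroup (m n : ℕ) : Subgroup (GL (Idx m n) ℝ) := formGroup (eta m n)

/-- The group `IO(m,n) = O(m,n) ⋉ ℝ^{m,n}`, as the group of affine matrices with linear part
in `O(m,n)`. -/
def inhomOrthGroup (m n : ℕ) : Subgroup (GL (Idx m n ⊕ Unit) ℝ) where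
  carrier := {B | ∃ (h : Matrix (Idx m n) (Idx m n) ℝ) (v : Matrix (Idx m n) Unit ℝ),
    hᵀ * eta m n * h = eta m n ∧
      (B : Matrix (Idx m n ⊕ Unit) (Idx m n ⊕ Unit) ℝ) = fromBlocks h v 0 1}
  one_mem' := ⟨1, 0, by simp, by simp [Matrix.fromBlocks_one]⟩
  mul_mem' := by
    rintro a b ⟨h, v, hh, ha⟩ ⟨k, w, hk, hb⟩
    refine ⟨h * k, h * w + v, ?_, ?_⟩
    · calc (h * k)ᵀ * eta m n * (h * k) = kᵀ * (hᵀ * eta m n * h) * k := by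
            simp only [Matrix.transpose_mul, Matrix.mul_assoc]
        _ = eta m n := by rw [hh, hk]
    · rw [Units.val_mul, ha, hb, Matrix.fromBlocks_multiply]; simp
  inv_mem' := by
    rintro a ⟨h, v, hh, ha⟩
    have hη : eta m n * eta m n = 1 := by
      rw [eta, Matrix.diagonal_mul_diagonal, ← Matrix.diagonal_one]
      congr 1; funext i; rcases i with i | i <;> simp
    have hl : (eta m n * hᵀ * eta m n) * h = 1 := by
      rw [Matrix.mul_assoc, Matrix.mul_assoc, ← Matrix.mul_assoc hᵀ, hh, hη]
    have hr : h * (eta m n * hᵀ * eta m n) = 1 := mul_eq_one_comm.mp hl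
    set k := eta m n * hᵀ * eta m n with hkdef
    refine ⟨k, -(k * v), ?_, ?_⟩
    · have hrT : kᵀ * hᵀ = 1 := by rw [← Matrix.transpose_mul, hr, Matrix.transpose_one]
      calc kᵀ * eta m n * k = kᵀ * (hᵀ * eta m n * h) * k := by rw [hh]
        _ = (kᵀ * hᵀ) * eta m n * (h * k) := by simp only [Matrix.mul_assoc]
        _ = eta m n := by rw [hrT, hr]; simp
    · apply Units.inv_eq_of_mul_eq_one_right
      rw [ha, Matrix.fromBlocks_multiply, ← Matrix.fromBlocks_one]
      simp [hr, ← Matrix.mul_assoc]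

/-- The model group `G`: `O(m,n+1)` for `Λ = 1`, `IO(m,n)` for `Λ = 0`, `O(m+1,n)` for
`Λ = -1`. The additional basis vector is the one with index `Sum.inr ()`. -/
def modelGroup (m n : ℕ) : SignType → Subgroup (GL (Idx m n ⊕ Unit) ℝ)
  | .pos => formGroup (fromBlocks (eta m n) 0 0 1)
  | .zero => inhomOrthGroup m n
  | .neg => formGroup (fromBlocks (eta m n) 0 0 (-1))

/-- The inclusion of `H = O(m,n)` into `G`, on matrices. -/
def incl {m n : ℕ} (h : Matrix (Idx m n) (Idx m n) ℝ) :
    Matrix (Idx m n ⊕ Unit) (Idx m n ⊕ Unit) ℝ := fromBlocks h 0 0 1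

/-- The Lie algebra `𝔤` of the model group `G` (see `mem_modelAlgebra_iff`). It consists of
the matrices `[[h, z], [-Λ zᵀ η, 0]]` with `h ∈ 𝔬(m,n)` and `z ∈ ℝ^{m,n}`. -/
def modelAlgebra (m n : ℕ) (Λ : SignType) :
    Submodule ℝ (Matrix (Idx m n ⊕ Unit) (Idx m n ⊕ Unit) ℝ) where
  carrier := {X | X.toBlocks₁₁ᵀ * eta m n + eta m n * X.toBlocks₁₁ = 0 ∧
    X.toBlocks₂₁ = -(Λ : ℝ) • (X.toBlocks₁₂ᵀ * eta m n) ∧ X.toBlocks₂₂ = 0}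
  zero_mem' := by
    refine ⟨?_, ?_, ?_⟩ <;> ext i j <;>
      simp [Matrix.mul_apply, toBlocks₁₁, toBlocks₁₂, toBlocks₂₁, toBlocks₂₂]
  add_mem' := by
    rintro X Y ⟨h1, h2, h3⟩ ⟨k1, k2, k3⟩
    refine ⟨?_, ?_, ?_⟩
    · have : (X + Y).toBlocks₁₁ = X.toBlocks₁₁ + Y.toBlocks₁₁ := rfl
      rw [this, Matrix.transpose_add, Matrix.add_mul, Matrix.mul_add,
        add_add_add_comm, h1, k1, add_zero]
    · have e1 : (X + Y).toBlocks₂₁ = X.toBlocks₂₁ + Y.toBlocks₂₁ := rfl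
      have e2 : (X + Y).toBlocks₁₂ = X.toBlocks₁₂ + Y.toBlocks₁₂ := rfl
      rw [e1, e2, h2, k2, Matrix.transpose_add, Matrix.add_mul, smul_add]
    · have : (X + Y).toBlocks₂₂ = X.toBlocks₂₂ + Y.toBlocks₂₂ := rfl
      rw [this, h3, k3, add_zero]
  smul_mem' := by
    rintro c X ⟨h1, h2, h3⟩
    refine ⟨?_, ?_, ?_⟩
    · have : (c • X).toBlocks₁₁ = c • X.toBlocks₁₁ := rfl
      rw [this, Matrix.transpose_smul, Matrix.smul_mul, Matrix.mul_smul, ← smul_add, h1,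
        smul_zero]
    · have e1 : (c • X).toBlocks₂₁ = c • X.toBlocks₂₁ := rfl
      have e2 : (c • X).toBlocks₁₂ = c • X.toBlocks₁₂ := rfl
      rw [e1, e2, h2, Matrix.transpose_smul, Matrix.smul_mul, smul_comm]
    · have : (c • X).toBlocks₂₂ = c • X.toBlocks₂₂ := rfl
      rw [this, h3, smul_zero]

/-- The inclusion of the complement `𝔷 = ℝ^{m,n}` of `𝔥` into `𝔤 = 𝔥 ⊕ 𝔷`. -/
def zIncl (m n : ℕ) (Λ : SignType) : (Idx m n → ℝ) →ₗ[ℝ] modelAlgebra m n Λ where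
  toFun z := ⟨fromBlocks 0 (replicateCol Unit z)
      (-(Λ : ℝ) • ((replicateCol Unit z)ᵀ * eta m n)) 0, by
    refine ⟨?_, ?_, ?_⟩ <;> simp [toBlocks_fromBlocks₁₁]⟩
  map_add' z w := by
    apply Subtype.ext
    simp [Matrix.fromBlocks_add, Matrix.add_mul, Matrix.replicateCol_add]
  map_smul' c z := by
    apply Subtype.ext
    simp only [Submodule.coe_smul, RingHom.id_apply, Matrix.fromBlocks_smul,
      Matrix.replicateCol_smul, Matrix.transpose_smul, Matrix.smul_mul, smul_zero]
    rw [smul_comm]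

section LieAlgebra

attribute [local instance] Matrix.linftyOpNormedRing Matrix.linftyOpNormedAlgebra

theorem hasDerivAt_exp_form {κ : Type} [Fintype κ] [DecidableEq κ] (J X : Matrix κ κ ℝ)
    (t : ℝ) :
    HasDerivAt (fun t : ℝ => (NormedSpace.exp (t • X))ᵀ * J * NormedSpace.exp (t • X))
      ((NormedSpace.exp (t • X))ᵀ * (Xᵀ * J + J * X) * NormedSpace.exp (t • X)) t := by
  have h1 : HasDerivAt (fun t : ℝ => NormedSpace.exp (t • Xᵀ))
      (NormedSpace.exp (t • Xᵀ) * Xᵀ) t := hasDerivAt_exp_smul_const Xᵀ t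
  have h2 : HasDerivAt (fun t : ℝ => NormedSpace.exp (t • X))
      (X * NormedSpace.exp (t • X)) t := hasDerivAt_exp_smul_const' X t
  have h3 := (h1.mul_const J).mul h2
  have e : ∀ t : ℝ, (NormedSpace.exp (t • X))ᵀ = NormedSpace.exp (t • Xᵀ) := fun t => by
    rw [← Matrix.exp_transpose, Matrix.transpose_smul]
  simp only [e]
  refine h3.congr_deriv ?_
  simp only [Matrix.mul_add, Matrix.add_mul, Matrix.mul_assoc]

theorem exp_form_iff {κ : Type} [Fintype κ] [DecidableEq κ] (J X : Matrix κ κ ℝ) :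
    (∀ t : ℝ, (NormedSpace.exp (t • X))ᵀ * J * NormedSpace.exp (t • X) = J) ↔
      Xᵀ * J + J * X = 0 := by
  constructor
  · intro h
    have h1 := hasDerivAt_exp_form J X 0
    simp only [h] at h1
    have h2 := h1.unique (hasDerivAt_const (0 : ℝ) J)
    simpa using h2
  · intro h t
    have hd : ∀ t : ℝ, HasDerivAt
        (fun t : ℝ => (NormedSpace.exp (t • X))ᵀ * J * NormedSpace.exp (t • X)) 0 t := by
      intro t
      have := hasDerivAt_exp_form J X t
      rwa [h, Matrix.mul_zero, Matrix.zero_mul] at this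
    have := is_const_of_deriv_eq_zero (fun t => (hd t).differentiableAt)
      (fun t => (hd t).deriv) t 0
    simpa using this

theorem mem_formGroup_exp_iff {κ : Type} [Fintype κ] [DecidableEq κ] (J X : Matrix κ κ ℝ) :
    (∀ t : ℝ, ∃ B ∈ formGroup J, (B : Matrix κ κ ℝ) = NormedSpace.exp (t • X)) ↔
      Xᵀ * J + J * X = 0 := by
  rw [← exp_form_iff]
  refine forall_congr' fun t => ⟨?_, fun h => ?_⟩
  · rintro ⟨B, hB, h⟩
    rw [← h]; exact hB
  · obtain ⟨B, hB⟩ := Matrix.isUnit_exp (t • X)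
    exact ⟨B, by change (B : Matrix κ κ ℝ)ᵀ * J * B = J; rw [hB]; exact h, hB⟩

theorem blocks_form_iff {m n : ℕ} (c : ℝ) (hc : c * c = 1)
    (X : Matrix (Idx m n ⊕ Unit) (Idx m n ⊕ Unit) ℝ) :
    Xᵀ * fromBlocks (eta m n) 0 0 (c • 1) + fromBlocks (eta m n) 0 0 (c • 1) * X = 0 ↔
      X.toBlocks₁₁ᵀ * eta m n + eta m n * X.toBlocks₁₁ = 0 ∧
        X.toBlocks₂₁ = -c • (X.toBlocks₁₂ᵀ * eta m n) ∧ X.toBlocks₂₂ = 0 := by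
  have hηT : (eta m n)ᵀ = eta m n := Matrix.diagonal_transpose _
  have hc0 : c ≠ 0 := by rintro rfl; simp at hc
  conv_lhs => rw [← Matrix.fromBlocks_toBlocks X]
  rw [Matrix.fromBlocks_transpose, Matrix.fromBlocks_multiply, Matrix.fromBlocks_multiply,
    Matrix.fromBlocks_add, ← Matrix.fromBlocks_zero, Matrix.fromBlocks_inj]
  simp only [Matrix.mul_zero, Matrix.zero_mul, add_zero, zero_add, Matrix.mul_smul,
    Matrix.smul_mul, Matrix.mul_one, Matrix.one_mul]
  constructor
  · rintro ⟨h1, h2, h3, h4⟩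
    refine ⟨h1, ?_, ?_⟩
    · have h5 : c • X.toBlocks₂₁ = -(X.toBlocks₁₂ᵀ * eta m n) :=
        (neg_eq_of_add_eq_zero_right h3).symm
      calc X.toBlocks₂₁ = (c * c) • X.toBlocks₂₁ := by rw [hc, one_smul]
        _ = -c • (X.toBlocks₁₂ᵀ * eta m n) := by rw [mul_smul, h5, smul_neg, neg_smul]
    · ext i j
      have h6 := congrFun (congrFun h4 i) j
      simp only [Matrix.add_apply, Matrix.smul_apply, Matrix.transpose_apply, smul_eq_mul,
        Matrix.zero_apply] at h6
      have : X.toBlocks₂₂ j i = X.toBlocks₂₂ i j := rfl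
      rw [this] at h6
      have : c * X.toBlocks₂₂ i j = 0 := by linarith
      simpa [hc0] using this
  · rintro ⟨h1, h2, h3⟩
    refine ⟨h1, ?_, ?_, ?_⟩
    · rw [h2, Matrix.transpose_smul, Matrix.transpose_mul, hηT, Matrix.transpose_transpose,
        smul_smul]
      simp [hc]
    · rw [h2, smul_smul]; simp [hc]
    · simp [h3]

theorem mem_inhomOrthGroup_exp_iff {m n : ℕ}
    (X : Matrix (Idx m n ⊕ Unit) (Idx m n ⊕ Unit) ℝ) :
    (∀ t : ℝ, ∃ B ∈ inhomOrthGroup m n,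
      (B : Matrix (Idx m n ⊕ Unit) (Idx m n ⊕ Unit) ℝ) = NormedSpace.exp (t • X)) ↔
      X.toBlocks₁₁ᵀ * eta m n + eta m n * X.toBlocks₁₁ = 0 ∧
        X.toBlocks₂₁ = 0 ∧ X.toBlocks₂₂ = 0 := by
  set E : Matrix (Idx m n ⊕ Unit) (Idx m n ⊕ Unit) ℝ := fromBlocks 0 0 0 1 with hE
  set Q : Matrix (Idx m n ⊕ Unit) (Idx m n ⊕ Unit) ℝ := fromBlocks 1 0 0 0 with hQ
  set J : Matrix (Idx m n ⊕ Unit) (Idx m n ⊕ Unit) ℝ := fromBlocks (eta m n) 0 0 0 with hJ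
  have hQE : Q + E = 1 := by
    rw [hQ, hE, Matrix.fromBlocks_add, ← Matrix.fromBlocks_one]; simp
  have hEQ : E * Q = 0 := by
    rw [hQ, hE, Matrix.fromBlocks_multiply, ← Matrix.fromBlocks_zero]; simp
  have hQT : Qᵀ = Q := by rw [hQ, Matrix.fromBlocks_transpose]; simp
  have hderE : ∀ t : ℝ, HasDerivAt (fun t : ℝ => E * NormedSpace.exp (t • X))
      (E * (X * NormedSpace.exp (t • X))) t := fun t =>
    (hasDerivAt_exp_smul_const' X t).const_mul E
  have hderJ : ∀ t : ℝ, HasDerivAt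
      (fun t : ℝ => Q * ((NormedSpace.exp (t • X))ᵀ * J * NormedSpace.exp (t • X)) * Q)
      (Q * ((NormedSpace.exp (t • X))ᵀ * (Xᵀ * J + J * X) * NormedSpace.exp (t • X)) * Q) t :=
    fun t => ((hasDerivAt_exp_form J X t).const_mul Q).mul_const Q
  have hmem : ∀ B : Matrix (Idx m n ⊕ Unit) (Idx m n ⊕ Unit) ℝ,
      (∃ (h : Matrix (Idx m n) (Idx m n) ℝ) (v : Matrix (Idx m n) Unit ℝ),
        hᵀ * eta m n * h = eta m n ∧ B = fromBlocks h v 0 1) ↔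
      E * B = E ∧ Q * (Bᵀ * J * B) * Q = J := by
    intro B
    constructor
    · rintro ⟨h, v, hh, rfl⟩
      rw [hE, hQ, hJ, Matrix.fromBlocks_transpose]
      simp [Matrix.fromBlocks_multiply, hh]
    · rintro ⟨h1, h2⟩
      rw [← Matrix.fromBlocks_toBlocks B, hE, hQ, hJ, Matrix.fromBlocks_transpose] at *
      simp only [Matrix.fromBlocks_multiply, Matrix.fromBlocks_inj, Matrix.zero_mul,
        Matrix.one_mul, Matrix.mul_zero, Matrix.mul_one, zero_add, add_zero] at h1 h2
      exact ⟨B.toBlocks₁₁, B.toBlocks₁₂, h2.1, by rw [h1.2.2.1, h1.2.2.2]⟩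
  have hlie : (X.toBlocks₁₁ᵀ * eta m n + eta m n * X.toBlocks₁₁ = 0 ∧
        X.toBlocks₂₁ = 0 ∧ X.toBlocks₂₂ = 0) ↔
      E * X = 0 ∧ Q * (Xᵀ * J + J * X) * Q = 0 := by
    conv_rhs => rw [← Matrix.fromBlocks_toBlocks X]
    rw [hE, hQ, hJ, Matrix.fromBlocks_transpose]
    have hz : ∀ (a : Matrix (Idx m n) (Idx m n) ℝ) (b : Matrix (Idx m n) Unit ℝ)
        (c : Matrix Unit (Idx m n) ℝ) (d : Matrix Unit Unit ℝ),
        fromBlocks a b c d = 0 ↔ a = 0 ∧ b = 0 ∧ c = 0 ∧ d = 0 := fun a b c d => by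
      rw [← Matrix.fromBlocks_zero, Matrix.fromBlocks_inj]
    simp only [Matrix.fromBlocks_multiply, Matrix.fromBlocks_add, hz, Matrix.zero_mul,
      Matrix.one_mul, Matrix.mul_zero, Matrix.mul_one, zero_add, add_zero]
    tauto
  have hexp : (∀ t : ℝ, ∃ B ∈ inhomOrthGroup m n,
      (B : Matrix (Idx m n ⊕ Unit) (Idx m n ⊕ Unit) ℝ) = NormedSpace.exp (t • X)) ↔
      ∀ t : ℝ, E * NormedSpace.exp (t • X) = E ∧
        Q * ((NormedSpace.exp (t • X))ᵀ * J * NormedSpace.exp (t • X)) * Q = J := by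
    refine forall_congr' fun t => ?_
    rw [← hmem]
    constructor
    · rintro ⟨B, hB, h⟩
      rw [← h]; exact hB
    · intro h
      obtain ⟨B, hB⟩ := Matrix.isUnit_exp (t • X)
      refine ⟨B, ?_, hB⟩
      rw [← hB] at h
      exact h
  rw [hexp, hlie]
  constructor
  · intro h
    have h1 := hderE 0
    simp only [(h _).1] at h1
    have h2 := hderJ 0
    simp only [(h _).2] at h2
    refine ⟨by simpa using h1.unique (hasDerivAt_const (0 : ℝ) E),
      by simpa using h2.unique (hasDerivAt_const (0 : ℝ) J)⟩
  · rintro ⟨h1, h2⟩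
    have hEB : ∀ t : ℝ, E * NormedSpace.exp (t • X) = E := by
      have hd : ∀ t : ℝ, HasDerivAt (fun t : ℝ => E * NormedSpace.exp (t • X)) 0 t := by
        intro t
        have := hderE t
        rwa [← Matrix.mul_assoc, h1, Matrix.zero_mul] at this
      intro t
      have := is_const_of_deriv_eq_zero (fun t => (hd t).differentiableAt)
        (fun t => (hd t).deriv) t 0
      simpa using this
    have hBQ : ∀ t : ℝ, NormedSpace.exp (t • X) * Q = Q * (NormedSpace.exp (t • X) * Q) := by
      intro t
      have h3 : (Q + E) * (NormedSpace.exp (t • X) * Q) = NormedSpace.exp (t • X) * Q := by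
        rw [hQE, Matrix.one_mul]
      rw [← h3, Matrix.add_mul, ← Matrix.mul_assoc E, hEB, hEQ, add_zero, ← Matrix.mul_assoc Q Q]
      congr 1
      rw [hQ, Matrix.fromBlocks_multiply]; simp
    have hQB : ∀ t : ℝ, Q * (NormedSpace.exp (t • X))ᵀ = Q * (NormedSpace.exp (t • X))ᵀ * Q := by
      intro t
      have := congrArg Matrix.transpose (hBQ t)
      simpa only [Matrix.transpose_mul, hQT] using this
    have hd : ∀ t : ℝ, HasDerivAt
        (fun t : ℝ => Q * ((NormedSpace.exp (t • X))ᵀ * J * NormedSpace.exp (t • X)) * Q) 0 t := by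
      intro t
      refine (hderJ t).congr_deriv ?_
      calc Q * ((NormedSpace.exp (t • X))ᵀ * (Xᵀ * J + J * X) * NormedSpace.exp (t • X)) * Q
          = (Q * (NormedSpace.exp (t • X))ᵀ) * (Xᵀ * J + J * X)
              * (NormedSpace.exp (t • X) * Q) := by simp only [Matrix.mul_assoc]
        _ = Q * (NormedSpace.exp (t • X))ᵀ * (Q * (Xᵀ * J + J * X) * Q)
              * (NormedSpace.exp (t • X) * Q) := by
            conv_lhs => rw [hQB t, hBQ t]
            simp only [Matrix.mul_assoc]
        _ = 0 := by rw [h2]; simp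
    intro t
    refine ⟨hEB t, ?_⟩
    have := is_const_of_deriv_eq_zero (fun t => (hd t).differentiableAt)
      (fun t => (hd t).deriv) t 0
    refine this.trans ?_
    rw [hQ, hJ]
    simp [Matrix.fromBlocks_multiply]

/-- `modelAlgebra` is the Lie algebra of `modelGroup`. -/
theorem mem_modelAlgebra_iff {m n : ℕ} {Λ : SignType}
    (X : Matrix (Idx m n ⊕ Unit) (Idx m n ⊕ Unit) ℝ) :
    X ∈ modelAlgebra m n Λ ↔ ∀ t : ℝ, ∃ B ∈ modelGroup m n Λ,
      (B : Matrix (Idx m n ⊕ Unit) (Idx m n ⊕ Unit) ℝ) = NormedSpace.exp (t • X) := by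
  have hX : X ∈ modelAlgebra m n Λ ↔
      X.toBlocks₁₁ᵀ * eta m n + eta m n * X.toBlocks₁₁ = 0 ∧
        X.toBlocks₂₁ = -(Λ : ℝ) • (X.toBlocks₁₂ᵀ * eta m n) ∧ X.toBlocks₂₂ = 0 := Iff.rfl
  rw [hX]
  cases Λ with
  | zero =>
    rw [show modelGroup m n SignType.zero = inhomOrthGroup m n from rfl,
      mem_inhomOrthGroup_exp_iff]
    simp
  | pos =>
    have := blocks_form_iff 1 (by norm_num) X
    rw [one_smul] at this
    rw [show modelGroup m n SignType.pos = formGroup (fromBlocks (eta m n) 0 0 1) from rfl,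
      mem_formGroup_exp_iff, this]
    simp
  | neg =>
    have := blocks_form_iff (-1) (by norm_num) X
    rw [neg_one_smul] at this
    rw [show modelGroup m n SignType.neg = formGroup (fromBlocks (eta m n) 0 0 (-1)) from rfl,
      mem_formGroup_exp_iff, this]
    simp

end LieAlgebra

/-! ### Principal bundles and Cartan geometries -/

/-- The matrix entries of an element of `GL κ ℝ`, as a point of the vector space `κ → κ → ℝ`. -/
def entries {κ : Type} [Fintype κ] [DecidableEq κ] (h : GL κ ℝ) : κ → κ → ℝ :=
  fun i j => (h : Matrix κ κ ℝ) i j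

/-- A smooth principal bundle over `M` with total space `P` and structure group a (closed) matrix
group `H`. Smoothness on `U × H` refers to `H` as a subset of the space of matrices `κ → κ → ℝ`. -/
structure PrincipalBundle {κ : Type} [Fintype κ] [DecidableEq κ] (H : Subgroup (GL κ ℝ))
    {E : Type*} [NormedAddCommGroup E] [NormedSpace ℝ E]
    (M : Type*) [TopologicalSpace M] [ChartedSpace E M]
    {F : Type*} [NormedAddCommGroup F] [NormedSpace ℝ F]
    (P : Type*) [TopologicalSpace P] [ChartedSpace F P] where
  /-- the projection -/
  proj : P → M
  contMDiff_proj : ContMDiff 𝓘(ℝ, F) 𝓘(ℝ, E) ∞ proj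
  /-- the right action `R_h p = act p h` -/
  act : P → H → P
  act_one : ∀ p, act p 1 = p
  act_mul : ∀ p h k, act p (h * k) = act (act p h) k
  proj_act : ∀ p h, proj (act p h) = proj p
  /-- Over a neighbourhood `U` of each point there is an `H`-equivariant diffeomorphism `Ψ` from
  `U × H` to `proj ⁻¹ U` over `U`, with inverse `p ↦ (proj p, k p)`. -/
  locally_trivial : ∀ x : M, ∃ U : Set M, IsOpen U ∧ x ∈ U ∧
    ∃ (Ψ : M × (κ → κ → ℝ) → P) (k : P → (κ → κ → ℝ)),
      ContMDiffOn (𝓘(ℝ, E).prod 𝓘(ℝ, κ → κ → ℝ)) 𝓘(ℝ, F) ∞ Ψ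
        (U ×ˢ {a | ∃ h ∈ H, entries h = a}) ∧
      ContMDiffOn 𝓘(ℝ, F) 𝓘(ℝ, κ → κ → ℝ) ∞ k (proj ⁻¹' U) ∧
      (∀ y ∈ U, ∀ h ∈ H, proj (Ψ (y, entries h)) = y ∧ k (Ψ (y, entries h)) = entries h) ∧
      (∀ p ∈ proj ⁻¹' U, (∃ h ∈ H, entries h = k p) ∧ Ψ (proj p, k p) = p) ∧
      (∀ y ∈ U, ∀ h k' : H, Ψ (y, entries (h * k' : H)) = act (Ψ (y, entries h)) k')

/-- A Cartan geometry on `M` modeled on the orthogonal Klein geometry `G / H`, where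
`H = O(m,n)` and `G = modelGroup m n Λ`. -/
structure CartanGeometry (m n : ℕ) (Λ : SignType)
    {E : Type*} [NormedAddCommGroup E] [NormedSpace ℝ E]
    (M : Type*) [TopologicalSpace M] [ChartedSpace E M]
    {F : Type*} [NormedAddCommGroup F] [NormedSpace ℝ F]
    (P : Type*) [TopologicalSpace P] [ChartedSpace F P] [IsManifold 𝓘(ℝ, F) ∞ P]
    extends PrincipalBundle (orthGroup m n) (E := E) M (F := F) P where
  /-- the Cartan connection, a linear isomorphism `T_p P → 𝔤` for each `p` -/
  conn : ∀ p : P, TangentSpace 𝓘(ℝ, F) p ≃ₗ[ℝ] modelAlgebra m n Λ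
  /-- `A` is smooth: each of its matrix entries is a smooth function on `TP` -/
  contMDiff_conn : ∀ i j, ContMDiff 𝓘(ℝ, F).tangent 𝓘(ℝ, ℝ) ∞
    (fun v : TangentBundle 𝓘(ℝ, F) P =>
      (conn v.proj v.snd : Matrix (Idx m n ⊕ Unit) (Idx m n ⊕ Unit) ℝ) i j)
  /-- `(R_h)^* A = Ad(h⁻¹) ∘ A` -/
  conn_equivariant : ∀ (h : orthGroup m n) (p : P) (v : TangentSpace 𝓘(ℝ, F) p),
    (conn (act p h) (mfderiv 𝓘(ℝ, F) 𝓘(ℝ, F) (fun q => act q h) p v) :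
        Matrix (Idx m n ⊕ Unit) (Idx m n ⊕ Unit) ℝ) =
      incl (((h⁻¹ : orthGroup m n) : GL (Idx m n) ℝ) : Matrix (Idx m n) (Idx m n) ℝ) *
        (conn p v : Matrix (Idx m n ⊕ Unit) (Idx m n ⊕ Unit) ℝ) *
        incl ((h : GL (Idx m n) ℝ) : Matrix (Idx m n) (Idx m n) ℝ)
  /-- `A` takes the value `X` on the fundamental vector field of `X ∈ 𝔥`, that is, on the velocity
  at `t = 0` of `t ↦ R_{c t} p` for the one-parameter subgroup `c t = exp (t X)` of `H`. -/
  conn_fundamental : ∀ (X : Matrix (Idx m n) (Idx m n) ℝ) (c : ℝ → orthGroup m n),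
    (∀ t, ((c t : GL (Idx m n) ℝ) : Matrix (Idx m n) (Idx m n) ℝ) = NormedSpace.exp (t • X)) →
    ∀ p : P, (conn (act p (c 0))
        (mfderiv 𝓘(ℝ, ℝ) 𝓘(ℝ, F) (fun t : ℝ => act p (c t)) 0 (1 : ℝ)) :
          Matrix (Idx m n ⊕ Unit) (Idx m n ⊕ Unit) ℝ) = fromBlocks X 0 0 0

/-! ### The linear frame bundle and complete lifts -/

section Base

variable {E : Type*} [NormedAddCommGroup E] [NormedSpace ℝ E]
  {M : Type*} [TopologicalSpace M] [ChartedSpace E M] [IsManifold 𝓘(ℝ, E) ∞ M]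

/-- Smooth vector fields. -/
def IsSmoothField (X : ∀ x : M, TangentSpace 𝓘(ℝ, E) x) : Prop :=
  ContMDiff 𝓘(ℝ, E) 𝓘(ℝ, E).tangent ∞ (fun x => (⟨x, X x⟩ : TangentBundle 𝓘(ℝ, E) M))

/-- The derivative of a function `u : M → ℝ` at `x` in direction `v ∈ T_x M`. -/
def dirDeriv (u : M → ℝ) (x : M) (v : TangentSpace 𝓘(ℝ, E) x) : ℝ :=
  (mfderiv 𝓘(ℝ, E) 𝓘(ℝ, ℝ) u x : TangentSpace 𝓘(ℝ, E) x →L[ℝ] ℝ) v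

/-- The total space of the vector bundle with fibres `Hom(ℝ^{m,n}, T_x M)`. The linear frame
bundle `GL(M)` is its open subset of bijective maps. -/
abbrev HomBundle (m n : ℕ) (E : Type*) [NormedAddCommGroup E] [NormedSpace ℝ E]
    (M : Type*) [TopologicalSpace M] [ChartedSpace E M] : Type _ :=
  Bundle.TotalSpace ((Idx m n → ℝ) →L[ℝ] E)
    (fun x : M => Bundle.Trivial M (Idx m n → ℝ) x →L[ℝ] TangentSpace 𝓘(ℝ, E) x)

/-- The model with corners of `HomBundle` (and of its open subset `GL(M)`). -/
abbrev homModel (m n : ℕ) (E : Type*) [NormedAddCommGroup E] [NormedSpace ℝ E] :=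
  𝓘(ℝ, E).prod 𝓘(ℝ, (Idx m n → ℝ) →L[ℝ] E)

/-- The complete lift `ξ^a ∂_a + f_i^b ∂_b ξ^a ∂/∂f_i^a` of a vector field `ξ` to the frame bundle.
In Mathlib a tangent vector to the total space at `f` is the pair of its components in the induced
coordinates `(x^a, f_i^a)` of the preferred chart of `M` at the base point of `f`. In that chart,
the components of `ξ` are `y ↦ (trivializationAt _ _ f.proj ⟨y, ξ y⟩).2`. -/
def completeLift {m n : ℕ} (ξ : ∀ x : M, TangentSpace 𝓘(ℝ, E) x) (f : HomBundle m n E M) :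
    TangentSpace (homModel m n E) f :=
  (ξ f.proj,
    (mfderiv 𝓘(ℝ, E) 𝓘(ℝ, E)
      (fun y : M => (trivializationAt E (TangentSpace 𝓘(ℝ, E)) f.proj ⟨y, ξ y⟩).2) f.proj :
        TangentSpace 𝓘(ℝ, E) f.proj →L[ℝ] E).comp f.snd)

/-- Invariance `L_ξ g = 0` of a `(0,2)`-tensor field:
`ξ (g (X, Y)) = g ([ξ, X], Y) + g (X, [ξ, Y])` for all smooth vector fields `X`, `Y`. -/
def LieDerivMetricEqZero (ξ : ∀ x : M, TangentSpace 𝓘(ℝ, E) x)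
    (g : ∀ x : M, TangentSpace 𝓘(ℝ, E) x → TangentSpace 𝓘(ℝ, E) x → ℝ) : Prop :=
  ∀ X Y : ∀ x : M, TangentSpace 𝓘(ℝ, E) x, IsSmoothField X → IsSmoothField Y → ∀ x : M,
    dirDeriv (fun y => g y (X y) (Y y)) x (ξ x)
      - g x (VectorField.mlieBracket 𝓘(ℝ, E) ξ X x) (Y x)
      - g x (X x) (VectorField.mlieBracket 𝓘(ℝ, E) ξ Y x) = 0

/-- Invariance `L_ξ T = 0` of a `(1,2)`-tensor field, given by its action on vector fields:
`[ξ, T (X, Y)] = T ([ξ, X], Y) + T (X, [ξ, Y])` for all smooth vector fields `X`, `Y`. -/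
def LieDerivTorsionEqZero (ξ : ∀ x : M, TangentSpace 𝓘(ℝ, E) x)
    (T : (∀ x : M, TangentSpace 𝓘(ℝ, E) x) → (∀ x : M, TangentSpace 𝓘(ℝ, E) x) →
      ∀ x : M, TangentSpace 𝓘(ℝ, E) x) : Prop :=
  ∀ X Y : ∀ x : M, TangentSpace 𝓘(ℝ, E) x, IsSmoothField X → IsSmoothField Y → ∀ x : M,
    VectorField.mlieBracket 𝓘(ℝ, E) ξ (T X Y) x
      - T (VectorField.mlieBracket 𝓘(ℝ, E) ξ X) Y x
      - T X (VectorField.mlieBracket 𝓘(ℝ, E) ξ Y) x = 0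

end Base

/-! ### Riemann–Cartan geometry and invariance of an orthogonal Cartan geometry -/

namespace CartanGeometry

variable {m n : ℕ} {Λ : SignType}
  {E : Type*} [NormedAddCommGroup E] [NormedSpace ℝ E]
  {M : Type*} [TopologicalSpace M] [ChartedSpace E M]
  {F : Type*} [NormedAddCommGroup F] [NormedSpace ℝ F]
  {P : Type*} [TopologicalSpace P] [ChartedSpace F P] [IsManifold 𝓘(ℝ, F) ∞ P]
  (C : CartanGeometry m n Λ (E := E) M (F := F) P)

theorem proj_surjective : Function.Surjective C.proj := by
  intro x
  obtain ⟨U, -, hx, Ψ, k, -, -, h, -⟩ := C.locally_trivial x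
  exact ⟨_, (h x hx 1 (Subgroup.one_mem _)).1⟩

/-- A point of `P` over `x`. -/
def pointOver (x : M) : P := (C.proj_surjective x).choose

theorem proj_pointOver (x : M) : C.proj (C.pointOver x) = x := (C.proj_surjective x).choose_spec

variable [IsManifold 𝓘(ℝ, E) ∞ M]

/-- The admissible frame `ℝ^{m,n} → T_x M`, `x = proj p`, given by `p`: it maps `z` to
`d proj (w)` for the vector `w ∈ T_p P` with `A (w) = z` (that is, to the inverse image of
`[p, z]` under the coframe field). -/
def frame (p : P) : (Idx m n → ℝ) →L[ℝ] TangentSpace 𝓘(ℝ, E) (C.proj p) :=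
  LinearMap.toContinuousLinearMap
    ((mfderiv 𝓘(ℝ, F) 𝓘(ℝ, E) C.proj p).toLinearMap ∘ₗ (C.conn p).symm.toLinearMap ∘ₗ
      zIncl m n Λ)

/-- The map `φ : P → GL(M)`, an embedding whose image is the admissible frame bundle. -/
def toHomBundle (p : P) : HomBundle m n E M := ⟨C.proj p, C.frame p⟩

/-- The frame at `x` given by a point `p` over `x`. -/
def frameAt {x : M} {p : P} (hp : C.proj p = x) :
    (Idx m n → ℝ) →L[ℝ] TangentSpace 𝓘(ℝ, E) x :=
  hp ▸ C.frame p

/-- The induced metric `g (v, w) = η (p⁻¹ v, p⁻¹ w)`, for any frame `p` over `x`. -/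
def metric (x : M) (v w : TangentSpace 𝓘(ℝ, E) x) : ℝ :=
  (C.frameAt (C.proj_pointOver x)).inverse v ⬝ᵥ
    (eta m n *ᵥ (C.frameAt (C.proj_pointOver x)).inverse w)

/-- The function `p ↦ p⁻¹ (X (proj p))` on `P` corresponding to a vector field `X` on `M`. -/
def equivariantFunction (X : ∀ x : M, TangentSpace 𝓘(ℝ, E) x) (p : P) : Idx m n → ℝ :=
  (C.frame p).inverse (X (C.proj p))

/-- The horizontal lift to `p` of a tangent vector `v` at `x = proj p`: the vector in `T_p P` over
`v` on which the `𝔥`-valued part of `A` vanishes. -/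
def horizontalLift {x : M} {p : P} (hp : C.proj p = x) (v : TangentSpace 𝓘(ℝ, E) x) :
    TangentSpace 𝓘(ℝ, F) p :=
  (C.conn p).symm (zIncl m n Λ ((C.frameAt hp).inverse v))

/-- The covariant derivative `∇_v X` at `x` defined by the `𝔥`-valued part of `A`: the frame `p`
applied to the derivative of `equivariantFunction X` along the horizontal lift of `v`, for any
frame `p` over `x`. -/
def covDeriv (X : ∀ x : M, TangentSpace 𝓘(ℝ, E) x) (x : M) (v : TangentSpace 𝓘(ℝ, E) x) :
    TangentSpace 𝓘(ℝ, E) x :=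
  C.frameAt (C.proj_pointOver x)
    (mfderiv 𝓘(ℝ, F) 𝓘(ℝ, Idx m n → ℝ) (C.equivariantFunction X) (C.pointOver x)
      (C.horizontalLift (C.proj_pointOver x) v) : Idx m n → ℝ)

/-- The torsion `T (X, Y) = ∇_X Y - ∇_Y X - [X, Y]`. -/
def torsion (X Y : ∀ x : M, TangentSpace 𝓘(ℝ, E) x) (x : M) : TangentSpace 𝓘(ℝ, E) x :=
  C.covDeriv Y x (X x) - C.covDeriv X x (Y x) - VectorField.mlieBracket 𝓘(ℝ, E) X Y x

/-- The complete lift of `ξ` is tangent to the admissible frame bundle `φ (P)`, whose tangent space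
at `φ p` is the range of the differential of `φ` at `p`. -/
def LiftTangent (ξ : ∀ x : M, TangentSpace 𝓘(ℝ, E) x) : Prop :=
  ∀ p : P, ∃ w : TangentSpace 𝓘(ℝ, F) p,
    mfderiv 𝓘(ℝ, F) (homModel m n E) C.toHomBundle p w = completeLift ξ (C.toHomBundle p)

/-- The Cartan geometry is invariant under `ξ`: the complete lift of `ξ` is tangent to the
admissible frame bundle, and its restriction to that bundle, pulled back by `φ` to a smooth vector
field `Z` on `P`, preserves the Cartan connection: `(L_Z A) (Y) = Z (A (Y)) - A ([Z, Y]) = 0` for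
all smooth vector fields `Y` on `P` (written out for the matrix entries of `A`). -/
def IsInvariant (ξ : ∀ x : M, TangentSpace 𝓘(ℝ, E) x) : Prop :=
  C.LiftTangent ξ ∧
  ∃ Z : ∀ p : P, TangentSpace 𝓘(ℝ, F) p, IsSmoothField Z ∧
    (∀ p : P, mfderiv 𝓘(ℝ, F) (homModel m n E) C.toHomBundle p (Z p) =
      completeLift ξ (C.toHomBundle p)) ∧
    ∀ Y : ∀ p : P, TangentSpace 𝓘(ℝ, F) p, IsSmoothField Y → ∀ (p : P) (i j : Idx m n ⊕ Unit),
      dirDeriv (fun q => (C.conn q (Y q) : Matrix (Idx m n ⊕ Unit) (Idx m n ⊕ Unit) ℝ) i j) p (Z p)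
        - (C.conn p (VectorField.mlieBracket 𝓘(ℝ, F) Z Y p) :
            Matrix (Idx m n ⊕ Unit) (Idx m n ⊕ Unit) ℝ) i j = 0

end CartanGeometry

end RiemannCartan

end

set_option linter.unusedSectionVars false

/-! A vector field `X` on `M` corresponds to the `ℝ^{m,n}`-valued function `f_X =
equivariantFunction X` on `P`, and everything is computed with these functions. In induced
coordinates, differentiating `X = φ(q) f_X(q)` shows that a vector `w ∈ T_p P` is mapped by `dφ` to
the complete lift of `ξ` exactly when `w` projects to `ξ` and `w f_X = f_[ξ,X]` for all smooth `X`
(`mfderiv_toHomBundle_eq_completeLift_iff`).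

Tangency. Since `g(X,Y) ∘ π = η(f_X, f_Y)` with `η` constant, a tangent lift gives `L_ξ g = 0` by
the product rule. Conversely, let `B_c` be the field with `A(B_c) = c ∈ 𝔷`. The horizontal lift
`ξ^h` satisfies `ξ^h f_X = f_[ξ,X] - K f_X`, where `K c` is the `𝔷`-part of `A([ξ^h, B_c])`. The
equation `L_ξ g = 0` puts `K` into `𝔬(m,n)`, so `K` defines a vertical field; subtracting it from
`ξ^h` gives a field `Z` with `Z f_X = f_[ξ,X]`, the required lift (`exists_lift`).

Invariance. The lift `Z` commutes with the fundamental fields (`mlieBracket_hIncl`), and `[Z, B_c]`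
is vertical (`solder_mlieBracket`), with value `κ(c) ∈ 𝔬(m,n)`. On one side `(L_Z A)(V)` is `-κ` of
the `𝔷`-part of `A(V)` (`lieDerivConn_iff`). On the other side the function of `(L_ξ T)(X,Y)` is
`κ(f_Y) f_X - κ(f_X) f_Y` (`equivariantFunction_lieDerivTorsion`). So `L_ξ T = 0` says that `κ(v) w`
is symmetric in `v, w`, and a symmetric `κ` with values in `𝔬(m,n)` vanishes
(`eq_zero_of_symm_infOrth`), the algebra behind the uniqueness of a metric connection with given
torsion. Both conditions therefore mean `κ = 0`. -/

noncomputable section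

namespace RiemannCartan

/-! ### Derivations, Lie brackets and related vector fields. -/

section Calculus

open VectorField Filter Topology

variable {F : Type*} [NormedAddCommGroup F] [NormedSpace ℝ F]
  {N : Type*} [TopologicalSpace N] [ChartedSpace F N]
  {W : Type*} [NormedAddCommGroup W] [NormedSpace ℝ W]

theorem mvfderiv_congr {f g : N → W} {p : N} (h : f =ᶠ[𝓝 p] g) :
    mvfderiv 𝓘(ℝ, F) f p = mvfderiv 𝓘(ℝ, F) g p := by
  ext v
  change (mfderiv 𝓘(ℝ, F) 𝓘(ℝ, W) f p v : W) = (mfderiv 𝓘(ℝ, F) 𝓘(ℝ, W) g p v : W)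
  rw [h.mfderiv_eq]
  rfl

theorem two_le_infty : (2 : WithTop ℕ∞) ≤ ∞ := by
  exact WithTop.coe_le_coe.2 (le_top : (2 : ℕ∞) ≤ ⊤)

variable {W₁ W₂ : Type*} [NormedAddCommGroup W₁] [NormedSpace ℝ W₁] [NormedAddCommGroup W₂]
  [NormedSpace ℝ W₂]

theorem mvfderiv_clm_comp (L : W →L[ℝ] W₁) {f : N → W} {p : N}
    (hf : MDifferentiableAt 𝓘(ℝ, F) 𝓘(ℝ, W) f p) (v : TangentSpace 𝓘(ℝ, F) p) :
    mvfderiv 𝓘(ℝ, F) (fun q => L (f q)) p v = L (mvfderiv 𝓘(ℝ, F) f p v) := by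
  have h := mfderiv_comp_apply (I' := 𝓘(ℝ, W)) p L.mdifferentiableAt hf v
  rw [ContinuousLinearMap.mfderiv_eq] at h
  exact h

theorem mvfderiv_bilin (B : W →L[ℝ] W₁ →L[ℝ] W₂) {f : N → W} {g : N → W₁} {p : N}
    (hf : MDifferentiableAt 𝓘(ℝ, F) 𝓘(ℝ, W) f p) (hg : MDifferentiableAt 𝓘(ℝ, F) 𝓘(ℝ, W₁) g p)
    (v : TangentSpace 𝓘(ℝ, F) p) :
    mvfderiv 𝓘(ℝ, F) (fun q => B (f q) (g q)) p v =
      B (mvfderiv 𝓘(ℝ, F) f p v) (g p) + B (f p) (mvfderiv 𝓘(ℝ, F) g p v) := by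
  have h1 : HasMFDerivAt 𝓘(ℝ, W × W₁) 𝓘(ℝ, W₂) (fun x : W × W₁ => B x.1 x.2) (f p, g p)
      (B.isBoundedBilinearMap.deriv (f p, g p)) :=
    (B.isBoundedBilinearMap.hasFDerivAt (f p, g p)).hasMFDerivAt
  have h2 : HasMFDerivAt 𝓘(ℝ, F) 𝓘(ℝ, W × W₁) (fun q => (f q, g q)) p
      (ContinuousLinearMap.prod (mvfderiv 𝓘(ℝ, F) f p) (mvfderiv 𝓘(ℝ, F) g p)) :=
    ⟨hf.continuousAt.prodMk hg.continuousAt, hf.hasMFDerivAt.2.prodMk hg.hasMFDerivAt.2⟩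
  have h3 := (HasMFDerivAt.comp p h1 h2).mfderiv
  have h4 := DFunLike.congr_fun h3 v
  refine h4.trans (add_comm _ _)

theorem contDiffAt_comp_extChartAt_symm {f : N → W} {p : N}
    (hf : ContMDiffAt 𝓘(ℝ, F) 𝓘(ℝ, W) ∞ f p) :
    ContDiffAt ℝ ∞ (f ∘ (extChartAt 𝓘(ℝ, F) p).symm) (extChartAt 𝓘(ℝ, F) p p) := by
  have := (contMDiffAt_iff.1 hf).2
  simpa [contDiffWithinAt_univ] using! this

theorem eventuallyEq_comp_extChartAt {W : Type*} (f : N → W) (p : N) :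
    f =ᶠ[𝓝 p] (f ∘ (extChartAt 𝓘(ℝ, F) p).symm) ∘ extChartAt 𝓘(ℝ, F) p := by
  filter_upwards [extChartAt_source_mem_nhds (I := 𝓘(ℝ, F)) p] with y hy
  exact congrArg f ((extChartAt 𝓘(ℝ, F) p).left_inv hy).symm

variable {E : Type*} [NormedAddCommGroup E] [NormedSpace ℝ E]
  {M : Type*} [TopologicalSpace M] [ChartedSpace E M]

theorem mvfderiv_comp_eq {π : N → M} {q : N} {f : M → W}
    (hf : MDifferentiableAt 𝓘(ℝ, E) 𝓘(ℝ, W) f (π q))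
    (hπ : MDifferentiableAt 𝓘(ℝ, F) 𝓘(ℝ, E) π q) (v : TangentSpace 𝓘(ℝ, F) q) :
    mvfderiv 𝓘(ℝ, F) (fun p => f (π p)) q v =
      mvfderiv 𝓘(ℝ, E) f (π q) (mfderiv 𝓘(ℝ, F) 𝓘(ℝ, E) π q v) :=
  mfderiv_comp_apply (I' := 𝓘(ℝ, E)) q hf hπ v

variable [IsManifold 𝓘(ℝ, F) ∞ N]

theorem IsSmoothField.mdifferentiableAt {V : ∀ p : N, TangentSpace 𝓘(ℝ, F) p}
    (hV : IsSmoothField V) (p : N) :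
    MDifferentiableAt 𝓘(ℝ, F) 𝓘(ℝ, F).tangent
      (fun x => (⟨x, V x⟩ : TangentBundle 𝓘(ℝ, F) N)) p :=
  (hV p).mdifferentiableAt (by simp)

theorem mvfderiv_comp_extChartAt {p y : N} (hy : y ∈ (extChartAt 𝓘(ℝ, F) p).source)
    {g : F → W} (hg : DifferentiableAt ℝ g (extChartAt 𝓘(ℝ, F) p y))
    (v : TangentSpace 𝓘(ℝ, F) y) :
    mvfderiv 𝓘(ℝ, F) (g ∘ extChartAt 𝓘(ℝ, F) p) y v =
      fderiv ℝ g (extChartAt 𝓘(ℝ, F) p y)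
        (mfderiv 𝓘(ℝ, F) 𝓘(ℝ, F) (extChartAt 𝓘(ℝ, F) p) y v : F) := by
  rw [extChartAt_source] at hy
  have h1 := mfderiv_comp_apply (I := 𝓘(ℝ, F)) (I' := 𝓘(ℝ, F)) (I'' := 𝓘(ℝ, W)) y
    hg.mdifferentiableAt (mdifferentiableAt_extChartAt (I := 𝓘(ℝ, F)) hy) v
  rw [mfderiv_eq_fderiv] at h1
  exact h1

/-- The representation of a vector field in the chart at `p`. -/
def chartField (V : ∀ p : N, TangentSpace 𝓘(ℝ, F) p) (p : N) : F → F :=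
  mpullbackWithin 𝓘(ℝ, F) 𝓘(ℝ, F) (extChartAt 𝓘(ℝ, F) p).symm V (Set.range 𝓘(ℝ, F))

theorem chartField_apply (V : ∀ p : N, TangentSpace 𝓘(ℝ, F) p) {p y : N}
    (hy : y ∈ (extChartAt 𝓘(ℝ, F) p).source) :
    chartField V p (extChartAt 𝓘(ℝ, F) p y) =
      mfderiv 𝓘(ℝ, F) 𝓘(ℝ, F) (extChartAt 𝓘(ℝ, F) p) y (V y) := by
  have h1 := mfderivWithin_extChartAt_symm_comp_mfderiv_extChartAt' (I := 𝓘(ℝ, F)) hy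
  have h2 := mfderiv_extChartAt_comp_mfderivWithin_extChartAt_symm' (I := 𝓘(ℝ, F)) hy
  have h3 := ContinuousLinearMap.inverse_eq h1 h2
  have h4 : chartField V p (extChartAt 𝓘(ℝ, F) p y) =
      (mfderivWithin 𝓘(ℝ, F) 𝓘(ℝ, F) (extChartAt 𝓘(ℝ, F) p).symm (Set.range 𝓘(ℝ, F))
        (extChartAt 𝓘(ℝ, F) p y)).inverse
          (V ((extChartAt 𝓘(ℝ, F) p).symm (extChartAt 𝓘(ℝ, F) p y)) : F) := rfl
  rw [h4, (extChartAt 𝓘(ℝ, F) p).left_inv hy]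
  exact DFunLike.congr_fun h3 (V y)

theorem mvfderiv_comp_extChartAt_field {p y : N} (hy : y ∈ (extChartAt 𝓘(ℝ, F) p).source)
    {g : F → W} (hg : DifferentiableAt ℝ g (extChartAt 𝓘(ℝ, F) p y))
    (V : ∀ p : N, TangentSpace 𝓘(ℝ, F) p) :
    mvfderiv 𝓘(ℝ, F) (g ∘ extChartAt 𝓘(ℝ, F) p) y (V y) =
      fderiv ℝ g (extChartAt 𝓘(ℝ, F) p y) (chartField V p (extChartAt 𝓘(ℝ, F) p y)) := by
  rw [mvfderiv_comp_extChartAt hy hg, chartField_apply V hy]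

theorem differentiableAt_chartField [CompleteSpace F] {V : ∀ p : N, TangentSpace 𝓘(ℝ, F) p}
    (hV : IsSmoothField V) (p : N) :
    DifferentiableAt ℝ (chartField V p) (extChartAt 𝓘(ℝ, F) p p) := by
  have : IsManifold 𝓘(ℝ, F) 2 N := IsManifold.of_le (n := ∞) two_le_infty
  have h := MDifferentiableWithinAt.differentiableWithinAt_mpullbackWithin_vectorField
    (s := Set.univ) (hV.mdifferentiableAt p).mdifferentiableWithinAt
  have h2 : (extChartAt 𝓘(ℝ, F) p).symm ⁻¹' Set.univ ∩ Set.range 𝓘(ℝ, F) = Set.univ := by simp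
  rw [h2] at h
  exact differentiableWithinAt_univ.1 h

theorem mlieBracket_chart (V V' : ∀ p : N, TangentSpace 𝓘(ℝ, F) p) (p : N) :
    mfderiv 𝓘(ℝ, F) 𝓘(ℝ, F) (extChartAt 𝓘(ℝ, F) p) p (mlieBracket 𝓘(ℝ, F) V V' p) =
      lieBracket ℝ (chartField V p) (chartField V' p) (extChartAt 𝓘(ℝ, F) p p) := by
  have h := isInvertible_mfderiv_extChartAt (I := 𝓘(ℝ, F)) (mem_extChartAt_source (I := 𝓘(ℝ, F)) p)
  have h2 : (extChartAt 𝓘(ℝ, F) p).symm ⁻¹' Set.univ ∩ Set.range 𝓘(ℝ, F) = Set.univ := by simp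
  have h3 : mlieBracket 𝓘(ℝ, F) V V' p =
      (mfderiv 𝓘(ℝ, F) 𝓘(ℝ, F) (extChartAt 𝓘(ℝ, F) p) p).inverse
        (lieBracketWithin ℝ (chartField V p) (chartField V' p)
          ((extChartAt 𝓘(ℝ, F) p).symm ⁻¹' Set.univ ∩ Set.range 𝓘(ℝ, F))
          (extChartAt 𝓘(ℝ, F) p p) : F) := rfl
  rw [h3, h2, lieBracketWithin_univ]
  exact ContinuousLinearMap.IsInvertible.self_apply_inverse h _

theorem eventually_differentiableAt_comp_extChartAt_symm {f : N → W} {p : N}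
    (hf : ContMDiffAt 𝓘(ℝ, F) 𝓘(ℝ, W) ∞ f p) :
    ∀ᶠ y in 𝓝 p, DifferentiableAt ℝ (f ∘ (extChartAt 𝓘(ℝ, F) p).symm)
      (extChartAt 𝓘(ℝ, F) p y) := by
  have hφc : ContinuousAt (extChartAt 𝓘(ℝ, F) p) p := continuousAt_extChartAt p
  have := ((contDiffAt_comp_extChartAt_symm hf).of_le (m := 1) (by simp)).eventually (by simp)
  exact hφc.eventually (this.mono fun z hz => hz.differentiableAt (by simp))

/-- The commutator of two derivations involves second derivatives. Near `p` the first derivative is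
a function of the chart coordinate, which can be differentiated again in the vector space `F`. -/
theorem mvfderiv_field_eventuallyEq (U : ∀ p : N, TangentSpace 𝓘(ℝ, F) p) {f : N → W} {p : N}
    (hf : ContMDiffAt 𝓘(ℝ, F) 𝓘(ℝ, W) ∞ f p) :
    (fun q => mvfderiv 𝓘(ℝ, F) f q (U q)) =ᶠ[𝓝 p]
      (fun z => fderiv ℝ (f ∘ (extChartAt 𝓘(ℝ, F) p).symm) z (chartField U p z)) ∘
        extChartAt 𝓘(ℝ, F) p := by
  filter_upwards [(eventuallyEq_comp_extChartAt (F := F) f p).eventuallyEq_nhds,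
    eventually_differentiableAt_comp_extChartAt_symm hf,
    extChartAt_source_mem_nhds (I := 𝓘(ℝ, F)) p] with y h1 h2 h3
  rw [mvfderiv_congr h1, mvfderiv_comp_extChartAt_field h3 h2]
  rfl

theorem differentiableAt_fderiv_chartField [CompleteSpace F]
    {U : ∀ p : N, TangentSpace 𝓘(ℝ, F) p} (hU : IsSmoothField U) {f : N → W} {p : N}
    (hf : ContMDiffAt 𝓘(ℝ, F) 𝓘(ℝ, W) ∞ f p) :
    DifferentiableAt ℝ
      (fun z => fderiv ℝ (f ∘ (extChartAt 𝓘(ℝ, F) p).symm) z (chartField U p z))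
      (extChartAt 𝓘(ℝ, F) p p) := by
  have h1 := ((contDiffAt_comp_extChartAt_symm hf).fderiv_right (m := 1)
    (by simpa using! two_le_infty)).differentiableAt (by simp)
  exact h1.clm_apply (differentiableAt_chartField hU p)

theorem mdifferentiableAt_mvfderiv_field [CompleteSpace F]
    {U : ∀ p : N, TangentSpace 𝓘(ℝ, F) p} (hU : IsSmoothField U) {f : N → W} {p : N}
    (hf : ContMDiffAt 𝓘(ℝ, F) 𝓘(ℝ, W) ∞ f p) :
    MDifferentiableAt 𝓘(ℝ, F) 𝓘(ℝ, W) (fun q => mvfderiv 𝓘(ℝ, F) f q (U q)) p := by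
  refine MDifferentiableAt.congr_of_eventuallyEq ?_ (mvfderiv_field_eventuallyEq U hf)
  exact (differentiableAt_fderiv_chartField hU hf).mdifferentiableAt.comp p
    (mdifferentiableAt_extChartAt (mem_chart_source F p))

/-- The derivation along a Lie bracket is the commutator of the derivations. -/
theorem mvfderiv_mlieBracket [CompleteSpace F] {V V' : ∀ p : N, TangentSpace 𝓘(ℝ, F) p}
    (hV : IsSmoothField V) (hV' : IsSmoothField V') {f : N → W} {p : N}
    (hf : ContMDiffAt 𝓘(ℝ, F) 𝓘(ℝ, W) ∞ f p) :
    mvfderiv 𝓘(ℝ, F) f p (mlieBracket 𝓘(ℝ, F) V V' p) =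
      mvfderiv 𝓘(ℝ, F) (fun q => mvfderiv 𝓘(ℝ, F) f q (V' q)) p (V p) -
        mvfderiv 𝓘(ℝ, F) (fun q => mvfderiv 𝓘(ℝ, F) f q (V q)) p (V' p) := by
  have hp : p ∈ (extChartAt 𝓘(ℝ, F) p).source := mem_extChartAt_source p
  rw [mvfderiv_congr (mvfderiv_field_eventuallyEq V hf),
    mvfderiv_congr (mvfderiv_field_eventuallyEq V' hf),
    mvfderiv_congr (eventuallyEq_comp_extChartAt (F := F) f p),
    mvfderiv_comp_extChartAt hp
      (eventually_differentiableAt_comp_extChartAt_symm hf).self_of_nhds, mlieBracket_chart,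
    mvfderiv_comp_extChartAt_field hp (differentiableAt_fderiv_chartField hV' hf),
    mvfderiv_comp_extChartAt_field hp (differentiableAt_fderiv_chartField hV hf)]
  -- Every term now lives in the chart, where the identity rests on the symmetry of the second
  -- derivative.
  exact fderiv_apply_lieBracket (n := ∞) (contDiffAt_comp_extChartAt_symm hf)
    (by simpa using two_le_infty)
    (differentiableAt_chartField hV' p) (differentiableAt_chartField hV p)

theorem contMDiff_mvfderiv {V : ∀ p : N, TangentSpace 𝓘(ℝ, F) p}
    (hV : IsSmoothField V) {f : N → W} (hf : ContMDiff 𝓘(ℝ, F) 𝓘(ℝ, W) ∞ f) :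
    ContMDiff 𝓘(ℝ, F) 𝓘(ℝ, W) ∞ (fun q => mvfderiv 𝓘(ℝ, F) f q (V q)) := by
  have h1 : ContMDiff 𝓘(ℝ, F).tangent 𝓘(ℝ, W).tangent ∞ (tangentMap 𝓘(ℝ, F) 𝓘(ℝ, W) f) :=
    hf.contMDiff_tangentMap le_rfl
  exact (contMDiff_snd_tangentBundle_modelSpace W 𝓘(ℝ, W)).comp (h1.comp hV)

variable [IsManifold 𝓘(ℝ, E) ∞ M]

/-- Brackets of `π`-related vector fields are `π`-related. -/
theorem mfderiv_mlieBracket_of_related [CompleteSpace E] [CompleteSpace F] {π : N → M}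
    (hπ : ContMDiff 𝓘(ℝ, F) 𝓘(ℝ, E) ∞ π)
    {U V : ∀ p : N, TangentSpace 𝓘(ℝ, F) p} (hU : IsSmoothField U) (hV : IsSmoothField V)
    {X Y : ∀ p : M, TangentSpace 𝓘(ℝ, E) p} (hX : IsSmoothField X) (hY : IsSmoothField Y)
    (hUX : ∀ q, mfderiv 𝓘(ℝ, F) 𝓘(ℝ, E) π q (U q) = X (π q))
    (hVY : ∀ q, mfderiv 𝓘(ℝ, F) 𝓘(ℝ, E) π q (V q) = Y (π q)) (q : N) :
    mfderiv 𝓘(ℝ, F) 𝓘(ℝ, E) π q (mlieBracket 𝓘(ℝ, F) U V q) =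
      mlieBracket 𝓘(ℝ, E) X Y (π q) := by
  have hπd : ∀ p, MDifferentiableAt 𝓘(ℝ, F) 𝓘(ℝ, E) π p := fun p =>
    (hπ p).mdifferentiableAt (by simp)
  -- Both tangent vectors are tested with the chart at `π q`: its differential there is injective,
  -- and on the vector-valued functions `φ` and `φ ∘ π` brackets act as commutators.
  set φ : M → E := (extChartAt 𝓘(ℝ, E) (π q) : M → E) with hφ
  have hφs : ContMDiffAt 𝓘(ℝ, E) 𝓘(ℝ, E) ∞ φ (π q) := contMDiffAt_extChartAt
  have hinj : Function.Injective (mfderiv 𝓘(ℝ, E) 𝓘(ℝ, E) φ (π q)) := by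
    have h := isInvertible_mfderiv_extChartAt (I := 𝓘(ℝ, E))
      (mem_extChartAt_source (I := 𝓘(ℝ, E)) (π q))
    exact ContinuousLinearMap.IsInvertible.injective h
  apply hinj
  change mvfderiv 𝓘(ℝ, E) φ (π q) _ = mvfderiv 𝓘(ℝ, E) φ (π q) _
  have hfd : ∀ᶠ p in 𝓝 q, MDifferentiableAt 𝓘(ℝ, E) 𝓘(ℝ, E) φ (π p) := by
    apply (hπ q).continuousAt.eventually
    filter_upwards [(chartAt E (π q)).open_source.mem_nhds (mem_chart_source E (π q))] with y hy
    exact mdifferentiableAt_extChartAt hy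
  rw [← mvfderiv_comp_eq hfd.self_of_nhds (hπd q), mvfderiv_mlieBracket hX hY hφs,
    mvfderiv_mlieBracket hU hV (F := F) (f := fun p => φ (π p)) (hφs.comp q (hπ q))]
  have hrel : ∀ {V : ∀ p : N, TangentSpace 𝓘(ℝ, F) p} {Y : ∀ p : M, TangentSpace 𝓘(ℝ, E) p},
      (∀ q, mfderiv 𝓘(ℝ, F) 𝓘(ℝ, E) π q (V q) = Y (π q)) →
      (fun p => mvfderiv 𝓘(ℝ, F) (fun p => φ (π p)) p (V p)) =ᶠ[𝓝 q]
        fun p => mvfderiv 𝓘(ℝ, E) φ (π p) (Y (π p)) := fun h => by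
    filter_upwards [hfd] with p hp
    rw [mvfderiv_comp_eq hp (hπd p), h]
  have e1 := mvfderiv_congr (F := F) (hrel hVY)
  have e2 := mvfderiv_congr (F := F) (hrel hUX)
  have e3 := mvfderiv_comp_eq (mdifferentiableAt_mvfderiv_field hY hφs) (hπd q) (U q)
  have e4 := mvfderiv_comp_eq (mdifferentiableAt_mvfderiv_field hX hφs) (hπd q) (V q)
  rw [hUX] at e3
  rw [hVY] at e4
  rw [← e3, ← e4, ← e1, ← e2]

/-- A local extension of `v` is cut off by a bump function supported in its domain; the Hausdorff
property provides such bump functions. Pointwise identities can thus be tested on global fields. -/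
theorem exists_isSmoothField_eq [FiniteDimensional ℝ E] [T2Space M] (x : M)
    (v : TangentSpace 𝓘(ℝ, E) x) :
    ∃ X : ∀ y : M, TangentSpace 𝓘(ℝ, E) y, IsSmoothField X ∧ X x = v := by
  obtain ⟨s, hs, hsm⟩ := FiberBundle.exists_contMDiffOn_extend (k := ∞) 𝓘(ℝ, E) E v
  obtain ⟨u, hus, huo, hxu⟩ := mem_nhds_iff.1 hs
  obtain ⟨ρ, hρ⟩ := (SmoothBumpFunction.nhds_basis_tsupport (I := 𝓘(ℝ, E)) x).mem_iff.1
    (huo.mem_nhds hxu)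
  refine ⟨fun y => ρ y • FiberBundle.extend E v y, ?_, ?_⟩
  · exact ContMDiffOn.smul_section_of_tsupport ρ.contMDiff.contMDiffOn huo hρ.2 (hsm.mono hus)
  · change ρ x • FiberBundle.extend E v x = v
    rw [ρ.eq_one, one_smul, FiberBundle.extend_apply_self]

end Calculus

/-! ### Vector fields expressed in a smooth coframe. -/

section Coframe

open VectorField Filter Topology

variable {F : Type*} [NormedAddCommGroup F] [NormedSpace ℝ F] [FiniteDimensional ℝ F]
  {N : Type*} [TopologicalSpace N] [ChartedSpace F N] [IsManifold 𝓘(ℝ, F) ∞ N]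
  {W : Type*} [NormedAddCommGroup W] [NormedSpace ℝ W]

/-- Smoothness of a family of linear maps can be checked on vectors. -/
theorem contMDiffAt_clm_of_apply {W' : Type*} [NormedAddCommGroup W'] [NormedSpace ℝ W']
    [FiniteDimensional ℝ W'] {L : N → W' →L[ℝ] W} {p : N}
    (h : ∀ u, ContMDiffAt 𝓘(ℝ, F) 𝓘(ℝ, W) ∞ (fun q => L q u) p) :
    ContMDiffAt 𝓘(ℝ, F) 𝓘(ℝ, W' →L[ℝ] W) ∞ L p := by
  let b := Module.finBasis ℝ W'
  have hL : L = fun q => ∑ i, ContinuousLinearMap.smulRightL ℝ W' W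
      (LinearMap.toContinuousLinearMap (b.coord i)) (L q (b i)) := by
    funext q
    ext u
    conv_lhs => rw [← b.sum_repr u, map_sum]
    simp
  rw [hL]
  exact ContMDiffAt.sum fun i _ =>
    (ContinuousLinearMap.contMDiff _).contMDiffAt.comp p (h (b i))

variable [FiniteDimensional ℝ W]

theorem contMDiffAt_inverse_apply {W' : Type*} [NormedAddCommGroup W'] [NormedSpace ℝ W']
    [FiniteDimensional ℝ W'] {L : N → W' →L[ℝ] W} {g : N → W} {p : N}
    (hL : ContMDiffAt 𝓘(ℝ, F) 𝓘(ℝ, W' →L[ℝ] W) ∞ L p) (hi : (L p).IsInvertible)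
    (hg : ContMDiffAt 𝓘(ℝ, F) 𝓘(ℝ, W) ∞ g p) :
    ContMDiffAt 𝓘(ℝ, F) 𝓘(ℝ, W') ∞ (fun q => (L q).inverse (g q)) p := by
  have : CompleteSpace W' := FiniteDimensional.complete ℝ W'
  have h1 : ContMDiffAt 𝓘(ℝ, F) 𝓘(ℝ, W →L[ℝ] W') ∞ (fun q => (L q).inverse) p :=
    (hi.contDiffAt_map_inverse (n := ∞)).contMDiffAt.comp p hL
  exact h1.clm_apply hg

variable {α : ∀ p : N, TangentSpace 𝓘(ℝ, F) p ≃ₗ[ℝ] W}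

/-- The vector field with prescribed values of a coframe is smooth. -/
theorem isSmoothField_coframe_symm
    (hα : ContMDiff 𝓘(ℝ, F).tangent 𝓘(ℝ, W) ∞
      (fun v : TangentBundle 𝓘(ℝ, F) N => α v.proj v.snd))
    {g : N → W} (hg : ContMDiff 𝓘(ℝ, F) 𝓘(ℝ, W) ∞ g) :
    IsSmoothField fun p => (α p).symm (g p) := by
  intro p
  rw [Bundle.contMDiffAt_section]
  set e := trivializationAt F (TangentSpace 𝓘(ℝ, F)) p with he
  have hp : p ∈ e.baseSet := FiberBundle.mem_baseSet_trivializationAt' p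
  -- `L q` is the coframe read in the tangent trivialization at `p`; the field in question has
  -- coordinates `(L q)⁻¹ (g q)`, and inversion of linear maps is smooth.
  let L : N → F →L[ℝ] W := fun q =>
    LinearMap.toContinuousLinearMap ((α q).toLinearMap ∘ₗ (e.symmₗ ℝ q))
  have hL : ContMDiffAt 𝓘(ℝ, F) 𝓘(ℝ, F →L[ℝ] W) ∞ L p := by
    apply contMDiffAt_clm_of_apply
    intro u
    -- A fixed vector `u` of the trivialization is a local smooth field, on which the smooth form
    -- `α` can be evaluated.
    have h1 : ContMDiffAt 𝓘(ℝ, F) 𝓘(ℝ, F).tangent ∞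
        (fun q => (⟨q, FiberBundle.extend F (e.symm p u) q⟩ : TangentBundle 𝓘(ℝ, F) N)) p :=
      FiberBundle.contMDiffAt_extend (k := ∞) 𝓘(ℝ, F) F (e.symm p u)
    refine (hα.contMDiffAt.comp p h1).congr_of_eventuallyEq ?_
    filter_upwards [e.open_baseSet.mem_nhds hp] with q hq
    change α q (e.symmₗ ℝ q u) = α q (e.symm q (e ⟨p, e.symm p u⟩).2)
    rw [e.apply_mk_symm hp, e.symmₗ_apply hq]
  let M : ∀ q ∈ e.baseSet, F ≃L[ℝ] W := fun q hq =>
    ((e.continuousLinearEquivAt ℝ q hq).symm.toLinearEquiv.trans (α q)).toContinuousLinearEquiv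
  have hM : ∀ q (hq : q ∈ e.baseSet), L q = M q hq := fun q hq => by
    ext u
    change α q (e.symmₗ ℝ q u) = α q (e.symm q u)
    rw [e.symmₗ_apply hq]
  have hi : ∀ q ∈ e.baseSet, ∀ w : W, (L q).inverse w = (e ⟨q, (α q).symm w⟩).2 := by
    intro q hq w
    rw [hM q hq, ContinuousLinearMap.inverse_equiv]
    rfl
  have hip : (L p).IsInvertible := ⟨M p hp, (hM p hp).symm⟩
  refine (contMDiffAt_inverse_apply hL hip (hg p)).congr_of_eventuallyEq ?_
  filter_upwards [e.open_baseSet.mem_nhds (FiberBundle.mem_baseSet_trivializationAt' p)] with q hq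
  rw [hi q hq]

theorem mlieBracket_sum_smul {ι : Type*} (s : Finset ι) {Z : ∀ p : N, TangentSpace 𝓘(ℝ, F) p}
    {c : ι → N → ℝ} (hc : ∀ i, ContMDiff 𝓘(ℝ, F) 𝓘(ℝ, ℝ) ∞ (c i))
    {Y : ι → ∀ p : N, TangentSpace 𝓘(ℝ, F) p} (hY : ∀ i, IsSmoothField (Y i)) (p : N) :
    mlieBracket 𝓘(ℝ, F) Z (fun q => ∑ i ∈ s, c i q • Y i q) p =
      ∑ i ∈ s, (mvfderiv 𝓘(ℝ, F) (c i) p (Z p) • Y i p +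
        c i p • mlieBracket 𝓘(ℝ, F) Z (Y i) p) := by
  have : CompleteSpace F := FiniteDimensional.complete ℝ F
  have : IsManifold 𝓘(ℝ, F) 2 N := IsManifold.of_le (n := ∞) two_le_infty
  classical
  have hcY : ∀ i, IsSmoothField (fun q => c i q • Y i q) := fun i => (hc i).smul_section (hY i)
  induction s using Finset.induction_on with
  | empty =>
    simp only [Finset.sum_empty]
    exact congrFun (mlieBracket_zero_right (I := 𝓘(ℝ, F)) (W := Z)) p
  | insert i s hi ih =>
    have hs : IsSmoothField (fun q => ∑ i ∈ s, c i q • Y i q) :=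
      ContMDiff.sum_section fun i _ => hcY i
    have h1 : (fun q => ∑ i ∈ insert i s, c i q • Y i q) =
        (fun q => c i q • Y i q) + fun q => ∑ i ∈ s, c i q • Y i q := by
      funext q
      rw [Finset.sum_insert hi]
      rfl
    rw [Finset.sum_insert hi, h1, mlieBracket_add_right ((hcY i).mdifferentiableAt p)
      (hs.mdifferentiableAt p), ih]
    congr 1
    exact mlieBracket_smul_right (((hc i) p).mdifferentiableAt (by simp))
      ((hY i).mdifferentiableAt p)

/-- Bracket with a vector field given by a non-constant function in a coframe. -/
theorem coframe_mlieBracket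
    (hα : ContMDiff 𝓘(ℝ, F).tangent 𝓘(ℝ, W) ∞
      (fun v : TangentBundle 𝓘(ℝ, F) N => α v.proj v.snd))
    {g : N → W} (hg : ContMDiff 𝓘(ℝ, F) 𝓘(ℝ, W) ∞ g) (Z : ∀ p : N, TangentSpace 𝓘(ℝ, F) p)
    (p : N) :
    α p (mlieBracket 𝓘(ℝ, F) Z (fun q => (α q).symm (g q)) p) =
      mvfderiv 𝓘(ℝ, F) g p (Z p) +
        α p (mlieBracket 𝓘(ℝ, F) Z (fun q => (α q).symm (g p)) p) := by
  let b := Module.finBasis ℝ W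
  let B : Fin (Module.finrank ℝ W) → W →L[ℝ] ℝ := fun i =>
    LinearMap.toContinuousLinearMap (b.coord i)
  have hB : ∀ w : W, w = ∑ i, B i w • b i := fun w => (b.sum_repr w).symm
  have hY : ∀ i, IsSmoothField fun q => (α q).symm (b i) := fun i =>
    isSmoothField_coframe_symm hα contMDiff_const
  -- In a basis of `W` the field is a combination of the fields dual to the coframe. The Leibniz
  -- rule splits off the derivatives of the coefficients; the remaining terms have coefficients
  -- frozen at `p`.
  have e1 : ∀ f : N → W, (fun q => (α q).symm (f q)) =
      fun q => ∑ i, B i (f q) • (α q).symm (b i) := by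
    intro f
    funext q
    conv_lhs => rw [hB (f q)]
    rw [map_sum]
    simp only [map_smul]
  have hgd : MDifferentiableAt 𝓘(ℝ, F) 𝓘(ℝ, W) g p := (hg p).mdifferentiableAt (by simp)
  rw [e1 g, e1 fun _ => g p,
    mlieBracket_sum_smul (c := fun i q => B i (g q)) _ (fun i => (B i).contMDiff.comp hg) hY,
    mlieBracket_sum_smul (c := fun i _ => B i (g p)) _ (fun i => contMDiff_const) hY]
  have e2 : ∀ i, mvfderiv 𝓘(ℝ, F) (fun q => B i (g q)) p (Z p) =
      B i (mvfderiv 𝓘(ℝ, F) g p (Z p)) := fun i => mvfderiv_clm_comp _ hgd _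
  simp only [map_sum, map_add, map_smul, mvfderiv_const, LinearEquiv.apply_symm_apply,
    Finset.sum_add_distrib, e2, _root_.zero_apply, zero_smul, zero_add]
  rw [← hB]

end Coframe

/-! ### Principal bundles: sections, the action and vertical vectors. -/

theorem entries_mul {κ : Type} [Fintype κ] [DecidableEq κ] (a b : GL κ ℝ) :
    entries (a * b) = fun i j => ∑ l, entries a i l * entries b l j := by
  funext i j
  simp [entries, Matrix.mul_apply]

namespace PrincipalBundle

open Filter Topology

variable {κ : Type} [Fintype κ] [DecidableEq κ] {H : Subgroup (GL κ ℝ)}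
  {E : Type*} [NormedAddCommGroup E] [NormedSpace ℝ E]
  {M : Type*} [TopologicalSpace M] [ChartedSpace E M]
  {F : Type*} [NormedAddCommGroup F] [NormedSpace ℝ F]
  {P : Type*} [TopologicalSpace P] [ChartedSpace F P]
  (B : PrincipalBundle H (E := E) M (F := F) P)

theorem mdifferentiableAt_proj (p : P) : MDifferentiableAt 𝓘(ℝ, F) 𝓘(ℝ, E) B.proj p :=
  (B.contMDiff_proj p).mdifferentiableAt (by simp)

/-- The structure group acts transitively on fibres. -/
theorem exists_act_eq {p q : P} (h : B.proj p = B.proj q) : ∃ a : H, B.act p a = q := by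
  obtain ⟨U, -, hx, Ψ, k, -, -, -, h2, h3⟩ := B.locally_trivial (B.proj p)
  obtain ⟨⟨a, ha, hak⟩, hap⟩ := h2 p hx
  obtain ⟨⟨b, hb, hbk⟩, hbq⟩ := h2 q (show B.proj q ∈ U by rw [← h]; exact hx)
  refine ⟨⟨a, ha⟩⁻¹ * ⟨b, hb⟩, ?_⟩
  have := h3 (B.proj p) hx ⟨a, ha⟩ (⟨a, ha⟩⁻¹ * ⟨b, hb⟩)
  rw [mul_inv_cancel_left] at this
  rw [← hap, ← hak]
  rw [← this, ← hbq, ← hbk, h]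

/-- A local smooth section through a given point. -/
theorem exists_section (p : P) : ∃ s : M → P, s (B.proj p) = p ∧
    ContMDiffAt 𝓘(ℝ, E) 𝓘(ℝ, F) ∞ s (B.proj p) ∧ ∀ᶠ y in 𝓝 (B.proj p), B.proj (s y) = y := by
  obtain ⟨U, hU, hx, Ψ, k, hΨ, -, h1, h2, -⟩ := B.locally_trivial (B.proj p)
  obtain ⟨⟨a, ha, hak⟩, hap⟩ := h2 p hx
  refine ⟨fun y => Ψ (y, k p), hap, ?_, ?_⟩
  · have hpair : ContMDiffOn 𝓘(ℝ, E) (𝓘(ℝ, E).prod 𝓘(ℝ, κ → κ → ℝ)) ∞ (fun y : M => (y, k p)) U :=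
      contMDiffOn_id.prodMk contMDiffOn_const
    exact (hΨ.comp hpair fun y hy => ⟨hy, a, ha, hak⟩).contMDiffAt (hU.mem_nhds hx)
  · filter_upwards [hU.mem_nhds hx] with y hy
    rw [← hak]
    exact (h1 y hy a ha).1

/-- Smoothness of the action is not part of the structure. It follows from the trivializations, in
which the action is right multiplication by a fixed matrix, a linear map of the entries. -/
theorem contMDiff_act (h : H) : ContMDiff 𝓘(ℝ, F) 𝓘(ℝ, F) ∞ (fun q => B.act q h) := by
  intro p
  obtain ⟨U, hU, hx, Ψ, k, hΨ, hk, h1, h2, h3⟩ := B.locally_trivial (B.proj p)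
  have hact : ∀ q ∈ B.proj ⁻¹' U, B.act q h =
      Ψ (B.proj q, fun i j => ∑ l, k q i l * entries (h : GL κ ℝ) l j) := by
    intro q hq
    obtain ⟨⟨a, ha, hak⟩, haq⟩ := h2 q hq
    have := h3 (B.proj q) hq ⟨a, ha⟩ h
    conv_lhs => rw [← haq, ← hak]
    rw [← this, ← hak]
    change Ψ (_, entries (a * (h : GL κ ℝ))) = _
    rw [entries_mul]
  have hopen : IsOpen (B.proj ⁻¹' U) := hU.preimage B.contMDiff_proj.continuous
  have hmul : ContMDiffOn 𝓘(ℝ, F) 𝓘(ℝ, κ → κ → ℝ) ∞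
      (fun q => fun i j => ∑ l, k q i l * entries (h : GL κ ℝ) l j) (B.proj ⁻¹' U) := by
    have hlin : ContDiff ℝ ∞ (fun a : κ → κ → ℝ => fun i j => ∑ l, a i l * entries (h : GL κ ℝ) l j) := by
      fun_prop
    exact hlin.contMDiff.comp_contMDiffOn hk
  have hpair := B.contMDiff_proj.contMDiffOn.prodMk hmul
  have hcomp := hΨ.comp hpair fun q hq => by
    obtain ⟨⟨a, ha, hak⟩, -⟩ := h2 q hq
    refine ⟨hq, a * (h : GL κ ℝ), H.mul_mem ha h.2, ?_⟩
    rw [entries_mul, hak]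
  exact (hcomp.congr hact).contMDiffAt (hopen.mem_nhds hx)

/-- The differential of a local trivialization splits tangent vectors and gives the velocities of
the action. -/
theorem exists_vertical_splitting (p : P) :
    ∃ (k : P → κ → κ → ℝ) (D : E × (κ → κ → ℝ) →L[ℝ] TangentSpace 𝓘(ℝ, F) p),
      MDifferentiableAt 𝓘(ℝ, F) 𝓘(ℝ, κ → κ → ℝ) k p ∧
      (∀ᶠ q in 𝓝 p, ∃ h ∈ H, entries h = k q) ∧
      (∀ v, v = D (mfderiv 𝓘(ℝ, F) 𝓘(ℝ, E) B.proj p v, mvfderiv 𝓘(ℝ, F) k p v)) ∧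
      ∀ (c : ℝ → H) (b : κ → κ → ℝ), c 0 = 1 →
        HasDerivAt (fun t => entries (c t : GL κ ℝ)) b 0 →
          MDifferentiableAt 𝓘(ℝ, ℝ) 𝓘(ℝ, F) (fun t => B.act p (c t)) 0 ∧
          (mfderiv 𝓘(ℝ, ℝ) 𝓘(ℝ, F) (fun t => B.act p (c t)) 0 (1 : ℝ) : F) =
            D (0, fun i j => ∑ l, k p i l * b l j) := by
  obtain ⟨U, hU, hx, Ψ, k, hΨ, hk, h1, h2, h3⟩ := B.locally_trivial (B.proj p)
  have hopen : IsOpen (B.proj ⁻¹' U) := hU.preimage B.contMDiff_proj.continuous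
  have hmem : B.proj ⁻¹' U ∈ 𝓝 p := hopen.mem_nhds hx
  obtain ⟨⟨a, ha, hak⟩, hap⟩ := h2 p hx
  have hkd : MDifferentiableAt 𝓘(ℝ, F) 𝓘(ℝ, κ → κ → ℝ) k p :=
    (hk.contMDiffAt hmem).mdifferentiableAt (by simp)
  have hS : ∀ q ∈ B.proj ⁻¹' U, (B.proj q, k q) ∈ U ×ˢ {a | ∃ h ∈ H, entries h = a} :=
    fun q hq => ⟨hq, (h2 q hq).1⟩
  have hΨd : MDifferentiableWithinAt (𝓘(ℝ, E).prod 𝓘(ℝ, κ → κ → ℝ)) 𝓘(ℝ, F) Ψ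
      (U ×ˢ {a | ∃ h ∈ H, entries h = a}) (B.proj p, k p) :=
    (hΨ _ (hS p hx)).mdifferentiableWithinAt (by simp)
  have hΨD := hΨd.hasMFDerivWithinAt
  -- `Ψ` is controlled only on `U × H`, in general not an open set of `M × (κ → κ → ℝ)`, so its
  -- derivative within this set need not be unique. Any choice serves: the chain rule is applied
  -- only to maps with values in `U × H`.
  set D := mfderivWithin (𝓘(ℝ, E).prod 𝓘(ℝ, κ → κ → ℝ)) 𝓘(ℝ, F) Ψ
      (U ×ˢ {a | ∃ h ∈ H, entries h = a}) (B.proj p, k p) with hD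
  refine ⟨k, D, hkd, ?_, ?_, ?_⟩
  · filter_upwards [hmem] with q hq using (h2 q hq).1
  · intro v
    -- The splitting of `v` is the derivative of the identity `Ψ (proj q, k q) = q`, valid near `p`.
    have e1 := ((B.mdifferentiableAt_proj p).hasMFDerivAt.prodMk hkd.hasMFDerivAt).hasMFDerivWithinAt
      (s := B.proj ⁻¹' U)
    have e2 := (hΨD.comp p e1 hS).hasMFDerivAt hmem
    have e3 : HasMFDerivAt 𝓘(ℝ, F) 𝓘(ℝ, F) (id : P → P) p _ := e2.congr_of_eventuallyEq (by
      filter_upwards [hmem] with q hq using ((h2 q hq).2).symm)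
    have e4 := hasMFDerivAt_unique (hasMFDerivAt_id p) e3
    exact DFunLike.congr_fun e4 v
  · intro c b hc0 hc
    -- In the trivialization the orbit curve has constant base point and fibre coordinate `k p * c
    -- t`.
    have hact : ∀ t, B.act p (c t) =
        Ψ (B.proj p, fun i j => ∑ l, k p i l * entries (c t : GL κ ℝ) l j) := by
      intro t
      have := h3 (B.proj p) hx ⟨a, ha⟩ (c t)
      conv_lhs => rw [← hap, ← hak]
      rw [← this, ← hak]
      change Ψ (_, entries (a * (c t : GL κ ℝ))) = _
      rw [entries_mul]
    have e1 : HasDerivAt (fun t => fun i j => ∑ l, k p i l * entries (c t : GL κ ℝ) l j)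
        (fun i j => ∑ l, k p i l * b l j) 0 := by
      rw [hasDerivAt_pi]
      intro i
      rw [hasDerivAt_pi]
      intro j
      refine HasDerivAt.fun_sum fun l _ => ?_
      exact (hasDerivAt_pi.1 (hasDerivAt_pi.1 hc l) j).const_mul _
    have e0 : (fun i j => ∑ l, k p i l * entries (c 0 : GL κ ℝ) l j) = k p := by
      rw [← hak, hc0, ← entries_mul]
      simp
    have hΨD' : ∀ a, a = k p → HasMFDerivWithinAt (𝓘(ℝ, E).prod 𝓘(ℝ, κ → κ → ℝ)) 𝓘(ℝ, F) Ψ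
        (U ×ˢ {a | ∃ h ∈ H, entries h = a}) (B.proj p, a) D := by
      rintro _ rfl
      exact hΨD
    have e2 : HasMFDerivAt 𝓘(ℝ, ℝ) (𝓘(ℝ, E).prod 𝓘(ℝ, κ → κ → ℝ))
        (fun t : ℝ => (B.proj p, fun i j => ∑ l, k p i l * entries (c t : GL κ ℝ) l j)) 0 _ :=
      (hasMFDerivAt_const (I := 𝓘(ℝ, ℝ)) (I' := 𝓘(ℝ, E)) (B.proj p) (0 : ℝ)).prodMk
        e1.hasFDerivAt.hasMFDerivAt
    have hmaps : ∀ t ∈ (Set.univ : Set ℝ),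
        (B.proj p, fun i j => ∑ l, k p i l * entries (c t : GL κ ℝ) l j) ∈
          U ×ˢ {a | ∃ h ∈ H, entries h = a} := fun t _ =>
      ⟨hx, a * (c t : GL κ ℝ), H.mul_mem ha (c t).2, by rw [entries_mul, hak]⟩
    have e3 := HasMFDerivWithinAt.comp (0 : ℝ) (hΨD' _ e0) (e2.hasMFDerivWithinAt (s := Set.univ))
      hmaps
    rw [hasMFDerivWithinAt_univ] at e3
    have e4 := e3.congr_of_eventuallyEq (Eventually.of_forall hact)
    refine ⟨e4.mdifferentiableAt, ?_⟩
    rw [e4.mfderiv]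
    change D (0, (1 : ℝ) • _) = _
    rw [one_smul]
    rfl

end PrincipalBundle

/-! ### The splitting of `𝔤` and the algebra of `𝔬(m,n)`. -/

section Algebra

variable {m n : ℕ} {Λ : SignType}

/-- Membership in the Lie algebra `𝔥 = 𝔬(m,n)`. -/
def IsInfOrth (X : Matrix (Idx m n) (Idx m n) ℝ) : Prop := Xᵀ * eta m n + eta m n * X = 0

/-- The inclusion of `𝔥` into `𝔤`. -/
def hIncl (Λ : SignType) (X : Matrix (Idx m n) (Idx m n) ℝ) (hX : IsInfOrth X) :
    modelAlgebra m n Λ :=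
  ⟨fromBlocks X 0 0 0, by
    refine ⟨?_, ?_, ?_⟩
    · rw [toBlocks_fromBlocks₁₁]; exact hX
    · rw [toBlocks_fromBlocks₂₁, toBlocks_fromBlocks₁₂]; simp
    · rw [toBlocks_fromBlocks₂₂]⟩

/-- The `𝔷`-part of an element of `𝔤`. -/
def zPart (m n : ℕ) (Λ : SignType) : modelAlgebra m n Λ →ₗ[ℝ] (Idx m n → ℝ) where
  toFun x i := (x : Matrix (Idx m n ⊕ Unit) (Idx m n ⊕ Unit) ℝ) (Sum.inl i) (Sum.inr ())
  map_add' _ _ := rfl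
  map_smul' _ _ := rfl

/-- The `𝔥`-part of an element of `𝔤`. -/
def hPart (m n : ℕ) (Λ : SignType) : modelAlgebra m n Λ →ₗ[ℝ] Matrix (Idx m n) (Idx m n) ℝ where
  toFun x := (x : Matrix (Idx m n ⊕ Unit) (Idx m n ⊕ Unit) ℝ).toBlocks₁₁
  map_add' _ _ := rfl
  map_smul' _ _ := rfl

theorem isInfOrth_hPart (x : modelAlgebra m n Λ) : IsInfOrth (hPart m n Λ x) := x.2.1

@[simp]
theorem zPart_zIncl (z : Idx m n → ℝ) : zPart m n Λ (zIncl m n Λ z) = z := rfl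

@[simp]
theorem hPart_zIncl (z : Idx m n → ℝ) : hPart m n Λ (zIncl m n Λ z) = 0 := by
  ext i j; rfl

@[simp]
theorem zPart_hIncl (X : Matrix (Idx m n) (Idx m n) ℝ) (hX : IsInfOrth X) :
    zPart m n Λ (hIncl Λ X hX) = 0 := rfl

@[simp]
theorem hPart_hIncl (X : Matrix (Idx m n) (Idx m n) ℝ) (hX : IsInfOrth X) :
    hPart m n Λ (hIncl Λ X hX) = X := rfl

theorem modelAlgebra_ext {x y : modelAlgebra m n Λ} (hh : hPart m n Λ x = hPart m n Λ y)
    (hz : zPart m n Λ x = zPart m n Λ y) : x = y := by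
  have h12 : (x : Matrix (Idx m n ⊕ Unit) (Idx m n ⊕ Unit) ℝ).toBlocks₁₂ =
      (y : Matrix (Idx m n ⊕ Unit) (Idx m n ⊕ Unit) ℝ).toBlocks₁₂ := by
    ext i j
    exact congrFun hz i
  apply Subtype.ext
  rw [← fromBlocks_toBlocks (x : Matrix (Idx m n ⊕ Unit) (Idx m n ⊕ Unit) ℝ),
    ← fromBlocks_toBlocks (y : Matrix (Idx m n ⊕ Unit) (Idx m n ⊕ Unit) ℝ), fromBlocks_inj]
  exact ⟨hh, h12, by rw [x.2.2.1, y.2.2.1, h12], by rw [x.2.2.2, y.2.2.2]⟩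

theorem hIncl_add_zIncl (x : modelAlgebra m n Λ) :
    hIncl Λ (hPart m n Λ x) (isInfOrth_hPart x) + zIncl m n Λ (zPart m n Λ x) = x := by
  apply modelAlgebra_ext <;> simp

theorem eta_mul_eta (m n : ℕ) : eta m n * eta m n = 1 := by
  rw [eta, Matrix.diagonal_mul_diagonal, ← Matrix.diagonal_one]
  congr 1; funext i; rcases i with i | i <;> simp

theorem eta_transpose (m n : ℕ) : (eta m n)ᵀ = eta m n := Matrix.diagonal_transpose _

theorem isInfOrth_iff {X : Matrix (Idx m n) (Idx m n) ℝ} :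
    IsInfOrth X ↔ ∀ v w, (X *ᵥ v) ⬝ᵥ (eta m n *ᵥ w) + v ⬝ᵥ (eta m n *ᵥ (X *ᵥ w)) = 0 := by
  have key : ∀ v w, (X *ᵥ v) ⬝ᵥ (eta m n *ᵥ w) + v ⬝ᵥ (eta m n *ᵥ (X *ᵥ w)) =
      v ⬝ᵥ ((Xᵀ * eta m n + eta m n * X) *ᵥ w) := by
    intro v w
    rw [Matrix.add_mulVec, dotProduct_add, ← Matrix.mulVec_mulVec, ← Matrix.mulVec_mulVec]
    congr 1
    rw [Matrix.dotProduct_mulVec v Xᵀ, Matrix.vecMul_transpose]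
  constructor
  · intro h v w
    rw [key, h]; simp
  · intro h
    ext i j
    have := h (Pi.single i 1) (Pi.single j 1)
    rw [key] at this
    simpa using this

/-- The first prolongation of `𝔬(m,n)` vanishes. -/
theorem eq_zero_of_symm_infOrth {κ : (Idx m n → ℝ) → Matrix (Idx m n) (Idx m n) ℝ}
    (hκ : ∀ z, IsInfOrth (κ z)) (hs : ∀ z w, κ z *ᵥ w = κ w *ᵥ z) (z : Idx m n → ℝ) :
    κ z = 0 := by
  have hη : ∀ v w : Idx m n → ℝ, v ⬝ᵥ (eta m n *ᵥ w) = w ⬝ᵥ (eta m n *ᵥ v) := by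
    intro v w
    rw [Matrix.dotProduct_mulVec, ← Matrix.mulVec_transpose, eta_transpose, dotProduct_comm]
  have hskew : ∀ a b c, (κ a *ᵥ b) ⬝ᵥ (eta m n *ᵥ c) = -((κ a *ᵥ c) ⬝ᵥ (eta m n *ᵥ b)) := by
    intro a b c
    have := isInfOrth_iff.1 (hκ a) b c
    rw [hη b] at this
    linarith
  have h0 : ∀ a b c, (κ a *ᵥ b) ⬝ᵥ (eta m n *ᵥ c) = 0 := by
    intro a b c
    -- The trilinear form `η(κ(a) b, c)` is symmetric in `a, b` and skew in `b, c`. Six swaps of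
    -- alternating kind return to the start and produce three minus signs.
    have h1 : (κ a *ᵥ b) ⬝ᵥ (eta m n *ᵥ c) = -((κ a *ᵥ b) ⬝ᵥ (eta m n *ᵥ c)) := by
      conv_lhs => rw [hskew, hs a c, hskew, hs c b, hskew, hs b a]
      ring
    linarith
  have h1 : ∀ b, κ z *ᵥ b = 0 := by
    intro b
    have h2 : ∀ w, (κ z *ᵥ b) ⬝ᵥ w = 0 := by
      intro w
      have := h0 z b (eta m n *ᵥ w)
      rwa [Matrix.mulVec_mulVec, eta_mul_eta, Matrix.one_mulVec] at this
    exact dotProduct_eq_zero _ h2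
  ext i j
  have := congrFun (h1 (Pi.single j 1)) i
  simpa using this

end Algebra

/-! ### One-parameter subgroups, fundamental fields and admissible frames. -/

section Exp

attribute [local instance] Matrix.linftyOpNormedRing Matrix.linftyOpNormedAlgebra

theorem exists_exp_curve {m n : ℕ} {X : Matrix (Idx m n) (Idx m n) ℝ} (hX : IsInfOrth X) :
    ∃ c : ℝ → orthGroup m n,
      (∀ t, ((c t : GL (Idx m n) ℝ) : Matrix (Idx m n) (Idx m n) ℝ) = NormedSpace.exp (t • X)) ∧
      c 0 = 1 ∧ HasDerivAt (fun t => entries (c t : GL (Idx m n) ℝ)) X 0 := by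
  have h := (mem_formGroup_exp_iff (eta m n) X).2 hX
  choose B hB hBe using h
  refine ⟨fun t => ⟨B t, hB t⟩, hBe, ?_, ?_⟩
  · apply Subtype.ext
    apply Units.ext
    change (B 0 : Matrix (Idx m n) (Idx m n) ℝ) = 1
    rw [hBe]; simp
  · have h1 : HasDerivAt (fun t : ℝ => NormedSpace.exp (t • X)) X 0 := by
      have h0 := hasDerivAt_exp_smul_const X (0 : ℝ)
      rw [zero_smul, NormedSpace.exp_zero, one_mul] at h0
      exact h0
    -- The exponential is differentiated in the operator norm, whereas `entries` takes values in the
    -- pi type; the identity, linear in finite dimension, transports the derivative.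
    let L : Matrix (Idx m n) (Idx m n) ℝ →ₗ[ℝ] (Idx m n → Idx m n → ℝ) :=
      { toFun := fun A => A, map_add' := fun _ _ => rfl, map_smul' := fun _ _ => rfl }
    have h2 := (LinearMap.toContinuousLinearMap L).hasFDerivAt.comp_hasDerivAt (0 : ℝ) h1
    have h3 : (fun t => entries (B t)) =
        (LinearMap.toContinuousLinearMap L) ∘ fun t : ℝ => NormedSpace.exp (t • X) := by
      funext t i j
      change (B t : Matrix (Idx m n) (Idx m n) ℝ) i j = _
      rw [hBe]; rfl
    change HasDerivAt (fun t => entries (B t)) X 0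
    rw [h3]
    exact h2

end Exp

namespace CartanGeometry

open Filter Topology

variable {m n : ℕ} {Λ : SignType}
  {E : Type*} [NormedAddCommGroup E] [NormedSpace ℝ E]
  {M : Type*} [TopologicalSpace M] [ChartedSpace E M]
  {F : Type*} [NormedAddCommGroup F] [NormedSpace ℝ F]
  {P : Type*} [TopologicalSpace P] [ChartedSpace F P] [IsManifold 𝓘(ℝ, F) ∞ P]
  (C : CartanGeometry m n Λ (E := E) M (F := F) P)

theorem eq_conn_symm_of_mfderiv {X : Matrix (Idx m n) (Idx m n) ℝ} (hX : IsInfOrth X)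
    {c : ℝ → orthGroup m n} (hc : ∀ t, ((c t : GL (Idx m n) ℝ) : Matrix (Idx m n) (Idx m n) ℝ) =
      NormedSpace.exp (t • X)) (hc0 : c 0 = 1) (p : P) :
    (mfderiv 𝓘(ℝ, ℝ) 𝓘(ℝ, F) (fun t : ℝ => C.act p (c t)) 0 (1 : ℝ) : F) =
      (C.conn p).symm (hIncl Λ X hX) := by
  -- The velocity is based at `act p (c 0)`, which is only propositionally equal to `p`; a free base
  -- point `q` allows substitution.
  have key : ∀ q, q = p → ∀ v : TangentSpace 𝓘(ℝ, F) q,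
      (C.conn q v : Matrix (Idx m n ⊕ Unit) (Idx m n ⊕ Unit) ℝ) = fromBlocks X 0 0 0 →
        (v : F) = (C.conn p).symm (hIncl Λ X hX) := by
    rintro q rfl v hv
    exact ((C.conn q).symm_apply_eq.2 (Subtype.ext hv.symm)).symm
  exact key _ (by rw [hc0, C.act_one]) _ (C.conn_fundamental X c hc p)

/-- The flow of a fundamental vector field. -/
theorem exists_curve {X : Matrix (Idx m n) (Idx m n) ℝ} (hX : IsInfOrth X) (p : P) :
    ∃ c : ℝ → orthGroup m n, c 0 = 1 ∧
      HasDerivAt (fun t => entries (c t : GL (Idx m n) ℝ)) X 0 ∧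
      HasMFDerivAt 𝓘(ℝ, ℝ) 𝓘(ℝ, F) (fun t : ℝ => C.act p (c t)) 0
        (ContinuousLinearMap.toSpanSingleton ℝ
          ((C.conn p).symm (hIncl Λ X hX) : F) : ℝ →L[ℝ] F) := by
  obtain ⟨c, hc, hc0, hd⟩ := exists_exp_curve hX
  obtain ⟨k, D, -, -, -, h⟩ := C.exists_vertical_splitting p
  refine ⟨c, hc0, hd, ?_⟩
  have h1 := (h c X hc0 hd).1.hasMFDerivAt
  have h2 : mfderiv 𝓘(ℝ, ℝ) 𝓘(ℝ, F) (fun t : ℝ => C.act p (c t)) 0 =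
      (ContinuousLinearMap.toSpanSingleton ℝ
          ((C.conn p).symm (hIncl Λ X hX) : F) : ℝ →L[ℝ] F) := by
    refine ContinuousLinearMap.ext_ring ?_
    refine Eq.trans (b := ((C.conn p).symm (hIncl Λ X hX) : F)) ?_ ?_
    · exact C.eq_conn_symm_of_mfderiv hX hc hc0 p
    · exact (one_smul ℝ _).symm
  rw [← h2]
  exact h1

/-- `proj` is constant along the orbit curve that has this velocity. -/
theorem mfderiv_proj_conn_symm_hIncl {X : Matrix (Idx m n) (Idx m n) ℝ} (hX : IsInfOrth X) (p : P) :
    mfderiv 𝓘(ℝ, F) 𝓘(ℝ, E) C.proj p ((C.conn p).symm (hIncl Λ X hX)) = 0 := by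
  obtain ⟨c, hc0, -, hm⟩ := C.exists_curve hX p
  have h0 : C.act p (c 0) = p := by rw [hc0, C.act_one]
  have h1 : ∀ q, q = p → HasMFDerivAt 𝓘(ℝ, F) 𝓘(ℝ, E) C.proj q
      (mfderiv 𝓘(ℝ, F) 𝓘(ℝ, E) C.proj p : F →L[ℝ] E) := by
    rintro q rfl
    exact (C.mdifferentiableAt_proj q).hasMFDerivAt
  have h2 := HasMFDerivAt.comp (0 : ℝ) (h1 _ h0) hm
  have h3 : (C.proj ∘ fun t : ℝ => C.act p (c t)) = fun _ => C.proj p := by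
    funext t; exact C.proj_act _ _
  rw [h3] at h2
  have h4 := hasMFDerivAt_unique h2 (hasMFDerivAt_const (C.proj p) (0 : ℝ))
  have h5 := DFunLike.congr_fun h4 (1 : ℝ)
  have h6 : (mfderiv 𝓘(ℝ, F) 𝓘(ℝ, E) C.proj p
    ((1 : ℝ) • ((C.conn p).symm (hIncl Λ X hX))) : E) = 0 := h5
  rwa [one_smul] at h6

/-- Vertical vectors are fundamental. In a trivialization a vertical `v` is determined by the
derivative `b` of the fibre coordinate `k`. Differentiating `kᵀ η k = η` shows `k(p)⁻¹ b ∈ 𝔬(m,n)`,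
and the orbit curve generated by this element has velocity `v`. -/
theorem exists_isInfOrth_of_mfderiv_proj_eq_zero {p : P} {v : TangentSpace 𝓘(ℝ, F) p}
    (hv : mfderiv 𝓘(ℝ, F) 𝓘(ℝ, E) C.proj p v = 0) :
    ∃ (X : Matrix (Idx m n) (Idx m n) ℝ) (hX : IsInfOrth X),
      v = (C.conn p).symm (hIncl Λ X hX) := by
  obtain ⟨k, D, hk, hkH, hD, h⟩ := C.exists_vertical_splitting p
  set b : Idx m n → Idx m n → ℝ := mvfderiv 𝓘(ℝ, F) k p v with hb
  have hvD : v = D (0, b) := by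
    have := hD v
    rw [hv] at this
    exact this
  obtain ⟨a, ha, hak⟩ := hkH.self_of_nhds
  have hη : ∀ᶠ q in 𝓝 p, (of (k q))ᵀ * eta m n * of (k q) = eta m n := by
    filter_upwards [hkH] with q hq
    obtain ⟨g, hg, hgk⟩ := hq
    rw [← hgk]
    exact hg
  have hder : (of b)ᵀ * eta m n * of (k p) + (of (k p))ᵀ * eta m n * of b = 0 := by
    ext i j
    let β : (Idx m n → Idx m n → ℝ) →ₗ[ℝ] (Idx m n → Idx m n → ℝ) →ₗ[ℝ] ℝ :=
      LinearMap.mk₂ ℝ (fun x y => ((of x)ᵀ * eta m n * of y) i j)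
        (fun x y z => by
          change ((of x + of y)ᵀ * eta m n * of z) i j = _
          rw [transpose_add, Matrix.add_mul, Matrix.add_mul]; rfl)
        (fun r x y => by
          change ((r • of x)ᵀ * eta m n * of y) i j = _
          rw [transpose_smul, Matrix.smul_mul, Matrix.smul_mul]; rfl)
        (fun x y z => by
          change ((of x)ᵀ * eta m n * (of y + of z)) i j = _
          rw [Matrix.mul_add]; rfl)
        (fun r x y => by
          change ((of x)ᵀ * eta m n * (r • of y)) i j = _
          rw [Matrix.mul_smul]; rfl)
    have h1 := mvfderiv_bilin β.toContinuousBilinearMap hk hk v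
    have h2 : (fun q => β.toContinuousBilinearMap (k q) (k q)) =ᶠ[𝓝 p] fun _ => eta m n i j := by
      filter_upwards [hη] with q hq
      change ((of (k q))ᵀ * eta m n * of (k q)) i j = _
      rw [hq]
    rw [mvfderiv_congr h2, mvfderiv_const] at h1
    exact h1.symm
  set K := of (k p) with hK
  have hKη : Kᵀ * eta m n * K = eta m n := hη.self_of_nhds
  -- For `K ∈ O(m,n)` the inverse is `η Kᵀ η`.
  set L := eta m n * Kᵀ * eta m n with hL
  have hLK : L * K = 1 := by
    rw [hL, Matrix.mul_assoc, Matrix.mul_assoc, ← Matrix.mul_assoc Kᵀ, hKη, eta_mul_eta]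
  have hKL : K * L = 1 := mul_eq_one_comm.mp hLK
  have hηL : eta m n * L = Kᵀ * eta m n := by
    rw [hL, ← Matrix.mul_assoc, ← Matrix.mul_assoc, eta_mul_eta, Matrix.one_mul]
  have hLη : Lᵀ * eta m n = eta m n * K := by
    rw [hL, transpose_mul, transpose_mul, transpose_transpose, eta_transpose, Matrix.mul_assoc,
      Matrix.mul_assoc, eta_mul_eta, Matrix.mul_one]
  have hX : IsInfOrth (L * of b) := by
    rw [IsInfOrth, transpose_mul, Matrix.mul_assoc, hLη, ← Matrix.mul_assoc, ← Matrix.mul_assoc,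
      hηL]
    exact hder
  refine ⟨L * of b, hX, ?_⟩
  obtain ⟨c, hc, hc0, hd⟩ := exists_exp_curve hX
  have h3 := (h c _ hc0 hd).2
  have h4 : (fun i j => ∑ l, k p i l * (L * of b) l j) = b := by
    have : K * (L * of b) = of b := by rw [← Matrix.mul_assoc, hKL, Matrix.one_mul]
    exact this
  rw [h4, C.eq_conn_symm_of_mfderiv hX hc hc0 p] at h3
  exact hvD.trans h3.symm

theorem frame_apply (p : P) (z : Idx m n → ℝ) : C.frame p z =
    mfderiv 𝓘(ℝ, F) 𝓘(ℝ, E) C.proj p ((C.conn p).symm (zIncl m n Λ z)) := rfl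

/-- The `𝔥`-part of `A(v)` corresponds to a vertical vector, so `dπ(v)` depends on the `𝔷`-part
alone. -/
theorem frame_zPart (p : P) (v : TangentSpace 𝓘(ℝ, F) p) :
    C.frame p (zPart m n Λ (C.conn p v)) = mfderiv 𝓘(ℝ, F) 𝓘(ℝ, E) C.proj p v := by
  have h : v = (C.conn p).symm (hIncl Λ _ (isInfOrth_hPart (C.conn p v))) +
      (C.conn p).symm (zIncl m n Λ (zPart m n Λ (C.conn p v))) := by
    rw [← map_add, hIncl_add_zIncl, LinearEquiv.symm_apply_apply]
  conv_rhs => rw [h, map_add, C.mfderiv_proj_conn_symm_hIncl, zero_add]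
  rfl

/-- Injective: a vector with value in `𝔷` that is vertical has its value also in `𝔥`, hence is zero.
Surjective: `proj` has smooth local sections through every point. -/
theorem frame_isInvertible (p : P) : (C.frame p).IsInvertible := by
  have hinj : Function.Injective (C.frame p) := by
    rw [injective_iff_map_eq_zero]
    intro z hz
    obtain ⟨X, hX, h⟩ := C.exists_isInfOrth_of_mfderiv_proj_eq_zero ((C.frame_apply p z).symm.trans hz)
    have h1 := congrArg (zPart m n Λ) ((C.conn p).symm.injective h)
    simpa using h1
  have hsurj : Function.Surjective (C.frame p) := by
    intro x
    obtain ⟨s, hsp, hs, hps⟩ := C.exists_section p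
    have h1 := mfderiv_comp_apply_of_eq (I := 𝓘(ℝ, E)) (I' := 𝓘(ℝ, F)) (I'' := 𝓘(ℝ, E))
      (C.proj p) (C.mdifferentiableAt_proj p) (hs.mdifferentiableAt (by simp)) hsp x
    have h2 : C.proj ∘ s =ᶠ[𝓝 (C.proj p)] id := hps
    rw [h2.mfderiv_eq, mfderiv_id] at h1
    exact ⟨_, (C.frame_zPart p _).trans h1.symm⟩
  have : T2Space (TangentSpace 𝓘(ℝ, E) (C.proj p)) := inferInstanceAs (T2Space E)
  let e : (Idx m n → ℝ) ≃ₗ[ℝ] TangentSpace 𝓘(ℝ, E) (C.proj p) :=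
    LinearEquiv.ofBijective (C.frame p).toLinearMap ⟨hinj, hsurj⟩
  exact ⟨e.toContinuousLinearEquiv, by ext; rfl⟩

end CartanGeometry

/-! ### Smoothness in `𝔤` and equivariance of the connection and the frames. -/

section ModelAlgebraNorm

attribute [local instance] Matrix.normedAddCommGroup Matrix.normedSpace

/-- A norm on `𝔤`. -/
abbrev modelAlgebraNormed (m n : ℕ) (Λ : SignType) : NormedAddCommGroup (modelAlgebra m n Λ) :=
  inferInstance

/-- A norm on `𝔤`, as a normed space. -/
abbrev modelAlgebraNormedSpace (m n : ℕ) (Λ : SignType) :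
    @NormedSpace ℝ (modelAlgebra m n Λ) _ (modelAlgebraNormed m n Λ).toSeminormedAddCommGroup :=
  inferInstance

/-- The norm uniformity of `𝔤`. -/
abbrev modelAlgebraUniformity (m n : ℕ) (Λ : SignType) : UniformSpace (modelAlgebra m n Λ) :=
  (modelAlgebraNormed m n Λ).toMetricSpace.toPseudoMetricSpace.toUniformSpace

/-- The norm topology of `𝔤`. -/
abbrev modelAlgebraTopology (m n : ℕ) (Λ : SignType) : TopologicalSpace (modelAlgebra m n Λ) :=
  (modelAlgebraUniformity m n Λ).toTopologicalSpace

end ModelAlgebraNorm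

attribute [local instance] modelAlgebraNormed modelAlgebraNormedSpace modelAlgebraUniformity
  modelAlgebraTopology

theorem mulVec_inv_mulVec {m n : ℕ} (h : orthGroup m n) (z : Idx m n → ℝ) :
    ((h : GL (Idx m n) ℝ) : Matrix (Idx m n) (Idx m n) ℝ) *ᵥ
      ((((h⁻¹ : orthGroup m n) : GL (Idx m n) ℝ) : Matrix (Idx m n) (Idx m n) ℝ) *ᵥ z) = z := by
  rw [Matrix.mulVec_mulVec]
  have : ((h : GL (Idx m n) ℝ) : Matrix (Idx m n) (Idx m n) ℝ) *
      (((h⁻¹ : orthGroup m n) : GL (Idx m n) ℝ) : Matrix (Idx m n) (Idx m n) ℝ) = 1 := by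
    rw [Subgroup.coe_inv, ← Units.val_mul, mul_inv_cancel, Units.val_one]
  rw [this, Matrix.one_mulVec]

theorem dotProduct_eta_mulVec {m n : ℕ} (h : orthGroup m n) (v w : Idx m n → ℝ) :
    (((h : GL (Idx m n) ℝ) : Matrix (Idx m n) (Idx m n) ℝ) *ᵥ v) ⬝ᵥ
      (eta m n *ᵥ (((h : GL (Idx m n) ℝ) : Matrix (Idx m n) (Idx m n) ℝ) *ᵥ w)) =
      v ⬝ᵥ (eta m n *ᵥ w) := by
  have hh : ((h : GL (Idx m n) ℝ) : Matrix (Idx m n) (Idx m n) ℝ)ᵀ * eta m n *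
    ((h : GL (Idx m n) ℝ) : Matrix (Idx m n) (Idx m n) ℝ) = eta m n := h.2
  rw [← Matrix.vecMul_transpose, ← Matrix.dotProduct_mulVec, Matrix.mulVec_mulVec,
    Matrix.mulVec_mulVec, hh]

/-- Smoothness of an `𝔤`-valued map can be checked on matrix entries. -/
theorem contMDiff_modelAlgebra {m n : ℕ} {Λ : SignType}
    {V : Type*} [NormedAddCommGroup V] [NormedSpace ℝ V] {T : Type*} [TopologicalSpace T]
    {I : ModelWithCorners ℝ V T} {N : Type*} [TopologicalSpace N] [ChartedSpace T N]
    {f : N → modelAlgebra m n Λ} (hf : ∀ i j, ContMDiff I 𝓘(ℝ, ℝ) ∞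
      fun p => (f p : Matrix (Idx m n ⊕ Unit) (Idx m n ⊕ Unit) ℝ) i j) :
    ContMDiff I 𝓘(ℝ, modelAlgebra m n Λ) ∞ f := by
  -- A linear left inverse of the inclusion recovers the `𝔤`-valued map from its matrix entries.
  obtain ⟨R, hR⟩ := LinearMap.exists_leftInverse_of_injective (modelAlgebra m n Λ).subtype
    (Submodule.ker_subtype _)
  let S : (Idx m n ⊕ Unit → Idx m n ⊕ Unit → ℝ) →ₗ[ℝ] modelAlgebra m n Λ :=
    { toFun := fun A => R (of A), map_add' := fun A B => map_add R (of A) (of B),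
      map_smul' := fun r A => map_smul R r (of A) }
  have h1 : ContMDiff I 𝓘(ℝ, Idx m n ⊕ Unit → Idx m n ⊕ Unit → ℝ) ∞ (fun p => fun i j =>
      (f p : Matrix (Idx m n ⊕ Unit) (Idx m n ⊕ Unit) ℝ) i j) := by
    rw [contMDiff_pi_space]
    intro i
    rw [contMDiff_pi_space]
    intro j
    exact hf i j
  refine ((LinearMap.toContinuousLinearMap S).contMDiff.comp h1).congr fun p => ?_
  exact (LinearMap.congr_fun hR (f p)).symm

namespace CartanGeometry

open Filter Topology VectorField

variable {m n : ℕ} {Λ : SignType}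
  {E : Type*} [NormedAddCommGroup E] [NormedSpace ℝ E] [FiniteDimensional ℝ E]
  {M : Type*} [TopologicalSpace M] [ChartedSpace E M] [IsManifold 𝓘(ℝ, E) ∞ M]
  {F : Type*} [NormedAddCommGroup F] [NormedSpace ℝ F] [FiniteDimensional ℝ F]
  {P : Type*} [TopologicalSpace P] [ChartedSpace F P] [IsManifold 𝓘(ℝ, F) ∞ P]
  (C : CartanGeometry m n Λ (E := E) M (F := F) P)

theorem contMDiff_conn' : ContMDiff 𝓘(ℝ, F).tangent 𝓘(ℝ, modelAlgebra m n Λ) ∞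
    (fun v : TangentBundle 𝓘(ℝ, F) P => C.conn v.proj v.snd) :=
  contMDiff_modelAlgebra C.contMDiff_conn

theorem contMDiff_conn_field {V : ∀ p : P, TangentSpace 𝓘(ℝ, F) p} (hV : IsSmoothField V) :
    ContMDiff 𝓘(ℝ, F) 𝓘(ℝ, modelAlgebra m n Λ) ∞ fun p => C.conn p (V p) :=
  C.contMDiff_conn'.comp hV

theorem isSmoothField_conn_symm {g : P → modelAlgebra m n Λ}
    (hg : ContMDiff 𝓘(ℝ, F) 𝓘(ℝ, modelAlgebra m n Λ) ∞ g) :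
    IsSmoothField fun p => (C.conn p).symm (g p) :=
  isSmoothField_coframe_symm C.contMDiff_conn' hg

theorem conn_mlieBracket {g : P → modelAlgebra m n Λ}
    (hg : ContMDiff 𝓘(ℝ, F) 𝓘(ℝ, modelAlgebra m n Λ) ∞ g)
    (Z : ∀ p : P, TangentSpace 𝓘(ℝ, F) p) (p : P) :
    C.conn p (mlieBracket 𝓘(ℝ, F) Z (fun q => (C.conn q).symm (g q)) p) =
      mvfderiv 𝓘(ℝ, F) g p (Z p) +
        C.conn p (mlieBracket 𝓘(ℝ, F) Z (fun q => (C.conn q).symm (g p)) p) :=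
  coframe_mlieBracket C.contMDiff_conn' hg Z p

/-- `Ad(h⁻¹)` preserves the splitting: it acts by `h⁻¹` on `𝔷` and by conjugation on `𝔥`. -/
theorem zPart_conn_act (h : orthGroup m n) (p : P) (v : TangentSpace 𝓘(ℝ, F) p) :
    zPart m n Λ (C.conn (C.act p h) (mfderiv 𝓘(ℝ, F) 𝓘(ℝ, F) (fun q => C.act q h) p v)) =
      (((h⁻¹ : orthGroup m n) : GL (Idx m n) ℝ) : Matrix (Idx m n) (Idx m n) ℝ) *ᵥ
        zPart m n Λ (C.conn p v) := by
  funext i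
  change (C.conn (C.act p h) (mfderiv 𝓘(ℝ, F) 𝓘(ℝ, F) (fun q => C.act q h) p v) :
    Matrix (Idx m n ⊕ Unit) (Idx m n ⊕ Unit) ℝ) (Sum.inl i) (Sum.inr ()) = _
  rw [C.conn_equivariant]
  simp [incl, Matrix.mul_apply, Matrix.mulVec, dotProduct]
  rfl

theorem hPart_conn_act (h : orthGroup m n) (p : P) (v : TangentSpace 𝓘(ℝ, F) p) :
    hPart m n Λ (C.conn (C.act p h) (mfderiv 𝓘(ℝ, F) 𝓘(ℝ, F) (fun q => C.act q h) p v)) =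
      (((h⁻¹ : orthGroup m n) : GL (Idx m n) ℝ) : Matrix (Idx m n) (Idx m n) ℝ) *
        hPart m n Λ (C.conn p v) * ((h : GL (Idx m n) ℝ) : Matrix (Idx m n) (Idx m n) ℝ) := by
  ext i j
  change (C.conn (C.act p h) (mfderiv 𝓘(ℝ, F) 𝓘(ℝ, F) (fun q => C.act q h) p v) :
    Matrix (Idx m n ⊕ Unit) (Idx m n ⊕ Unit) ℝ) (Sum.inl i) (Sum.inl j) = _
  rw [C.conn_equivariant]
  simp [incl, Matrix.mul_apply, hPart, toBlocks₁₁]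

theorem mdifferentiableAt_act (h : orthGroup m n) (p : P) :
    MDifferentiableAt 𝓘(ℝ, F) 𝓘(ℝ, F) (fun q => C.act q h) p :=
  (C.contMDiff_act h p).mdifferentiableAt (by simp)

/-- This is `φ(p h) = φ(p) ∘ h`, obtained from `π ∘ R_h = π` and the equivariance of `A`. It is
stated in `E` because the two sides lie in tangent spaces at base points that are only
propositionally equal. -/
theorem frame_act (h : orthGroup m n) (p : P) (z : Idx m n → ℝ) :
    (C.frame (C.act p h) ((((h⁻¹ : orthGroup m n) : GL (Idx m n) ℝ) :
      Matrix (Idx m n) (Idx m n) ℝ) *ᵥ z) : E) = C.frame p z := by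
  have h1 := mfderiv_comp_apply (I := 𝓘(ℝ, F)) (I' := 𝓘(ℝ, F)) (I'' := 𝓘(ℝ, E)) p
    (C.mdifferentiableAt_proj (C.act p h)) (C.mdifferentiableAt_act h p)
    ((C.conn p).symm (zIncl m n Λ z))
  have h2 : (C.proj ∘ fun q => C.act q h) = C.proj := funext fun q => C.proj_act q h
  rw [h2] at h1
  have h3 := C.frame_zPart (C.act p h) (mfderiv 𝓘(ℝ, F) 𝓘(ℝ, F) (fun q => C.act q h) p
    ((C.conn p).symm (zIncl m n Λ z)))
  rw [C.zPart_conn_act, LinearEquiv.apply_symm_apply, zPart_zIncl] at h3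
  exact h3.trans h1.symm

theorem frame_inverse_frame (p : P) (z : Idx m n → ℝ) : (C.frame p).inverse (C.frame p z) = z :=
  (C.frame_isInvertible p).inverse_apply_self z

theorem frame_frame_inverse (p : P) (v : TangentSpace 𝓘(ℝ, E) (C.proj p)) :
    C.frame p ((C.frame p).inverse v) = v :=
  (C.frame_isInvertible p).self_apply_inverse v

theorem frame_equivariantFunction (X : ∀ x : M, TangentSpace 𝓘(ℝ, E) x) (p : P) :
    C.frame p (C.equivariantFunction X p) = X (C.proj p) :=
  C.frame_frame_inverse p _

theorem equivariantFunction_eq_iff {X : ∀ x : M, TangentSpace 𝓘(ℝ, E) x} {p : P}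
    {z : Idx m n → ℝ} : C.equivariantFunction X p = z ↔ X (C.proj p) = C.frame p z := by
  constructor
  · rintro rfl
    exact (C.frame_equivariantFunction X p).symm
  · intro h
    rw [equivariantFunction, h, C.frame_inverse_frame]

end CartanGeometry

/-! ### Equivariant functions and horizontal fields. -/

namespace CartanGeometry

open Filter Topology VectorField

variable {m n : ℕ} {Λ : SignType}
  {E : Type*} [NormedAddCommGroup E] [NormedSpace ℝ E] [FiniteDimensional ℝ E]
  {M : Type*} [TopologicalSpace M] [ChartedSpace E M] [IsManifold 𝓘(ℝ, E) ∞ M]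
  {F : Type*} [NormedAddCommGroup F] [NormedSpace ℝ F] [FiniteDimensional ℝ F]
  {P : Type*} [TopologicalSpace P] [ChartedSpace F P] [IsManifold 𝓘(ℝ, F) ∞ P]
  (C : CartanGeometry m n Λ (E := E) M (F := F) P)

/-- The vector field on `P` on which `A` takes the values `g`, for a `𝔷`-valued function `g`. -/
def zField (g : P → Idx m n → ℝ) (p : P) : TangentSpace 𝓘(ℝ, F) p :=
  (C.conn p).symm (zIncl m n Λ (g p))

/-- The horizontal lift of a vector field. -/
def fieldLift (X : ∀ x : M, TangentSpace 𝓘(ℝ, E) x) : ∀ p : P, TangentSpace 𝓘(ℝ, F) p :=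
  C.zField (C.equivariantFunction X)

/-- The `𝔷`-part of the Cartan connection. -/
def solder (p : P) (v : TangentSpace 𝓘(ℝ, F) p) : Idx m n → ℝ := zPart m n Λ (C.conn p v)

theorem isSmoothField_zField {g : P → Idx m n → ℝ}
    (hg : ContMDiff 𝓘(ℝ, F) 𝓘(ℝ, Idx m n → ℝ) ∞ g) : IsSmoothField (C.zField g) :=
  C.isSmoothField_conn_symm ((LinearMap.toContinuousLinearMap (zIncl m n Λ)).contMDiff.comp hg)

theorem contMDiff_solder {V : ∀ p : P, TangentSpace 𝓘(ℝ, F) p} (hV : IsSmoothField V) :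
    ContMDiff 𝓘(ℝ, F) 𝓘(ℝ, Idx m n → ℝ) ∞ fun p => C.solder p (V p) :=
  (LinearMap.toContinuousLinearMap (zPart m n Λ)).contMDiff.comp (C.contMDiff_conn_field hV)

theorem solder_zField (g : P → Idx m n → ℝ) (p : P) : C.solder p (C.zField g p) = g p := by
  rw [solder, zField, LinearEquiv.apply_symm_apply, zPart_zIncl]

theorem mfderiv_proj_fieldLift (X : ∀ x : M, TangentSpace 𝓘(ℝ, E) x) (p : P) :
    mfderiv 𝓘(ℝ, F) 𝓘(ℝ, E) C.proj p (C.fieldLift X p) = X (C.proj p) :=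
  C.frame_equivariantFunction X p

/-- Near a point, `X` is the smooth map `dπ ∘ V` composed with a local section. -/
theorem isSmoothField_of_related {V : ∀ p : P, TangentSpace 𝓘(ℝ, F) p} (hV : IsSmoothField V)
    {X : ∀ x : M, TangentSpace 𝓘(ℝ, E) x}
    (h : ∀ p, mfderiv 𝓘(ℝ, F) 𝓘(ℝ, E) C.proj p (V p) = X (C.proj p)) : IsSmoothField X := by
  intro x
  obtain ⟨p, rfl⟩ := C.proj_surjective x
  obtain ⟨s, hsp, hs, hps⟩ := C.exists_section p
  have h1 : ContMDiff 𝓘(ℝ, F) 𝓘(ℝ, E).tangent ∞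
      (fun q : P => tangentMap 𝓘(ℝ, F) 𝓘(ℝ, E) C.proj ⟨q, V q⟩) :=
    (C.contMDiff_proj.contMDiff_tangentMap le_rfl).comp hV
  have h2 : ContMDiff 𝓘(ℝ, F) 𝓘(ℝ, E).tangent ∞
      (fun q : P => (⟨C.proj q, X (C.proj q)⟩ : TangentBundle 𝓘(ℝ, E) M)) :=
    h1.congr fun q => congrArg (Bundle.TotalSpace.mk (C.proj q)) (h q).symm
  refine (h2.contMDiffAt.comp (C.proj p) hs).congr_of_eventuallyEq ?_
  filter_upwards [hps] with y hy
  change (⟨y, X y⟩ : TangentBundle 𝓘(ℝ, E) M) = ⟨C.proj (s y), X (C.proj (s y))⟩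
  rw [hy]

theorem eventually_proj_mem_baseSet (p : P) : ∀ᶠ q in 𝓝 p,
    C.proj q ∈ (trivializationAt E (TangentSpace 𝓘(ℝ, E)) (C.proj p)).baseSet :=
  C.contMDiff_proj.continuous.continuousAt.eventually
    ((trivializationAt E (TangentSpace 𝓘(ℝ, E)) (C.proj p)).open_baseSet.mem_nhds
      (FiberBundle.mem_baseSet_trivializationAt' _))

/-- The frame `q` in the coordinates at `p`. -/
def frameCoord (p q : P) : (Idx m n → ℝ) →L[ℝ] E :=
  ((trivializationAt E (TangentSpace 𝓘(ℝ, E)) (C.proj p)).continuousLinearMapAt ℝ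
    (C.proj q)).comp (C.frame q)

theorem frameCoord_apply {p q : P}
    (hq : C.proj q ∈ (trivializationAt E (TangentSpace 𝓘(ℝ, E)) (C.proj p)).baseSet)
    (z : Idx m n → ℝ) : C.frameCoord p q z =
      (trivializationAt E (TangentSpace 𝓘(ℝ, E)) (C.proj p) ⟨C.proj q, C.frame q z⟩).2 :=
  Bundle.Trivialization.continuousLinearMapAt_apply_of_mem ℝ _ hq _

theorem isInvertible_frameCoord {p q : P}
    (hq : C.proj q ∈ (trivializationAt E (TangentSpace 𝓘(ℝ, E)) (C.proj p)).baseSet) :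
    (C.frameCoord p q).IsInvertible := by
  rw [frameCoord, ← Bundle.Trivialization.coe_continuousLinearEquivAt_eq' _ hq]
  exact (ContinuousLinearMap.isInvertible_equiv).comp (C.frame_isInvertible q)

/-- For fixed `z` the frame is `dπ` of the smooth field on which `A` is constantly `z`. -/
theorem contMDiffAt_frameCoord (p : P) :
    ContMDiffAt 𝓘(ℝ, F) 𝓘(ℝ, (Idx m n → ℝ) →L[ℝ] E) ∞ (C.frameCoord p) p := by
  apply contMDiffAt_clm_of_apply
  intro z
  have h1 : ContMDiff 𝓘(ℝ, F) 𝓘(ℝ, E).tangent ∞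
      (fun q : P => tangentMap 𝓘(ℝ, F) 𝓘(ℝ, E) C.proj ⟨q, C.zField (fun _ => z) q⟩) :=
    (C.contMDiff_proj.contMDiff_tangentMap le_rfl).comp
      (C.isSmoothField_zField contMDiff_const)
  have h2 := (Bundle.contMDiffAt_totalSpace.1 (h1 p)).2
  refine h2.congr_of_eventuallyEq ?_
  filter_upwards [C.eventually_proj_mem_baseSet p] with q hq
  exact C.frameCoord_apply hq z

theorem contMDiff_equivariantFunction {X : ∀ x : M, TangentSpace 𝓘(ℝ, E) x}
    (hX : IsSmoothField X) :
    ContMDiff 𝓘(ℝ, F) 𝓘(ℝ, Idx m n → ℝ) ∞ (C.equivariantFunction X) := by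
  intro p
  have hX' := (Bundle.contMDiffAt_totalSpace.1 (hX (C.proj p))).2.comp p (C.contMDiff_proj p)
  have hp := (C.eventually_proj_mem_baseSet p).self_of_nhds
  refine (contMDiffAt_inverse_apply (C.contMDiffAt_frameCoord p) (C.isInvertible_frameCoord hp)
    hX').congr_of_eventuallyEq ?_
  filter_upwards [C.eventually_proj_mem_baseSet p] with q hq
  have h3 : (trivializationAt E (TangentSpace 𝓘(ℝ, E)) (C.proj p) ⟨C.proj q, X (C.proj q)⟩).2 =
      C.frameCoord p q (C.equivariantFunction X q) := by
    rw [C.frameCoord_apply hq, C.frame_equivariantFunction]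
  exact ((congrArg (C.frameCoord p q).inverse h3).trans
    ((C.isInvertible_frameCoord hq).inverse_apply_self _)).symm

theorem mdifferentiableAt_equivariantFunction {X : ∀ x : M, TangentSpace 𝓘(ℝ, E) x}
    (hX : IsSmoothField X) (p : P) :
    MDifferentiableAt 𝓘(ℝ, F) 𝓘(ℝ, Idx m n → ℝ) (C.equivariantFunction X) p :=
  (C.contMDiff_equivariantFunction hX p).mdifferentiableAt (by simp)

theorem isSmoothField_fieldLift {X : ∀ x : M, TangentSpace 𝓘(ℝ, E) x}
    (hX : IsSmoothField X) : IsSmoothField (C.fieldLift X) :=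
  C.isSmoothField_zField (C.contMDiff_equivariantFunction hX)

theorem frame_solder (p : P) (v : TangentSpace 𝓘(ℝ, F) p) :
    C.frame p (C.solder p v) = mfderiv 𝓘(ℝ, F) 𝓘(ℝ, E) C.proj p v := C.frame_zPart p v

theorem equivariantFunction_act (X : ∀ x : M, TangentSpace 𝓘(ℝ, E) x) (h : orthGroup m n) (p : P) :
    C.equivariantFunction X (C.act p h) =
      (((h⁻¹ : orthGroup m n) : GL (Idx m n) ℝ) : Matrix (Idx m n) (Idx m n) ℝ) *ᵥ
        C.equivariantFunction X p := by
  rw [equivariantFunction_eq_iff]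
  have h1 : ∀ x y : M, x = y → (X x : E) = X y := by rintro x _ rfl; rfl
  exact (h1 _ _ (C.proj_act p h)).trans ((C.frame_equivariantFunction X p).symm.trans
    (C.frame_act h p _).symm)

/-- The derivative of an equivariant function along a fundamental vector field. -/
theorem mvfderiv_equivariantFunction_hIncl {X : ∀ x : M, TangentSpace 𝓘(ℝ, E) x}
    (hX : IsSmoothField X) {K : Matrix (Idx m n) (Idx m n) ℝ} (hK : IsInfOrth K) (p : P) :
    mvfderiv 𝓘(ℝ, F) (C.equivariantFunction X) p ((C.conn p).symm (hIncl Λ K hK)) =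
      -(K *ᵥ C.equivariantFunction X p) := by
  obtain ⟨c, hc0, hc, hm⟩ := C.exists_curve hK p
  have h0 : C.act p (c 0) = p := by rw [hc0, C.act_one]
  have h1 : ∀ q, q = p → HasMFDerivAt 𝓘(ℝ, F) 𝓘(ℝ, Idx m n → ℝ) (C.equivariantFunction X) q
      (mvfderiv 𝓘(ℝ, F) (C.equivariantFunction X) p : F →L[ℝ] (Idx m n → ℝ)) := by
    rintro q rfl
    exact (C.mdifferentiableAt_equivariantFunction hX q).hasMFDerivAt
  have h2 := (HasMFDerivAt.comp (0 : ℝ) (h1 _ h0) hm).hasFDerivAt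
  have h3 : HasDerivAt (fun t => C.equivariantFunction X (C.act p (c t)))
      (mvfderiv 𝓘(ℝ, F) (C.equivariantFunction X) p ((C.conn p).symm (hIncl Λ K hK))) 0 := by
    refine (hasDerivAt_iff_hasFDerivAt.2 (h2.congr_fderiv ?_))
    refine ContinuousLinearMap.ext_ring ?_
    refine Eq.trans ?_ (one_smul ℝ _).symm
    exact congrArg (mvfderiv 𝓘(ℝ, F) (C.equivariantFunction X) p) (one_smul ℝ _)
  -- Equivariance makes `c(t) f_X(p c(t))` constant in `t`; its derivative at `0` gives the claim.
  have h4 : ∀ t, ((c t : GL (Idx m n) ℝ) : Matrix (Idx m n) (Idx m n) ℝ) *ᵥ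
      C.equivariantFunction X (C.act p (c t)) = C.equivariantFunction X p := fun t => by
    rw [equivariantFunction_act, mulVec_inv_mulVec]
  funext i
  have h5 : HasDerivAt (fun t => ∑ j, entries (c t : GL (Idx m n) ℝ) i j *
      C.equivariantFunction X (C.act p (c t)) j) _ 0 :=
    HasDerivAt.fun_sum fun j _ =>
      (hasDerivAt_pi.1 (hasDerivAt_pi.1 hc i) j).mul (hasDerivAt_pi.1 h3 j)
  have h6 : (fun t => ∑ j, entries (c t : GL (Idx m n) ℝ) i j *
      C.equivariantFunction X (C.act p (c t)) j) = fun _ => C.equivariantFunction X p i :=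
    funext fun t => congrFun (h4 t) i
  rw [h6] at h5
  have h7 := h5.unique (hasDerivAt_const (0 : ℝ) _)
  rw [Finset.sum_add_distrib, h0] at h7
  have h8 : ∀ z : Idx m n → ℝ, ∑ j, entries (c 0 : GL (Idx m n) ℝ) i j * z j = z i := by
    intro z
    have : ((c 0 : GL (Idx m n) ℝ) : Matrix (Idx m n) (Idx m n) ℝ) *ᵥ z = z := by
      rw [hc0]
      exact Matrix.one_mulVec z
    exact congrFun this i
  rw [h8] at h7
  exact eq_neg_of_add_eq_zero_right h7

end CartanGeometry

/-! ### Smoothness and the Jacobi identity of the Lie bracket. -/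

section LieBracket

open VectorField

variable {E : Type*} [NormedAddCommGroup E] [NormedSpace ℝ E] [FiniteDimensional ℝ E]
  {M : Type*} [TopologicalSpace M] [ChartedSpace E M] [IsManifold 𝓘(ℝ, E) ∞ M]
  {X Y Z : ∀ x : M, TangentSpace 𝓘(ℝ, E) x}

theorem isSmoothField_mlieBracket (hX : IsSmoothField X) (hY : IsSmoothField Y) :
    IsSmoothField (mlieBracket 𝓘(ℝ, E) X Y) := by
  have : CompleteSpace E := FiniteDimensional.complete ℝ E
  intro x
  have h2 : IsManifold 𝓘(ℝ, E) (minSmoothness ℝ 2) M := by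
    rw [minSmoothness_of_isRCLikeNormedField]
    exact IsManifold.of_le (n := ∞) two_le_infty
  have h3 : IsManifold 𝓘(ℝ, E) (((⊤ : ℕ∞) : WithTop ℕ∞) + 1) M := ‹IsManifold 𝓘(ℝ, E) ∞ M›
  refine ContMDiffAt.mlieBracket_vectorField (m := ⊤) (n := ⊤) (hX x) (hY x) ?_
  rw [minSmoothness_of_isRCLikeNormedField]
  exact le_rfl

theorem leibniz_mlieBracket (hX : IsSmoothField X) (hY : IsSmoothField Y) (hZ : IsSmoothField Z)
    (x : M) : mlieBracket 𝓘(ℝ, E) X (mlieBracket 𝓘(ℝ, E) Y Z) x =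
      mlieBracket 𝓘(ℝ, E) (mlieBracket 𝓘(ℝ, E) X Y) Z x +
        mlieBracket 𝓘(ℝ, E) Y (mlieBracket 𝓘(ℝ, E) X Z) x := by
  have : CompleteSpace E := FiniteDimensional.complete ℝ E
  have h2 : minSmoothness ℝ 2 ≤ ∞ := by
    rw [minSmoothness_of_isRCLikeNormedField]
    exact two_le_infty
  have h3 : IsManifold 𝓘(ℝ, E) (minSmoothness ℝ 3) M := by
    rw [minSmoothness_of_isRCLikeNormedField]
    exact IsManifold.of_le (n := ∞) (WithTop.coe_le_coe.2 (le_top : (3 : ℕ∞) ≤ ⊤))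
  exact leibniz_identity_mlieBracket_apply ((hX x).of_le h2) ((hY x).of_le h2) ((hZ x).of_le h2)

end LieBracket

/-! ### Metric, covariant derivative and torsion at an arbitrary frame. -/

namespace CartanGeometry

open Filter Topology VectorField

variable {m n : ℕ} {Λ : SignType}
  {E : Type*} [NormedAddCommGroup E] [NormedSpace ℝ E] [FiniteDimensional ℝ E]
  {M : Type*} [TopologicalSpace M] [ChartedSpace E M] [IsManifold 𝓘(ℝ, E) ∞ M]
  {F : Type*} [NormedAddCommGroup F] [NormedSpace ℝ F] [FiniteDimensional ℝ F]
  {P : Type*} [TopologicalSpace P] [ChartedSpace F P] [IsManifold 𝓘(ℝ, F) ∞ P]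
  (C : CartanGeometry m n Λ (E := E) M (F := F) P)

theorem frameAt_frameAt_inverse {x : M} {p : P} (hp : C.proj p = x) (v : TangentSpace 𝓘(ℝ, E) x) :
    C.frameAt hp ((C.frameAt hp).inverse v) = v := by
  subst hp
  exact C.frame_frame_inverse p v

theorem frameAt_inverse_frameAt {x : M} {p : P} (hp : C.proj p = x) (z : Idx m n → ℝ) :
    (C.frameAt hp).inverse (C.frameAt hp z) = z := by
  subst hp
  exact C.frame_inverse_frame p z

theorem frameAt_act {x : M} {p : P} (hp : C.proj p = x) {h : orthGroup m n}
    (hq : C.proj (C.act p h) = x) (z : Idx m n → ℝ) :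
    C.frameAt hq ((((h⁻¹ : orthGroup m n) : GL (Idx m n) ℝ) : Matrix (Idx m n) (Idx m n) ℝ) *ᵥ z) =
      C.frameAt hp z := by
  have key : ∀ (y : M) (hy : C.proj (C.act p h) = y) (hpy : C.proj p = y),
      (C.frameAt hy ((((h⁻¹ : orthGroup m n) : GL (Idx m n) ℝ) :
        Matrix (Idx m n) (Idx m n) ℝ) *ᵥ z) : E) =
      C.frameAt hpy z := by
    intro y hy hpy
    have e1 : ∀ (q : P) (hq : C.proj q = y) (w : Idx m n → ℝ),
        (C.frameAt hq w : E) = C.frame q w := by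
      rintro q rfl w
      rfl
    exact (e1 _ hy _).trans ((C.frame_act h p z).trans (e1 _ hpy _).symm)
  exact key x hq hp

theorem frameAt_inverse_act {x : M} {p : P} (hp : C.proj p = x) {h : orthGroup m n}
    (hq : C.proj (C.act p h) = x) (v : TangentSpace 𝓘(ℝ, E) x) :
    (C.frameAt hq).inverse v =
      (((h⁻¹ : orthGroup m n) : GL (Idx m n) ℝ) : Matrix (Idx m n) (Idx m n) ℝ) *ᵥ
        (C.frameAt hp).inverse v := by
  conv_lhs => rw [← C.frameAt_frameAt_inverse hp v, ← C.frameAt_act hp hq]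
  rw [C.frameAt_inverse_frameAt]

/-- `metric` uses the chosen point `pointOver x`. The structure group is transitive on the fibre and
preserves `η`, so any other frame gives the same value. -/
theorem metric_proj (p : P) (v w : TangentSpace 𝓘(ℝ, E) (C.proj p)) :
    C.metric (C.proj p) v w = (C.frame p).inverse v ⬝ᵥ (eta m n *ᵥ (C.frame p).inverse w) := by
  have key : ∀ (q : P) (hq : C.proj q = C.proj p),
      (C.frameAt hq).inverse v ⬝ᵥ (eta m n *ᵥ (C.frameAt hq).inverse w) =
        (C.frame p).inverse v ⬝ᵥ (eta m n *ᵥ (C.frame p).inverse w) := by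
    intro q hq
    obtain ⟨h, rfl⟩ := C.exists_act_eq hq.symm
    rw [C.frameAt_inverse_act rfl hq, C.frameAt_inverse_act rfl hq, dotProduct_eta_mulVec]
    rfl
  exact key _ _

theorem metric_field (X Y : ∀ x : M, TangentSpace 𝓘(ℝ, E) x) (p : P) :
    C.metric (C.proj p) (X (C.proj p)) (Y (C.proj p)) =
      C.equivariantFunction X p ⬝ᵥ (eta m n *ᵥ C.equivariantFunction Y p) :=
  C.metric_proj p _ _

/-- Right translations preserve horizontality, which makes the covariant derivative independent of
the frame. -/
theorem mfderiv_act_zField {p : P} {h : orthGroup m n} (z : Idx m n → ℝ) :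
    mfderiv 𝓘(ℝ, F) 𝓘(ℝ, F) (fun q => C.act q h) p ((C.conn p).symm (zIncl m n Λ z)) =
      (C.conn (C.act p h)).symm (zIncl m n Λ
        ((((h⁻¹ : orthGroup m n) : GL (Idx m n) ℝ) : Matrix (Idx m n) (Idx m n) ℝ) *ᵥ z)) := by
  rw [LinearEquiv.eq_symm_apply]
  apply modelAlgebra_ext
  · rw [C.hPart_conn_act]
    simp
  · rw [C.zPart_conn_act]
    simp

/-- The covariant derivative computed at an arbitrary frame. -/
theorem covDeriv_proj {X : ∀ x : M, TangentSpace 𝓘(ℝ, E) x} (hX : IsSmoothField X) (p : P)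
    (v : TangentSpace 𝓘(ℝ, E) (C.proj p)) :
    C.covDeriv X (C.proj p) v = C.frame p (mvfderiv 𝓘(ℝ, F) (C.equivariantFunction X) p
      ((C.conn p).symm (zIncl m n Λ ((C.frame p).inverse v)))) := by
  have key : ∀ (q : P) (hq : C.proj q = C.proj p),
      C.frameAt hq (mvfderiv 𝓘(ℝ, F) (C.equivariantFunction X) q
        ((C.conn q).symm (zIncl m n Λ ((C.frameAt hq).inverse v)))) =
      C.frame p (mvfderiv 𝓘(ℝ, F) (C.equivariantFunction X) p
        ((C.conn p).symm (zIncl m n Λ ((C.frame p).inverse v)))) := by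
    intro q hq
    obtain ⟨h, rfl⟩ := C.exists_act_eq hq.symm
    rw [C.frameAt_inverse_act rfl hq, ← C.mfderiv_act_zField,
      ← mvfderiv_comp_eq (C.mdifferentiableAt_equivariantFunction hX _)
        (C.mdifferentiableAt_act h p)]
    have h1 : (fun q => C.equivariantFunction X (C.act q h)) = fun q =>
        LinearMap.toContinuousLinearMap (Matrix.mulVecLin
          (((h⁻¹ : orthGroup m n) : GL (Idx m n) ℝ) : Matrix (Idx m n) (Idx m n) ℝ))
            (C.equivariantFunction X q) :=
      funext fun q => C.equivariantFunction_act X h q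
    rw [h1, mvfderiv_clm_comp _ (C.mdifferentiableAt_equivariantFunction hX p)]
    exact C.frameAt_act rfl hq _
  exact key _ _

/-- The function on `P` representing the torsion. -/
theorem torsion_proj {X Y : ∀ x : M, TangentSpace 𝓘(ℝ, E) x} (hX : IsSmoothField X)
    (hY : IsSmoothField Y) (p : P) :
    C.torsion X Y (C.proj p) = C.frame p
      (mvfderiv 𝓘(ℝ, F) (C.equivariantFunction Y) p (C.fieldLift X p) -
        mvfderiv 𝓘(ℝ, F) (C.equivariantFunction X) p (C.fieldLift Y p) -
        C.equivariantFunction (mlieBracket 𝓘(ℝ, E) X Y) p) := by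
  rw [map_sub, map_sub, frame_equivariantFunction, torsion, C.covDeriv_proj hY, C.covDeriv_proj hX]
  rfl

theorem equivariantFunction_torsion {X Y : ∀ x : M, TangentSpace 𝓘(ℝ, E) x} (hX : IsSmoothField X)
    (hY : IsSmoothField Y) (p : P) :
    C.equivariantFunction (C.torsion X Y) p =
      mvfderiv 𝓘(ℝ, F) (C.equivariantFunction Y) p (C.fieldLift X p) -
        mvfderiv 𝓘(ℝ, F) (C.equivariantFunction X) p (C.fieldLift Y p) -
        C.equivariantFunction (mlieBracket 𝓘(ℝ, E) X Y) p := by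
  rw [equivariantFunction_eq_iff, C.torsion_proj hX hY]

/-- The torsion is `dπ` of a smooth horizontal field. Its smoothness is needed because the bracket
of `ξ` with `T(X,Y)` enters `L_ξ T`. -/
theorem isSmoothField_torsion {X Y : ∀ x : M, TangentSpace 𝓘(ℝ, E) x} (hX : IsSmoothField X)
    (hY : IsSmoothField Y) : IsSmoothField (C.torsion X Y) := by
  refine C.isSmoothField_of_related (C.isSmoothField_zField (g := fun p =>
      mvfderiv 𝓘(ℝ, F) (C.equivariantFunction Y) p (C.fieldLift X p) -
        mvfderiv 𝓘(ℝ, F) (C.equivariantFunction X) p (C.fieldLift Y p) -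
        C.equivariantFunction (mlieBracket 𝓘(ℝ, E) X Y) p) ?_)
    fun p => (C.torsion_proj hX hY p).symm
  exact ((contMDiff_mvfderiv (C.isSmoothField_fieldLift hX)
    (C.contMDiff_equivariantFunction hY)).sub (contMDiff_mvfderiv (C.isSmoothField_fieldLift hY)
    (C.contMDiff_equivariantFunction hX))).sub
      (C.contMDiff_equivariantFunction (isSmoothField_mlieBracket hX hY))

end CartanGeometry

/-! ### The complete lift in induced coordinates. -/

section BaseCoordinates

open Filter Topology VectorField

variable {E : Type*} [NormedAddCommGroup E] [NormedSpace ℝ E] [FiniteDimensional ℝ E]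
  {M : Type*} [TopologicalSpace M] [ChartedSpace E M] [IsManifold 𝓘(ℝ, E) ∞ M]

theorem trivializationAt_self_apply (x : M) (v : TangentSpace 𝓘(ℝ, E) x) :
    ((trivializationAt E (TangentSpace 𝓘(ℝ, E)) x ⟨x, v⟩).2 : E) = v := by
  have : IsManifold 𝓘(ℝ, E) 1 M := IsManifold.of_le (n := ∞) (by simp)
  have h := tangentCoordChange_self (I := 𝓘(ℝ, E)) (x := x) (z := x) (v := v)
    (mem_extChartAt_source x)
  exact h

/-- A vector field in the coordinates of the preferred chart at `x`. -/
def fieldCoord (X : ∀ x : M, TangentSpace 𝓘(ℝ, E) x) (x y : M) : E :=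
  (trivializationAt E (TangentSpace 𝓘(ℝ, E)) x ⟨y, X y⟩).2

theorem contMDiffAt_fieldCoord {X : ∀ x : M, TangentSpace 𝓘(ℝ, E) x} (hX : IsSmoothField X)
    (x : M) : ContMDiffAt 𝓘(ℝ, E) 𝓘(ℝ, E) ∞ (fieldCoord X x) x :=
  (Bundle.contMDiffAt_totalSpace.1 (hX x)).2

theorem fieldCoord_eventuallyEq (X : ∀ x : M, TangentSpace 𝓘(ℝ, E) x) (x : M) :
    fieldCoord X x =ᶠ[𝓝 x] chartField X x ∘ extChartAt 𝓘(ℝ, E) x := by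
  have : IsManifold 𝓘(ℝ, E) 1 M := IsManifold.of_le (n := ∞) (by simp)
  filter_upwards [extChartAt_source_mem_nhds (I := 𝓘(ℝ, E)) x] with y hy
  have hy' : y ∈ (chartAt E x).source := by rwa [extChartAt_source] at hy
  have h1 := DFunLike.congr_fun
    (TangentBundle.continuousLinearMapAt_trivializationAt (I := 𝓘(ℝ, E)) hy') (X y)
  have h2 := Bundle.Trivialization.continuousLinearMapAt_apply_of_mem ℝ
    (trivializationAt E (TangentSpace 𝓘(ℝ, E)) x) (b := y) hy' (X y)
  exact h2.symm.trans (h1.trans (chartField_apply X hy).symm)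

/-- The coordinates are those in which `completeLift` is written. At the base point `x` itself the
trivialization is the identity, so the left side needs no conversion. -/
theorem mlieBracket_eq_fieldCoord {X Y : ∀ x : M, TangentSpace 𝓘(ℝ, E) x} (hX : IsSmoothField X)
    (hY : IsSmoothField Y) (x : M) :
    (mlieBracket 𝓘(ℝ, E) X Y x : E) = mvfderiv 𝓘(ℝ, E) (fieldCoord Y x) x (X x) -
      mvfderiv 𝓘(ℝ, E) (fieldCoord X x) x (Y x) := by
  have : CompleteSpace E := FiniteDimensional.complete ℝ E
  have : IsManifold 𝓘(ℝ, E) 1 M := IsManifold.of_le (n := ∞) (by simp)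
  have hx : x ∈ (extChartAt 𝓘(ℝ, E) x).source := mem_extChartAt_source x
  rw [mvfderiv_congr (fieldCoord_eventuallyEq Y x), mvfderiv_congr (fieldCoord_eventuallyEq X x),
    mvfderiv_comp_extChartAt_field hx (differentiableAt_chartField hY x),
    mvfderiv_comp_extChartAt_field hx (differentiableAt_chartField hX x)]
  refine Eq.trans ?_ (mlieBracket_chart X Y x)
  have h1 := DFunLike.congr_fun (TangentBundle.continuousLinearMapAt_trivializationAt
    (I := 𝓘(ℝ, E)) (mem_chart_source E x)) (mlieBracket 𝓘(ℝ, E) X Y x)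
  have h2 := Bundle.Trivialization.continuousLinearMapAt_apply_of_mem ℝ
    (trivializationAt E (TangentSpace 𝓘(ℝ, E)) x) (b := x) (mem_chart_source E x)
      (mlieBracket 𝓘(ℝ, E) X Y x)
  exact (trivializationAt_self_apply (E := E) x _).symm.trans (h2.symm.trans h1)

end BaseCoordinates

namespace CartanGeometry

open Filter Topology VectorField

variable {m n : ℕ} {Λ : SignType}
  {E : Type*} [NormedAddCommGroup E] [NormedSpace ℝ E] [FiniteDimensional ℝ E]
  {M : Type*} [TopologicalSpace M] [ChartedSpace E M] [IsManifold 𝓘(ℝ, E) ∞ M]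
  {F : Type*} [NormedAddCommGroup F] [NormedSpace ℝ F] [FiniteDimensional ℝ F]
  {P : Type*} [TopologicalSpace P] [ChartedSpace F P] [IsManifold 𝓘(ℝ, F) ∞ P]
  (C : CartanGeometry m n Λ (E := E) M (F := F) P)

theorem mdifferentiableAt_frameCoord (p : P) :
    MDifferentiableAt 𝓘(ℝ, F) 𝓘(ℝ, (Idx m n → ℝ) →L[ℝ] E) (C.frameCoord p) p :=
  (C.contMDiffAt_frameCoord p).mdifferentiableAt (by simp)

theorem frameCoord_self (p : P) (z : Idx m n → ℝ) : C.frameCoord p p z = (C.frame p z : E) := by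
  rw [C.frameCoord_apply (FiberBundle.mem_baseSet_trivializationAt' _)]
  exact trivializationAt_self_apply _ _

theorem trivializationAt_toHomBundle (p q : P) :
    trivializationAt ((Idx m n → ℝ) →L[ℝ] E) (fun x : M => Bundle.Trivial M (Idx m n → ℝ) x →L[ℝ]
      TangentSpace 𝓘(ℝ, E) x) (C.proj p) (C.toHomBundle q) = (C.proj q, C.frameCoord p q) := by
  rw [hom_trivializationAt_apply]
  refine Prod.ext rfl ?_
  simp only [ContinuousLinearMap.inCoordinates]
  ext z
  simp [frameCoord, toHomBundle]
  rfl

/-- In the induced coordinates at `p`, `φ` reads `q ↦ (proj q, frameCoord p q)`. -/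
theorem hasMFDerivAt_toHomBundle (p : P) :
    HasMFDerivAt 𝓘(ℝ, F) (homModel m n E) C.toHomBundle p
      ((mfderiv 𝓘(ℝ, F) 𝓘(ℝ, E) C.proj p : F →L[ℝ] E).prod
        (mvfderiv 𝓘(ℝ, F) (C.frameCoord p) p : F →L[ℝ] ((Idx m n → ℝ) →L[ℝ] E))) := by
  have h1 := (C.mdifferentiableAt_proj p).hasMFDerivAt
  have h2 := (C.mdifferentiableAt_frameCoord p).hasMFDerivAt
  have hc : ∀ q, (trivializationAt ((Idx m n → ℝ) →L[ℝ] E) (fun x : M =>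
      Bundle.Trivial M (Idx m n → ℝ) x →L[ℝ] TangentSpace 𝓘(ℝ, E) x) (C.toHomBundle p).proj
        (C.toHomBundle q)).2 = C.frameCoord p q := fun q =>
    congrArg Prod.snd (C.trivializationAt_toHomBundle p q)
  refine ⟨?_, ?_⟩
  · have h3 : ContMDiffAt 𝓘(ℝ, F) (homModel m n E) ∞ C.toHomBundle p := by
      refine Bundle.contMDiffAt_totalSpace.2 ⟨C.contMDiff_proj p, ?_⟩
      simp only [hc]
      exact C.contMDiffAt_frameCoord p
    exact h3.continuousAt
  · have h3 := h1.2.prodMk h2.2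
    have h4 : ∀ z, writtenInExtChartAt 𝓘(ℝ, F) (homModel m n E) p C.toHomBundle z =
        (writtenInExtChartAt 𝓘(ℝ, F) 𝓘(ℝ, E) p C.proj z,
          writtenInExtChartAt 𝓘(ℝ, F) 𝓘(ℝ, (Idx m n → ℝ) →L[ℝ] E) p (C.frameCoord p) z) := by
      intro z
      rw [writtenInExtChartAt, FiberBundle.extChartAt]
      refine Prod.ext rfl ?_
      exact hc _
    exact h3.congr_of_eventuallyEq (Eventually.of_forall h4) (h4 _)

/-- Differentiate `X = φ(q) f_X(q)` along `w` in coordinates and subtract `[ξ,X] = ∂_ξ X - ∂_X ξ`.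
What remains is `(wφ) f_X + φ (w f_X) = φ f_[ξ,X] + ∂_{φ f_X} ξ`, so the fibre condition `(wφ) z =
∂_{φ z} ξ` of the complete lift and `w f_X = f_[ξ,X]` imply each other. -/
theorem mfderiv_toHomBundle_eq_completeLift_iff [T2Space M] {ξ : ∀ x : M, TangentSpace 𝓘(ℝ, E) x}
    (hξ : IsSmoothField ξ) (p : P) (w : TangentSpace 𝓘(ℝ, F) p) :
    mfderiv 𝓘(ℝ, F) (homModel m n E) C.toHomBundle p w = completeLift ξ (C.toHomBundle p) ↔
      mfderiv 𝓘(ℝ, F) 𝓘(ℝ, E) C.proj p w = ξ (C.proj p) ∧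
      ∀ X : ∀ x : M, TangentSpace 𝓘(ℝ, E) x, IsSmoothField X →
        mvfderiv 𝓘(ℝ, F) (C.equivariantFunction X) p w =
          C.equivariantFunction (mlieBracket 𝓘(ℝ, E) ξ X) p := by
  have h1 : mfderiv 𝓘(ℝ, F) (homModel m n E) C.toHomBundle p w = completeLift ξ (C.toHomBundle p) ↔
      mfderiv 𝓘(ℝ, F) 𝓘(ℝ, E) C.proj p w = ξ (C.proj p) ∧
      ∀ z, mvfderiv 𝓘(ℝ, F) (C.frameCoord p) p w z =
        mvfderiv 𝓘(ℝ, E) (fieldCoord ξ (C.proj p)) (C.proj p) (C.frame p z) := by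
    rw [(C.hasMFDerivAt_toHomBundle p).mfderiv]
    exact Prod.ext_iff.trans (and_congr Iff.rfl ContinuousLinearMap.ext_iff)
  rw [h1]
  refine and_congr_right fun hw => ?_
  have h2 : ∀ X : ∀ x : M, TangentSpace 𝓘(ℝ, E) x, IsSmoothField X →
      mvfderiv 𝓘(ℝ, F) (C.frameCoord p) p w (C.equivariantFunction X p) +
        C.frameCoord p p (mvfderiv 𝓘(ℝ, F) (C.equivariantFunction X) p w) =
      C.frameCoord p p (C.equivariantFunction (mlieBracket 𝓘(ℝ, E) ξ X) p) +
        mvfderiv 𝓘(ℝ, E) (fieldCoord ξ (C.proj p)) (C.proj p)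
          (C.frame p (C.equivariantFunction X p)) := by
    intro X hX
    have e1 : (fun q => fieldCoord X (C.proj p) (C.proj q)) =ᶠ[𝓝 p] fun q =>
        C.frameCoord p q (C.equivariantFunction X q) := by
      filter_upwards [C.eventually_proj_mem_baseSet p] with q hq
      rw [C.frameCoord_apply hq, C.frame_equivariantFunction]
      rfl
    have e2 := mvfderiv_bilin (ContinuousLinearMap.id ℝ ((Idx m n → ℝ) →L[ℝ] E))
      (C.mdifferentiableAt_frameCoord p) (C.mdifferentiableAt_equivariantFunction hX p) w
    have e3 := mvfderiv_comp_eq ((contMDiffAt_fieldCoord hX (C.proj p)).mdifferentiableAt (by simp))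
      (C.mdifferentiableAt_proj p) w
    have e4 := congrFun (congrArg DFunLike.coe (mvfderiv_congr (F := F) e1)) w
    rw [hw] at e3
    have e5 := mlieBracket_eq_fieldCoord hξ hX (C.proj p)
    have e6 := (C.frame_equivariantFunction (mlieBracket 𝓘(ℝ, E) ξ X) p)
    have e7 := C.frame_equivariantFunction X p
    have e8 := C.frameCoord_self p (C.equivariantFunction (mlieBracket 𝓘(ℝ, E) ξ X) p)
    refine e2.symm.trans (e4.symm.trans (e3.trans ?_))
    rw [e7]
    exact sub_eq_iff_eq_add.1 (e5.symm.trans (e6.symm.trans e8.symm))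
  constructor
  · intro h X hX
    have h3 := h2 X hX
    rw [h, add_comm] at h3
    exact (C.isInvertible_frameCoord
      (C.eventually_proj_mem_baseSet p).self_of_nhds).injective (add_right_cancel h3)
  · intro h z
    -- The functions `f_X` attain every value at `p`, so a condition on all `X` gives one on all
    -- `z`.
    obtain ⟨X, hX, hXz⟩ := exists_isSmoothField_eq (C.proj p) (C.frame p z)
    have h3 := h2 X hX
    have h4 : C.equivariantFunction X p = z := C.equivariantFunction_eq_iff.2 hXz
    rw [h X hX, add_comm, h4] at h3
    exact add_left_cancel h3

end CartanGeometry

/-! ### Tangency of the complete lift and isometries. -/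

namespace CartanGeometry

open Filter Topology VectorField

variable {m n : ℕ} {Λ : SignType}
  {E : Type*} [NormedAddCommGroup E] [NormedSpace ℝ E] [FiniteDimensional ℝ E]
  {M : Type*} [TopologicalSpace M] [ChartedSpace E M] [IsManifold 𝓘(ℝ, E) ∞ M]
  {F : Type*} [NormedAddCommGroup F] [NormedSpace ℝ F] [FiniteDimensional ℝ F]
  {P : Type*} [TopologicalSpace P] [ChartedSpace F P] [IsManifold 𝓘(ℝ, F) ∞ P]
  (C : CartanGeometry m n Λ (E := E) M (F := F) P)
  {ξ X Y : ∀ x : M, TangentSpace 𝓘(ℝ, E) x} {Z : ∀ p : P, TangentSpace 𝓘(ℝ, F) p}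

/-- `Z` and the horizontal lift of `X` are `π`-related to `ξ` and `X`, hence so are their brackets.
-/
theorem equivariantFunction_mlieBracket (hξ : IsSmoothField ξ) (hX : IsSmoothField X)
    (hZ : IsSmoothField Z) (hZξ : ∀ p, mfderiv 𝓘(ℝ, F) 𝓘(ℝ, E) C.proj p (Z p) = ξ (C.proj p))
    (p : P) : C.equivariantFunction (mlieBracket 𝓘(ℝ, E) ξ X) p =
      C.solder p (mlieBracket 𝓘(ℝ, F) Z (C.fieldLift X) p) := by
  have : CompleteSpace E := FiniteDimensional.complete ℝ E
  have : CompleteSpace F := FiniteDimensional.complete ℝ F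
  rw [equivariantFunction_eq_iff, C.frame_solder]
  exact (mfderiv_mlieBracket_of_related C.contMDiff_proj hZ (C.isSmoothField_fieldLift hX) hξ hX
    hZξ (C.mfderiv_proj_fieldLift X) p).symm

theorem conn_mlieBracket_zField {g : P → Idx m n → ℝ}
    (hg : ContMDiff 𝓘(ℝ, F) 𝓘(ℝ, Idx m n → ℝ) ∞ g) (Z : ∀ p : P, TangentSpace 𝓘(ℝ, F) p) (p : P) :
    C.conn p (mlieBracket 𝓘(ℝ, F) Z (C.zField g) p) =
      zIncl m n Λ (mvfderiv 𝓘(ℝ, F) g p (Z p)) +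
        C.conn p (mlieBracket 𝓘(ℝ, F) Z (C.zField fun _ => g p) p) := by
  have h1 := C.conn_mlieBracket
    ((LinearMap.toContinuousLinearMap (zIncl m n Λ)).contMDiff.comp hg) Z p
  have h2 := mvfderiv_clm_comp (LinearMap.toContinuousLinearMap (zIncl m n Λ))
    ((hg p).mdifferentiableAt (by simp)) (Z p)
  exact h1.trans (congrArg (· + _) h2)

/-- The derivative of an equivariant function along a lift of `ξ`. -/
theorem mvfderiv_equivariantFunction (hξ : IsSmoothField ξ) (hX : IsSmoothField X)
    (hZ : IsSmoothField Z) (hZξ : ∀ p, mfderiv 𝓘(ℝ, F) 𝓘(ℝ, E) C.proj p (Z p) = ξ (C.proj p))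
    (p : P) : mvfderiv 𝓘(ℝ, F) (C.equivariantFunction X) p (Z p) =
      C.equivariantFunction (mlieBracket 𝓘(ℝ, E) ξ X) p -
        C.solder p (mlieBracket 𝓘(ℝ, F) Z (C.zField fun _ => C.equivariantFunction X p) p) := by
  rw [C.equivariantFunction_mlieBracket hξ hX hZ hZξ, solder, solder, fieldLift,
    C.conn_mlieBracket_zField (C.contMDiff_equivariantFunction hX), map_add, zPart_zIncl,
    add_sub_cancel_right]

/-- The form `η`, as a continuous bilinear map. -/
def etaBilin (m n : ℕ) : (Idx m n → ℝ) →L[ℝ] (Idx m n → ℝ) →L[ℝ] ℝ :=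
  LinearMap.toContinuousBilinearMap (Matrix.toLinearMap₂' ℝ (eta m n))

theorem etaBilin_apply (v w : Idx m n → ℝ) : etaBilin m n v w = v ⬝ᵥ (eta m n *ᵥ w) :=
  Matrix.toLinearMap₂'_apply' _ _ _

/-- The product rule for `g(X,Y) ∘ π = η(f_X, f_Y)`, in which `η` is constant. Differentiability of
`g(X,Y)` on `M` is obtained through a local section. -/
theorem dirDeriv_metric (hX : IsSmoothField X) (hY : IsSmoothField Y) (p : P)
    (w : TangentSpace 𝓘(ℝ, F) p) :
    dirDeriv (fun y => C.metric y (X y) (Y y)) (C.proj p)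
      (mfderiv 𝓘(ℝ, F) 𝓘(ℝ, E) C.proj p w) =
      mvfderiv 𝓘(ℝ, F) (C.equivariantFunction X) p w ⬝ᵥ (eta m n *ᵥ C.equivariantFunction Y p) +
      C.equivariantFunction X p ⬝ᵥ
        (eta m n *ᵥ mvfderiv 𝓘(ℝ, F) (C.equivariantFunction Y) p w) := by
  have h0 : (fun q => C.metric (C.proj q) (X (C.proj q)) (Y (C.proj q))) = fun q =>
      etaBilin m n (C.equivariantFunction X q) (C.equivariantFunction Y q) := by
    funext q
    rw [C.metric_field, etaBilin_apply]
  have hXd := C.mdifferentiableAt_equivariantFunction hX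
  have hYd := C.mdifferentiableAt_equivariantFunction hY
  have h1 : MDifferentiableAt 𝓘(ℝ, E) 𝓘(ℝ, ℝ) (fun y => C.metric y (X y) (Y y)) (C.proj p) := by
    obtain ⟨s, hsp, hs, hps⟩ := C.exists_section p
    have e1 : ContMDiff 𝓘(ℝ, F) 𝓘(ℝ, ℝ) ∞ fun q =>
        etaBilin m n (C.equivariantFunction X q) (C.equivariantFunction Y q) :=
      ((etaBilin m n).contMDiff.comp (C.contMDiff_equivariantFunction hX)).clm_apply
        (C.contMDiff_equivariantFunction hY)
    refine ((e1.contMDiffAt.comp (C.proj p) hs).congr_of_eventuallyEq ?_).mdifferentiableAt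
      (by simp)
    filter_upwards [hps] with y hy
    refine Eq.trans ?_ (congrFun h0 (s y))
    rw [hy]
  have h2 := mvfderiv_comp_eq h1 (C.mdifferentiableAt_proj p) w
  rw [h0, mvfderiv_bilin _ (hXd p) (hYd p), etaBilin_apply, etaBilin_apply] at h2
  exact h2.symm

theorem exists_equivariantFunction_eq [T2Space M] (p : P) (z : Idx m n → ℝ) :
    ∃ X : ∀ x : M, TangentSpace 𝓘(ℝ, E) x, IsSmoothField X ∧ C.equivariantFunction X p = z := by
  obtain ⟨X, hX, h⟩ := exists_isSmoothField_eq (C.proj p) (C.frame p z)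
  exact ⟨X, hX, C.equivariantFunction_eq_iff.2 h⟩

theorem LiftTangent.lieDerivMetricEqZero [T2Space M] (hξ : IsSmoothField ξ)
    (h : C.LiftTangent ξ) : LieDerivMetricEqZero ξ C.metric := by
  intro X Y hX hY x
  obtain ⟨p, rfl⟩ := C.proj_surjective x
  obtain ⟨w, hw⟩ := h p
  obtain ⟨hw1, hw2⟩ := (C.mfderiv_toHomBundle_eq_completeLift_iff hξ p w).1 hw
  have h1 := C.dirDeriv_metric hX hY p w
  rw [hw1, hw2 X hX, hw2 Y hY] at h1
  rw [h1, C.metric_field (mlieBracket 𝓘(ℝ, E) ξ X) Y, C.metric_field X]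
  ring

/-- The operator `c ↦ [Z, B_c]` on `𝔷`, up to `𝔥`. -/
def bracketMatrix (Z : ∀ p : P, TangentSpace 𝓘(ℝ, F) p) (p : P) :
    Matrix (Idx m n) (Idx m n) ℝ :=
  of fun i j => C.solder p (mlieBracket 𝓘(ℝ, F) Z (C.zField fun _ => Pi.single j 1) p) i

theorem bracketMatrix_mulVec (Z : ∀ p : P, TangentSpace 𝓘(ℝ, F) p) (p : P) (c : Idx m n → ℝ) :
    C.bracketMatrix Z p *ᵥ c = C.solder p (mlieBracket 𝓘(ℝ, F) Z (C.zField fun _ => c) p) := by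
  have h1 : (C.zField fun _ => c) = fun q => ∑ j, c j • C.zField (fun _ => Pi.single j 1) q := by
    funext q
    simp only [zField, ← map_smul, ← map_sum]
    congr 2
    exact pi_eq_sum_univ' c
  rw [h1, mlieBracket_sum_smul (c := fun j _ => c j) _ (fun _ => contMDiff_const)
    fun j => C.isSmoothField_zField contMDiff_const]
  simp only [mvfderiv_const, _root_.zero_apply, zero_smul, zero_add, solder, map_sum, map_smul]
  funext i
  simp only [Matrix.mulVec, dotProduct, Finset.sum_apply, Pi.smul_apply, smul_eq_mul]
  exact Finset.sum_congr rfl fun j _ => mul_comm _ _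

/-- Along the horizontal lift, `f_X` changes by `f_[ξ,X] - K f_X`. In `L_ξ g = 0` only `η(K f_X,
f_Y) + η(f_X, K f_Y)` survives, and `f_X`, `f_Y` are arbitrary at `p`. -/
theorem isInfOrth_bracketMatrix [T2Space M] (hξ : IsSmoothField ξ)
    (hg : LieDerivMetricEqZero ξ C.metric) (p : P) :
    IsInfOrth (C.bracketMatrix (C.fieldLift ξ) p) := by
  rw [isInfOrth_iff]
  intro v w
  obtain ⟨X, hX, rfl⟩ := C.exists_equivariantFunction_eq p v
  obtain ⟨Y, hY, rfl⟩ := C.exists_equivariantFunction_eq p w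
  have h1 := C.dirDeriv_metric hX hY p (C.fieldLift ξ p)
  have h2 := hg X Y hX hY (C.proj p)
  have h3 := fun {X : ∀ x : M, TangentSpace 𝓘(ℝ, E) x} (hX : IsSmoothField X) =>
    C.mvfderiv_equivariantFunction hξ hX (C.isSmoothField_fieldLift hξ)
      (C.mfderiv_proj_fieldLift ξ) p
  rw [C.mfderiv_proj_fieldLift, h3 hX, h3 hY, ← bracketMatrix_mulVec, ← bracketMatrix_mulVec] at h1
  rw [h1, C.metric_field (mlieBracket 𝓘(ℝ, E) ξ X) Y, C.metric_field X, sub_dotProduct,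
    Matrix.mulVec_sub, dotProduct_sub] at h2
  linarith

/-- The lift of an isometry field to the admissible frame bundle. -/
theorem exists_lift [T2Space M] (hξ : IsSmoothField ξ) (hg : LieDerivMetricEqZero ξ C.metric) :
    ∃ Z : ∀ p : P, TangentSpace 𝓘(ℝ, F) p, IsSmoothField Z ∧
      ∀ p : P, mfderiv 𝓘(ℝ, F) (homModel m n E) C.toHomBundle p (Z p) =
        completeLift ξ (C.toHomBundle p) := by
  have hK := C.isInfOrth_bracketMatrix hξ hg
  set K := C.bracketMatrix (C.fieldLift ξ) with hKdef
  have hKs : ContMDiff 𝓘(ℝ, F) 𝓘(ℝ, modelAlgebra m n Λ) ∞ fun p => hIncl Λ (K p) (hK p) := by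
    apply contMDiff_modelAlgebra
    have h1 : ∀ i j, ContMDiff 𝓘(ℝ, F) 𝓘(ℝ, ℝ) ∞ fun p => K p i j := fun i j =>
      (contMDiff_pi_space.1 (C.contMDiff_solder (isSmoothField_mlieBracket
        (C.isSmoothField_fieldLift hξ) (C.isSmoothField_zField contMDiff_const)))) i
    rintro (i | i) (j | j)
    · exact h1 i j
    all_goals exact contMDiff_const
  have hzs : ContMDiff 𝓘(ℝ, F) 𝓘(ℝ, modelAlgebra m n Λ) ∞
      fun p => zIncl m n Λ (C.equivariantFunction ξ p) :=
    (LinearMap.toContinuousLinearMap (zIncl m n Λ)).contMDiff.comp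
      (C.contMDiff_equivariantFunction hξ)
  -- The lift is the horizontal lift of `ξ` minus the vertical field with value `K`. A vertical
  -- field acts on `f_X` by `-K`, so subtracting it cancels the defect `-K f_X` of the horizontal
  -- lift.
  refine ⟨_, C.isSmoothField_conn_symm (hzs.sub hKs), fun p => ?_⟩
  rw [C.mfderiv_toHomBundle_eq_completeLift_iff hξ, map_sub, map_sub]
  refine ⟨?_, fun X hX => ?_⟩
  · rw [C.mfderiv_proj_conn_symm_hIncl, sub_zero]
    exact C.mfderiv_proj_fieldLift ξ p
  · rw [map_sub, C.mvfderiv_equivariantFunction_hIncl hX, sub_neg_eq_add]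
    have h1 := C.mvfderiv_equivariantFunction hξ hX (C.isSmoothField_fieldLift hξ)
      (C.mfderiv_proj_fieldLift ξ) p
    rw [← bracketMatrix_mulVec] at h1
    exact (congrArg (· + _) h1).trans (sub_add_cancel _ _)

theorem liftTangent_iff [T2Space M] (hξ : IsSmoothField ξ) :
    C.LiftTangent ξ ↔ LieDerivMetricEqZero ξ C.metric :=
  ⟨LiftTangent.lieDerivMetricEqZero C hξ, fun hg p =>
    let ⟨Z, _, hZ⟩ := C.exists_lift hξ hg
    ⟨Z p, hZ p⟩⟩

end CartanGeometry

/-! ### Lie derivatives of the torsion and of the Cartan connection. -/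

namespace CartanGeometry

open Filter Topology VectorField

variable {m n : ℕ} {Λ : SignType}
  {E : Type*} [NormedAddCommGroup E] [NormedSpace ℝ E] [FiniteDimensional ℝ E]
  {M : Type*} [TopologicalSpace M] [ChartedSpace E M] [IsManifold 𝓘(ℝ, E) ∞ M] [T2Space M]
  {F : Type*} [NormedAddCommGroup F] [NormedSpace ℝ F] [FiniteDimensional ℝ F]
  {P : Type*} [TopologicalSpace P] [ChartedSpace F P] [IsManifold 𝓘(ℝ, F) ∞ P]
  (C : CartanGeometry m n Λ (E := E) M (F := F) P)
  {ξ X Y : ∀ x : M, TangentSpace 𝓘(ℝ, E) x} {Z : ∀ p : P, TangentSpace 𝓘(ℝ, F) p}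

/-- A smooth vector field on `P` which is the restriction of the complete lift of `ξ`. -/
structure IsLift (ξ : ∀ x : M, TangentSpace 𝓘(ℝ, E) x) (Z : ∀ p : P, TangentSpace 𝓘(ℝ, F) p) :
    Prop where
  isSmoothField : IsSmoothField Z
  mfderiv_toHomBundle : ∀ p : P, mfderiv 𝓘(ℝ, F) (homModel m n E) C.toHomBundle p (Z p) =
    completeLift ξ (C.toHomBundle p)

variable {C}

namespace IsLift

theorem mfderiv_proj (hZ : C.IsLift ξ Z) (hξ : IsSmoothField ξ) (p : P) :
    mfderiv 𝓘(ℝ, F) 𝓘(ℝ, E) C.proj p (Z p) = ξ (C.proj p) :=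
  ((C.mfderiv_toHomBundle_eq_completeLift_iff hξ p _).1 (hZ.mfderiv_toHomBundle p)).1

theorem mvfderiv_equivariantFunction (hZ : C.IsLift ξ Z) (hξ : IsSmoothField ξ)
    (hX : IsSmoothField X) (p : P) : mvfderiv 𝓘(ℝ, F) (C.equivariantFunction X) p (Z p) =
      C.equivariantFunction (mlieBracket 𝓘(ℝ, E) ξ X) p :=
  ((C.mfderiv_toHomBundle_eq_completeLift_iff hξ p _).1 (hZ.mfderiv_toHomBundle p)).2 X hX

/-- For any smooth lift of `ξ` this `𝔷`-part is the defect in `Z f_X = f_[ξ,X]`; for the complete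
lift there is no defect. -/
theorem solder_mlieBracket (hZ : C.IsLift ξ Z) (hξ : IsSmoothField ξ) (p : P) (c : Idx m n → ℝ) :
    C.solder p (mlieBracket 𝓘(ℝ, F) Z (C.zField fun _ => c) p) = 0 := by
  obtain ⟨X, hX, rfl⟩ := C.exists_equivariantFunction_eq p c
  have h1 := C.mvfderiv_equivariantFunction hξ hX hZ.isSmoothField (hZ.mfderiv_proj hξ) p
  rw [hZ.mvfderiv_equivariantFunction hξ hX] at h1
  exact sub_eq_self.1 h1.symm

/-- The complete lift commutes with fundamental vector fields. -/
theorem mlieBracket_hIncl (hZ : C.IsLift ξ Z) (hξ : IsSmoothField ξ)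
    {K : Matrix (Idx m n) (Idx m n) ℝ} (hK : IsInfOrth K) (p : P) :
    mlieBracket 𝓘(ℝ, F) Z (fun q => (C.conn q).symm (hIncl Λ K hK)) p = 0 := by
  have : CompleteSpace E := FiniteDimensional.complete ℝ E
  have : CompleteSpace F := FiniteDimensional.complete ℝ F
  have hKs : IsSmoothField (fun q => (C.conn q).symm (hIncl Λ K hK)) :=
    C.isSmoothField_conn_symm contMDiff_const
  have h0 : IsSmoothField (0 : ∀ x : M, TangentSpace 𝓘(ℝ, E) x) :=
    Bundle.contMDiff_zeroSection ℝ (TangentSpace 𝓘(ℝ, E))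
  -- The fundamental field is `π`-related to `0`, so the bracket is vertical and equals the
  -- fundamental vector of some `K'` at `p`.
  have h1 := mfderiv_mlieBracket_of_related C.contMDiff_proj hZ.isSmoothField hKs hξ h0
    (hZ.mfderiv_proj hξ) (fun q => C.mfderiv_proj_conn_symm_hIncl hK q) p
  rw [mlieBracket_zero_right] at h1
  obtain ⟨K', hK', h2⟩ := C.exists_isInfOrth_of_mfderiv_proj_eq_zero h1
  -- As derivations of the `f_X` the two fields commute: `Z` replaces `X` by `[ξ,X]`, and the
  -- fundamental field multiplies by the constant matrix `-K`. Hence `K'` annihilates all values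
  -- `f_X(p)`.
  have h3 : ∀ z, K' *ᵥ z = 0 := by
    intro z
    obtain ⟨X, hX, rfl⟩ := C.exists_equivariantFunction_eq p z
    have h4 := mvfderiv_mlieBracket hZ.isSmoothField hKs (C.contMDiff_equivariantFunction hX p)
    have h5 : (fun q => mvfderiv 𝓘(ℝ, F) (C.equivariantFunction X) q
        ((C.conn q).symm (hIncl Λ K hK))) = fun q =>
        LinearMap.toContinuousLinearMap (-Matrix.mulVecLin K) (C.equivariantFunction X q) :=
      funext fun q => C.mvfderiv_equivariantFunction_hIncl hX hK q
    have h6 : (fun q => mvfderiv 𝓘(ℝ, F) (C.equivariantFunction X) q (Z q)) =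
        C.equivariantFunction (mlieBracket 𝓘(ℝ, E) ξ X) :=
      funext fun q => hZ.mvfderiv_equivariantFunction hξ hX q
    rw [h5, h6, mvfderiv_clm_comp _ (C.mdifferentiableAt_equivariantFunction hX p),
      hZ.mvfderiv_equivariantFunction hξ hX, h2, C.mvfderiv_equivariantFunction_hIncl hX,
      C.mvfderiv_equivariantFunction_hIncl (isSmoothField_mlieBracket hξ hX)] at h4
    refine neg_eq_zero.1 (h4.trans ?_)
    exact sub_self _
  have h7 : K' = 0 := by
    ext i j
    simpa using congrFun (h3 (Pi.single j 1)) i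
  rw [h2]
  subst h7
  exact (LinearEquiv.map_eq_zero_iff _).2 (modelAlgebra_ext rfl rfl)

/-- The `𝔥`-part of the bracket of the complete lift with `B_c`. -/
theorem mlieBracket_zField_const (hZ : C.IsLift ξ Z) (hξ : IsSmoothField ξ) (p : P)
    (c : Idx m n → ℝ) : mlieBracket 𝓘(ℝ, F) Z (C.zField fun _ => c) p =
      (C.conn p).symm (hIncl Λ _ (isInfOrth_hPart
        (C.conn p (mlieBracket 𝓘(ℝ, F) Z (C.zField fun _ => c) p)))) := by
  rw [LinearEquiv.eq_symm_apply]
  exact modelAlgebra_ext rfl (hZ.solder_mlieBracket hξ p c)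

theorem mlieBracket_fieldLift (hZ : C.IsLift ξ Z) (hξ : IsSmoothField ξ) (hX : IsSmoothField X)
    (p : P) : mlieBracket 𝓘(ℝ, F) Z (C.fieldLift X) p =
      C.fieldLift (mlieBracket 𝓘(ℝ, E) ξ X) p +
        mlieBracket 𝓘(ℝ, F) Z (C.zField fun _ => C.equivariantFunction X p) p := by
  apply (C.conn p).injective
  rw [fieldLift, C.conn_mlieBracket_zField (C.contMDiff_equivariantFunction hX),
    hZ.mvfderiv_equivariantFunction hξ hX, map_add, fieldLift, zField,
    LinearEquiv.apply_symm_apply]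

/-- `Z` is moved past the horizontal lift of `X`. Their bracket is the horizontal lift of `[ξ,X]`
plus a vertical term, which contributes the matrix acting on `f_Y`. -/
theorem mvfderiv_mvfderiv_fieldLift (hZ : C.IsLift ξ Z) (hξ : IsSmoothField ξ)
    (hX : IsSmoothField X) (hY : IsSmoothField Y) (p : P) :
    mvfderiv 𝓘(ℝ, F) (fun q => mvfderiv 𝓘(ℝ, F) (C.equivariantFunction Y) q (C.fieldLift X q)) p
      (Z p) =
      mvfderiv 𝓘(ℝ, F) (C.equivariantFunction Y) p (C.fieldLift (mlieBracket 𝓘(ℝ, E) ξ X) p) -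
        hPart m n Λ (C.conn p (mlieBracket 𝓘(ℝ, F) Z
          (C.zField fun _ => C.equivariantFunction X p) p)) *ᵥ C.equivariantFunction Y p +
      mvfderiv 𝓘(ℝ, F) (C.equivariantFunction (mlieBracket 𝓘(ℝ, E) ξ Y)) p (C.fieldLift X p) := by
  have : CompleteSpace F := FiniteDimensional.complete ℝ F
  have h1 := mvfderiv_mlieBracket hZ.isSmoothField (C.isSmoothField_fieldLift hX)
    (C.contMDiff_equivariantFunction hY p)
  have h2 : (fun q => mvfderiv 𝓘(ℝ, F) (C.equivariantFunction Y) q (Z q)) =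
      C.equivariantFunction (mlieBracket 𝓘(ℝ, E) ξ Y) :=
    funext fun q => hZ.mvfderiv_equivariantFunction hξ hY q
  rw [h2, hZ.mlieBracket_fieldLift hξ hX, hZ.mlieBracket_zField_const hξ, map_add,
    C.mvfderiv_equivariantFunction_hIncl hY] at h1
  rw [sub_eq_add_neg]
  exact (sub_eq_iff_eq_add.1 h1.symm)

/-- The Lie derivative of the torsion in terms of the complete lift. -/
theorem equivariantFunction_lieDerivTorsion (hZ : C.IsLift ξ Z) (hξ : IsSmoothField ξ)
    (hX : IsSmoothField X) (hY : IsSmoothField Y) (p : P) :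
    C.equivariantFunction (mlieBracket 𝓘(ℝ, E) ξ (C.torsion X Y)) p -
      C.equivariantFunction (C.torsion (mlieBracket 𝓘(ℝ, E) ξ X) Y) p -
      C.equivariantFunction (C.torsion X (mlieBracket 𝓘(ℝ, E) ξ Y)) p =
      hPart m n Λ (C.conn p (mlieBracket 𝓘(ℝ, F) Z
          (C.zField fun _ => C.equivariantFunction Y p) p)) *ᵥ C.equivariantFunction X p -
      hPart m n Λ (C.conn p (mlieBracket 𝓘(ℝ, F) Z
          (C.zField fun _ => C.equivariantFunction X p) p)) *ᵥ C.equivariantFunction Y p := by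
  have hξX := isSmoothField_mlieBracket hξ hX
  have hξY := isSmoothField_mlieBracket hξ hY
  have hXY := isSmoothField_mlieBracket hX hY
  have hd : ∀ {X Y : ∀ x : M, TangentSpace 𝓘(ℝ, E) x}, IsSmoothField X → IsSmoothField Y →
      MDifferentiableAt 𝓘(ℝ, F) 𝓘(ℝ, Idx m n → ℝ)
        (fun q => mvfderiv 𝓘(ℝ, F) (C.equivariantFunction Y) q (C.fieldLift X q)) p :=
    fun hX hY => (contMDiff_mvfderiv (C.isSmoothField_fieldLift hX)
      (C.contMDiff_equivariantFunction hY) p).mdifferentiableAt (by simp)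
  have h1 := hZ.mvfderiv_equivariantFunction hξ (C.isSmoothField_torsion hX hY) p
  have h2 : C.equivariantFunction (C.torsion X Y) = _ :=
    funext fun q => C.equivariantFunction_torsion hX hY q
  have h3 : mvfderiv 𝓘(ℝ, F) (C.equivariantFunction (C.torsion X Y)) p (Z p) =
      mvfderiv 𝓘(ℝ, F) (fun q => mvfderiv 𝓘(ℝ, F) (C.equivariantFunction Y) q (C.fieldLift X q)) p
        (Z p) -
      mvfderiv 𝓘(ℝ, F) (fun q => mvfderiv 𝓘(ℝ, F) (C.equivariantFunction X) q (C.fieldLift Y q)) p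
        (Z p) - mvfderiv 𝓘(ℝ, F) (C.equivariantFunction (mlieBracket 𝓘(ℝ, E) X Y)) p (Z p) := by
    rw [h2]
    have h4 := (((hd hX hY).hasMFDerivAt.sub (hd hY hX).hasMFDerivAt).sub
      (C.mdifferentiableAt_equivariantFunction hXY p).hasMFDerivAt).mfderiv
    exact DFunLike.congr_fun h4 (Z p)
  -- The Jacobi identity matches the bracket terms of the three torsions, so that only the vertical
  -- corrections remain.
  have hJ : C.equivariantFunction (mlieBracket 𝓘(ℝ, E) ξ (mlieBracket 𝓘(ℝ, E) X Y)) p =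
      C.equivariantFunction (mlieBracket 𝓘(ℝ, E) (mlieBracket 𝓘(ℝ, E) ξ X) Y) p +
      C.equivariantFunction (mlieBracket 𝓘(ℝ, E) X (mlieBracket 𝓘(ℝ, E) ξ Y)) p := by
    rw [equivariantFunction, leibniz_mlieBracket hξ hX hY, map_add]
    rfl
  rw [hZ.mvfderiv_mvfderiv_fieldLift hξ hX hY, hZ.mvfderiv_mvfderiv_fieldLift hξ hY hX,
    hZ.mvfderiv_equivariantFunction hξ hXY, hJ, h1] at h3
  rw [h3, C.equivariantFunction_torsion hξX hY, C.equivariantFunction_torsion hX hξY]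
  abel

/-- With `κ(c)` the `𝔥`-part of `A([Z, B_c])`, vanishing of `L_ξ T` means `κ(v) w = κ(w) v`, which
forces `κ = 0` since `κ` takes values in `𝔬(m,n)`. The `𝔷`-part vanishes for every complete lift. -/
theorem lieDerivTorsionEqZero_iff (hZ : C.IsLift ξ Z) (hξ : IsSmoothField ξ) :
    LieDerivTorsionEqZero ξ C.torsion ↔
      ∀ p c, C.conn p (mlieBracket 𝓘(ℝ, F) Z (C.zField fun _ => c) p) = 0 := by
  have key : ∀ X Y : ∀ x : M, TangentSpace 𝓘(ℝ, E) x, ∀ p,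
      mlieBracket 𝓘(ℝ, E) ξ (C.torsion X Y) (C.proj p) -
        C.torsion (mlieBracket 𝓘(ℝ, E) ξ X) Y (C.proj p) -
        C.torsion X (mlieBracket 𝓘(ℝ, E) ξ Y) (C.proj p) = 0 ↔
      C.equivariantFunction (mlieBracket 𝓘(ℝ, E) ξ (C.torsion X Y)) p -
        C.equivariantFunction (C.torsion (mlieBracket 𝓘(ℝ, E) ξ X) Y) p -
        C.equivariantFunction (C.torsion X (mlieBracket 𝓘(ℝ, E) ξ Y)) p = 0 := by
    intro X Y p
    rw [← (C.frame_isInvertible p).injective.eq_iff (b := 0), map_sub, map_sub, map_zero,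
      frame_equivariantFunction, frame_equivariantFunction, frame_equivariantFunction]
  constructor
  · intro hT p c
    refine modelAlgebra_ext ?_ (hZ.solder_mlieBracket hξ p c)
    refine eq_zero_of_symm_infOrth (κ := fun c => hPart m n Λ (C.conn p
      (mlieBracket 𝓘(ℝ, F) Z (C.zField fun _ => c) p))) (fun _ => isInfOrth_hPart _) ?_ c
    intro v w
    obtain ⟨X, hX, rfl⟩ := C.exists_equivariantFunction_eq p v
    obtain ⟨Y, hY, rfl⟩ := C.exists_equivariantFunction_eq p w
    have h1 := (key X Y p).1 (hT X Y hX hY _)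
    rw [hZ.equivariantFunction_lieDerivTorsion hξ hX hY] at h1
    exact (sub_eq_zero.1 h1).symm
  · intro h X Y hX hY x
    obtain ⟨p, rfl⟩ := C.proj_surjective x
    rw [key, hZ.equivariantFunction_lieDerivTorsion hξ hX hY, h, h]
    simp

/-- The Lie derivative of the Cartan connection in terms of constant vector fields. -/
theorem conn_mlieBracket_field (hZ : C.IsLift ξ Z) (hξ : IsSmoothField ξ)
    {V : ∀ p : P, TangentSpace 𝓘(ℝ, F) p} (hV : IsSmoothField V) (p : P) :
    C.conn p (mlieBracket 𝓘(ℝ, F) Z V p) =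
      mvfderiv 𝓘(ℝ, F) (fun q => C.conn q (V q)) p (Z p) +
        C.conn p (mlieBracket 𝓘(ℝ, F) Z (C.zField fun _ => C.solder p (V p)) p) := by
  have : IsManifold 𝓘(ℝ, F) 2 P := IsManifold.of_le (n := ∞) two_le_infty
  have : CompleteSpace F := FiniteDimensional.complete ℝ F
  have h1 : V = fun q => (C.conn q).symm (C.conn q (V q)) :=
    funext fun q => ((C.conn q).symm_apply_apply _).symm
  conv_lhs => rw [h1]
  rw [C.conn_mlieBracket (C.contMDiff_conn_field hV)]
  have hK : IsInfOrth (hPart m n Λ (C.conn p (V p))) := isInfOrth_hPart _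
  -- The value `A(V)` frozen at `p` is split into its `𝔥`- and `𝔷`-parts; the `𝔥`-part gives a
  -- fundamental field, which commutes with `Z`.
  have h2 : (fun q => (C.conn q).symm (C.conn p (V p))) =
      (fun q => (C.conn q).symm (hIncl Λ _ hK)) + C.zField fun _ => C.solder p (V p) := by
    funext q
    change _ = (C.conn q).symm _ + (C.conn q).symm _
    rw [← map_add]
    exact congrArg _ (hIncl_add_zIncl _).symm
  rw [h2, mlieBracket_add_right
    ((C.isSmoothField_conn_symm contMDiff_const).mdifferentiableAt p)
    ((C.isSmoothField_zField contMDiff_const).mdifferentiableAt p), hZ.mlieBracket_hIncl hξ,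
    zero_add]

/-- By `conn_mlieBracket_field` the derivative of `A(V)` cancels and `(L_Z A)(V) = -A([Z, B_c])`,
with `c` the `𝔷`-part of `A(V)` at the point. -/
theorem lieDerivConn_iff (hZ : C.IsLift ξ Z) (hξ : IsSmoothField ξ) :
    (∀ V : ∀ p : P, TangentSpace 𝓘(ℝ, F) p, IsSmoothField V →
      ∀ (p : P) (i j : Idx m n ⊕ Unit),
      dirDeriv (fun q => (C.conn q (V q) : Matrix (Idx m n ⊕ Unit) (Idx m n ⊕ Unit) ℝ) i j) p (Z p)
        - (C.conn p (mlieBracket 𝓘(ℝ, F) Z V p) :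
            Matrix (Idx m n ⊕ Unit) (Idx m n ⊕ Unit) ℝ) i j = 0) ↔
      ∀ p c, C.conn p (mlieBracket 𝓘(ℝ, F) Z (C.zField fun _ => c) p) = 0 := by
  have key : ∀ V : ∀ p : P, TangentSpace 𝓘(ℝ, F) p, IsSmoothField V →
      ∀ (p : P) (i j : Idx m n ⊕ Unit),
      dirDeriv (fun q => (C.conn q (V q) : Matrix (Idx m n ⊕ Unit) (Idx m n ⊕ Unit) ℝ) i j) p (Z p)
        - (C.conn p (mlieBracket 𝓘(ℝ, F) Z V p) :
            Matrix (Idx m n ⊕ Unit) (Idx m n ⊕ Unit) ℝ) i j =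
      -(C.conn p (mlieBracket 𝓘(ℝ, F) Z (C.zField fun _ => C.solder p (V p)) p) :
            Matrix (Idx m n ⊕ Unit) (Idx m n ⊕ Unit) ℝ) i j := by
    intro V hV p i j
    let L : modelAlgebra m n Λ →ₗ[ℝ] ℝ :=
      { toFun := fun x => (x : Matrix (Idx m n ⊕ Unit) (Idx m n ⊕ Unit) ℝ) i j
        map_add' := fun _ _ => rfl
        map_smul' := fun _ _ => rfl }
    have h1 := mvfderiv_clm_comp (LinearMap.toContinuousLinearMap L)
      ((C.contMDiff_conn_field hV p).mdifferentiableAt (by simp)) (Z p)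
    have h2 := congrArg L (hZ.conn_mlieBracket_field hξ hV p)
    rw [map_add] at h2
    have h3 : dirDeriv (fun q => L (C.conn q (V q))) p (Z p) =
      L (mvfderiv 𝓘(ℝ, F) (fun q => C.conn q (V q)) p (Z p)) := h1
    change dirDeriv (fun q => L (C.conn q (V q))) p (Z p) -
      L (C.conn p (mlieBracket 𝓘(ℝ, F) Z V p)) = -L _
    rw [h3, h2]
    ring
  constructor
  · intro h p c
    apply Subtype.ext
    ext i j
    have hB : IsSmoothField (C.zField fun _ => c) := C.isSmoothField_zField contMDiff_const
    have h1 := h _ hB p i j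
    rw [key _ hB, C.solder_zField] at h1
    exact neg_eq_zero.1 h1
  · intro h V hV p i j
    rw [key V hV, h]
    simp

end IsLift

variable (C)

/-- For a given lift `Z`, invariance of the connection and of the torsion are the same condition
`[Z, B_c] = 0` for all `c`; the metric condition supplies the lift. -/
theorem isInvariant_iff (hξ : IsSmoothField ξ) : C.IsInvariant ξ ↔
    LieDerivMetricEqZero ξ C.metric ∧ LieDerivTorsionEqZero ξ C.torsion := by
  constructor
  · rintro ⟨hL, Z, hZs, hZl, hZ⟩
    have hZL : C.IsLift ξ Z := ⟨hZs, hZl⟩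
    exact ⟨hL.lieDerivMetricEqZero C hξ,
      (hZL.lieDerivTorsionEqZero_iff hξ).2 ((hZL.lieDerivConn_iff hξ).1 hZ)⟩
  · rintro ⟨hg, hT⟩
    obtain ⟨Z, hZs, hZl⟩ := C.exists_lift hξ hg
    have hZL : C.IsLift ξ Z := ⟨hZs, hZl⟩
    exact ⟨fun p => ⟨Z p, hZl p⟩, Z, hZs, hZl,
      (hZL.lieDerivConn_iff hξ).2 ((hZL.lieDerivTorsionEqZero_iff hξ).1 hT)⟩

end CartanGeometry

end RiemannCartan

end

theorem mainTheorem3 (m n : ℕ) (Λ : SignType)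
    {E : Type*} [NormedAddCommGroup E] [NormedSpace ℝ E] [FiniteDimensional ℝ E]
    {M : Type*} [TopologicalSpace M] [ChartedSpace E M] [IsManifold 𝓘(ℝ, E) ∞ M] [T2Space M]
    {F : Type*} [NormedAddCommGroup F] [NormedSpace ℝ F] [FiniteDimensional ℝ F]
    {P : Type*} [TopologicalSpace P] [ChartedSpace F P] [IsManifold 𝓘(ℝ, F) ∞ P] [T2Space P]
    (C : RiemannCartan.CartanGeometry m n Λ (E := E) M (F := F) P)
    (ξ : ∀ x : M, TangentSpace 𝓘(ℝ, E) x) (hξ : RiemannCartan.IsSmoothField ξ) :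
    (C.IsInvariant ξ ↔
      RiemannCartan.LieDerivMetricEqZero ξ C.metric ∧
      RiemannCartan.LieDerivTorsionEqZero ξ C.torsion) ∧
    (C.LiftTangent ξ ↔ RiemannCartan.LieDerivMetricEqZero ξ C.metric) :=
  ⟨C.isInvariant_iff hξ, C.liftTangent_iff hξ⟩
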